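/- Let $n\ge 1$, let $\widetilde M^{n+1}$ be a smooth (Hausdorff) Riemannian manifold, not necessarily complete, and let $f:M^n\to\widetilde M^{n+1}$ be a smooth immersed hypersurface with a smooth unit normal field $N$ (a 2-sided hypersurface). For a unit normal field $\nu$ the shape operator is $A_\nu X=-\widetilde\nabla_X\nu$ and the mean curvature is $H=\frac1n\operatorname{tr}A_\nu$. Write $\gamma_x(r)=\exp_{f(x)}(rN(x))$ on the maximal interval where this is defined. For a unit normal field $\nu$ of $f$, call $f$ *isoparametric on the side of $\nu$* if there is $r_0>0$ such that for every $0\le r<r_0$ the map $x\mapsto\exp_{f(x)}(r\,\nu(x))$ is defined on all of $M$, is an immersion with unit normal field $\frac{d}{dr}\exp_{f(x)}(r\,\nu(x))$, and has constant mean curvature with respect to this normal field. Let $0<\delta\le T\le\infty$ and let $F:M\times[0,T)\to\widetilde M$ be a smooth solution of the mean curvature flow with initial data $f$: each $F(\cdot,t)$ is an immersion with a smooth unit normal field $N(\cdot,t)$ and mean curvature $H(\cdot,t)$, and $\partial_tF=HN$, $F(\cdot,0)=f$. Suppose that on $[0,\delta)$ the flow is a reparametrization of the parallel flow: there is a continuous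 $\epsilon:[0,\delta)\to\mathbb R$ with $\epsilon(0)=0$ such that $\exp_{f(x)}(\epsilon(t)N(x))$ is defined and $F(x,t)=\exp_{f(x)}(\epsilon(t)N(x))$ for all $x\in M$, $t\in[0,\delta)$. Then the following hold. 1. If $\epsilon$ is not identically zero, then $f$ is isoparametric on the side into which it moves: if $\epsilon(t)>0$ for some $t\in[0,\delta)$, then $f$ is isoparametric on the side of $N$, and if $\epsilon(t)<0$ for some $t\in[0,\delta)$, then $f$ is isoparametric on the side of $-N$. 2. For every $x\in M$ there is a solution $D$, an $\operatorname{End}(\dot\gamma_x^\perp)$-valued tensor field along $\gamma_x$, of $$D''+\widetilde R(D,\dot\gamma_x)\dot\gamma_x=0,\qquad D(0)=\mathrm{id}_{T_xM},\qquad D'(0)=-A_{N(x)},$$ where $'$ is the covariant derivative along $\gamma_x$ and $\widetilde R(X,Y)Z=\widetilde\nabla_X\widetilde\nabla_YZ-\widetilde\nabla_Y\widetilde\nabla_XZ-\widetilde\nabla_{[X,Y]}Z$. For every $x$, every such $D$ and every $t\in[0,\delta)$, $\det D(\epsilon(t))\neq0$, $\det D$ is differentiable at $\epsilon(t)$, and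 $\epsilon$ is differentiable at $t$ (from the right at $t=0$) with $$\epsilon'(t)=-\frac{(\det D)'}{n\det D}(\epsilon(t)).$$ 3. The right-hand side of this equation does not depend on $x\in M$. -/

import Mathlib

open Set Manifold ContDiff

set_option maxSynthPendingDepth 3

noncomputable section AmbientGeometry

/-! ### Riemannian geometry of the ambient manifold

Everything is computed at a point `p` in the preferred chart of Mathlib at `p`. In that chart the
tangent space `TangentSpace 𝓘(ℝ, E) p` is identified with `E` by the identity map, so the
coordinate formulas below directly give the invariant objects at `p`. -/

variable {E : Type*} [NormedAddCommGroup E] [NormedSpace ℝ E]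
  {P : Type*} [TopologicalSpace P] [ChartedSpace E P] [IsManifold 𝓘(ℝ, E) ∞ P]

/-- A smooth Riemannian metric on `P` (no completeness is assumed). -/
abbrev SmoothMetric (E : Type*) [NormedAddCommGroup E] [NormedSpace ℝ E]
    (P : Type*) [TopologicalSpace P] [ChartedSpace E P] [IsManifold 𝓘(ℝ, E) ∞ P] :=
  Bundle.ContMDiffRiemannianMetric 𝓘(ℝ, E) ∞ E (fun p : P => TangentSpace 𝓘(ℝ, E) p)

/-- Coordinates, in the chart at `p`, of the vectors tangent to `P` at `q`. -/
def toChart (p q : P) : TangentSpace 𝓘(ℝ, E) q →L[ℝ] E :=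
  mfderiv 𝓘(ℝ, E) 𝓘(ℝ, E) (extChartAt 𝓘(ℝ, E) p) q

/-- The tangent vector at the point with coordinates `u` in the chart at `p`, from its
coordinates. -/
def fromChart (p : P) (u : E) :
    E →L[ℝ] TangentSpace 𝓘(ℝ, E) ((extChartAt 𝓘(ℝ, E) p).symm u) :=
  mfderiv 𝓘(ℝ, E) 𝓘(ℝ, E) (extChartAt 𝓘(ℝ, E) p).symm u

/-- The metric in the chart at `p`: the matrix `g_ij(u)` as a bilinear form. -/
def chartMetric (g : SmoothMetric E P) (p : P) (u : E) : E →L[ℝ] E →L[ℝ] ℝ :=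
  (show E →L[ℝ] E →L[ℝ] ℝ from g.inner ((extChartAt 𝓘(ℝ, E) p).symm u)).bilinearComp
    (show E →L[ℝ] E from fromChart p u) (show E →L[ℝ] E from fromChart p u)

/-- The Christoffel symbols of the first kind:
`Γ(v, w; z) = ½ (∂_v g(w, z) + ∂_w g(v, z) - ∂_z g(v, w))`. -/
def christoffelFirst (g : SmoothMetric E P) (p : P) (u : E) : E →L[ℝ] E →L[ℝ] E →L[ℝ] ℝ :=
  let T : E →L[ℝ] E →L[ℝ] E →L[ℝ] ℝ := fderiv ℝ (chartMetric g p) u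
  let T' : E →L[ℝ] E →L[ℝ] E →L[ℝ] ℝ := T.flip
  let T'' : E →L[ℝ] E →L[ℝ] E →L[ℝ] ℝ :=
    ((ContinuousLinearMap.flipₗᵢ ℝ E E ℝ).toContinuousLinearEquiv :
      (E →L[ℝ] E →L[ℝ] ℝ) →L[ℝ] (E →L[ℝ] E →L[ℝ] ℝ)).comp T'
  (1 / 2 : ℝ) • (T + T' - T'')

theorem christoffelFirst_apply (g : SmoothMetric E P) (p : P) (u v w z : E) :
    christoffelFirst g p u v w z = (1 / 2 : ℝ) * (fderiv ℝ (chartMetric g p) u v w z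
      + fderiv ℝ (chartMetric g p) u w v z - fderiv ℝ (chartMetric g p) u z v w) := by
  simp [christoffelFirst]

/-- The Christoffel symbols of the second kind `Γ(v, w)` of the Levi-Civita connection, in the
chart at `p` and at the coordinates `u`, so that `∇_v W = ∂_v W + Γ(v, W)`: the index of
`christoffelFirst` is raised with the inverse of the metric. -/
def christoffel (g : SmoothMetric E P) (p : P) (u : E) : E →L[ℝ] E →L[ℝ] E :=
  (ContinuousLinearMap.compL ℝ E (E →L[ℝ] ℝ) E (chartMetric g p u).inverse).comp
    (christoffelFirst g p u)

/-- `Γ` at the base point of the chart at `p`. -/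
def christoffelAt (g : SmoothMetric E P) (p : P) : E →L[ℝ] E →L[ℝ] E :=
  christoffel g p (extChartAt 𝓘(ℝ, E) p p)

/-- The Riemann curvature tensor
`R(X, Y) Z = ∇_X ∇_Y Z - ∇_Y ∇_X Z - ∇_[X, Y] Z` of the Levi-Civita connection. -/
def curvature (g : SmoothMetric E P) (p : P) (X Y Z : TangentSpace 𝓘(ℝ, E) p) :
    TangentSpace 𝓘(ℝ, E) p :=
  let Γ : E →L[ℝ] E →L[ℝ] E := christoffelAt g p
  let dΓ : E →L[ℝ] E →L[ℝ] E →L[ℝ] E :=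
    fderiv ℝ (christoffel g p) (extChartAt 𝓘(ℝ, E) p p)
  (dΓ X Y Z - dΓ Y X Z + Γ X (Γ Y Z) - Γ Y (Γ X Z) : E)

/-- The covariant derivative `X ↦ ∇_X V` at `s` of a vector field `V` along a map
`f : S → P`. -/
def covDerivAlong {E₀ : Type*} [NormedAddCommGroup E₀] [NormedSpace ℝ E₀]
    {S : Type*} [TopologicalSpace S] [ChartedSpace E₀ S] (g : SmoothMetric E P)
    (f : S → P) (V : ∀ s, TangentSpace 𝓘(ℝ, E) (f s)) (s : S) :
    TangentSpace 𝓘(ℝ, E₀) s →L[ℝ] TangentSpace 𝓘(ℝ, E) (f s) :=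
  (show TangentSpace 𝓘(ℝ, E₀) s →L[ℝ] E from
      mfderiv 𝓘(ℝ, E₀) 𝓘(ℝ, E) (fun s' => toChart (f s) (f s') (V s')) s)
    + ((christoffelAt g (f s)).flip (V s)).comp
        (show TangentSpace 𝓘(ℝ, E₀) s →L[ℝ] E from mfderiv 𝓘(ℝ, E₀) 𝓘(ℝ, E) f s)

/-- The velocity of a curve. -/
def velocity (γ : ℝ → P) (t : ℝ) : TangentSpace 𝓘(ℝ, E) (γ t) :=
  mfderiv 𝓘(ℝ, ℝ) 𝓘(ℝ, E) γ t (1 : ℝ)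

/-- `γ` is a geodesic on the open set `J ⊆ ℝ`. -/
def IsGeodesicOn (g : SmoothMetric E P) (γ : ℝ → P) (J : Set ℝ) : Prop :=
  IsOpen J ∧ ContMDiffOn 𝓘(ℝ, ℝ) 𝓘(ℝ, E) ∞ γ J ∧
    ∀ t ∈ J, covDerivAlong g γ (velocity γ) t (1 : ℝ) = 0

/-- `γ` is a geodesic on an open interval containing `[0, 1]`, issuing from `x` with velocity
`v`. -/
def IsExpGeodesic (g : SmoothMetric E P) (x : P) (v : TangentSpace 𝓘(ℝ, E) x)
    (γ : ℝ → P) : Prop :=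
  ∃ J : Set ℝ, J.OrdConnected ∧ (0 : ℝ) ∈ J ∧ (1 : ℝ) ∈ J ∧ IsGeodesicOn g γ J ∧
    (⟨γ 0, velocity γ 0⟩ : TangentBundle 𝓘(ℝ, E) P) = ⟨x, v⟩

/-- `v` lies in the domain of the exponential map at `x`. -/
def ExpDefined (g : SmoothMetric E P) (x : P) (v : TangentSpace 𝓘(ℝ, E) x) : Prop :=
  ∃ γ : ℝ → P, IsExpGeodesic g x v γ

open Classical in
/-- The exponential map `exp_x v`, the value at time `1` of the geodesic issuing from `x` with
velocity `v`; it is meaningful on its domain `ExpDefined`. -/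
def expMap (g : SmoothMetric E P) (x : P) (v : TangentSpace 𝓘(ℝ, E) x) : P :=
  if h : ExpDefined g x v then h.choose 1 else x

/-- An endomorphism of the tangent space at `q`, in the coordinates of the chart at `p`. -/
def endInChart (p q : P) (L : TangentSpace 𝓘(ℝ, E) q →L[ℝ] TangentSpace 𝓘(ℝ, E) q) :
    E →L[ℝ] E :=
  (toChart p q).comp (L.comp (show E →L[ℝ] TangentSpace 𝓘(ℝ, E) q from
    fromChart p (extChartAt 𝓘(ℝ, E) p q)))

/-- The covariant derivative along `γ` of a field of endomorphisms of the tangent spaces,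
`D' = ∂D + Γ(γ', ·) ∘ D - D ∘ Γ(γ', ·)`, so that `(D V)' = D' V + D V'` for vector fields `V`. -/
def covDerivEnd (g : SmoothMetric E P) (γ : ℝ → P)
    (D : ∀ r, TangentSpace 𝓘(ℝ, E) (γ r) →L[ℝ] TangentSpace 𝓘(ℝ, E) (γ r)) (r : ℝ) :
    TangentSpace 𝓘(ℝ, E) (γ r) →L[ℝ] TangentSpace 𝓘(ℝ, E) (γ r) :=
  let Γ : E →L[ℝ] E := christoffelAt g (γ r) (velocity γ r)
  let D₀ : E →L[ℝ] E := D r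
  (deriv (fun s => endInChart (γ r) (γ s) (D s)) r + Γ.comp D₀ - D₀.comp Γ : E →L[ℝ] E)

/-- The hyperplane `γ'(r)^⊥`. -/
def normalSpace (g : SmoothMetric E P) (γ : ℝ → P) (r : ℝ) :
    Submodule ℝ (TangentSpace 𝓘(ℝ, E) (γ r)) :=
  LinearMap.ker (g.inner (γ r) (velocity γ r)).toLinearMap

/-- An `End(γ'^⊥)`-valued tensor field along `γ`: an endomorphism of `γ'(r)^⊥` for every `r`,
extended by `0` in the direction `γ'(r)`. -/
structure NormalEndField (g : SmoothMetric E P) (γ : ℝ → P) where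
  /-- the endomorphism at `r` -/
  toFun : ∀ r, TangentSpace 𝓘(ℝ, E) (γ r) →L[ℝ] TangentSpace 𝓘(ℝ, E) (γ r)
  map_velocity : ∀ r, toFun r (velocity γ r) = 0
  map_normal : ∀ r, ∀ v ∈ normalSpace g γ r, toFun r v ∈ normalSpace g γ r

/-- The determinant of the endomorphism of `γ'(r)^⊥`. -/
def NormalEndField.det {g : SmoothMetric E P} {γ : ℝ → P} (D : NormalEndField g γ) (r : ℝ) : ℝ :=
  LinearMap.det ((D.toFun r).toLinearMap.restrict (D.map_normal r))

end AmbientGeometry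

noncomputable section Hypersurfaces

/-! ### Hypersurfaces, mean curvature flow and parallel hypersurfaces -/

variable {n : ℕ}
  {P : Type*} [TopologicalSpace P] [ChartedSpace (EuclideanSpace ℝ (Fin (n + 1))) P]
  [IsManifold (𝓡 (n + 1)) ∞ P]
  {M : Type*} [TopologicalSpace M] [ChartedSpace (EuclideanSpace ℝ (Fin n)) M]

variable (n) in
/-- `f` is a smooth immersion, that is, an (immersed) hypersurface of `P`. -/
def IsHypersurface (f : M → P) : Prop :=
  ContMDiff (𝓡 n) (𝓡 (n + 1)) ∞ f ∧
    ∀ x, Function.Injective (mfderiv (𝓡 n) (𝓡 (n + 1)) f x)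

/-- `N` is a smooth unit normal vector field along `f`. A hypersurface is 2-sided if it has
one. -/
def IsUnitNormal (g : SmoothMetric (EuclideanSpace ℝ (Fin (n + 1))) P) (f : M → P)
    (N : ∀ x, TangentSpace (𝓡 (n + 1)) (f x)) : Prop :=
  ContMDiff (𝓡 n) (𝓡 (n + 1)).tangent ∞
      (fun x => (⟨f x, N x⟩ : TangentBundle (𝓡 (n + 1)) P)) ∧
    ∀ x, g.inner (f x) (N x) (N x) = 1 ∧
      ∀ X : TangentSpace (𝓡 n) x, g.inner (f x) (N x) (mfderiv (𝓡 n) (𝓡 (n + 1)) f x X) = 0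

/-- The shape operator `A_N` at `x`: `df (A_N X) = -∇_X N`. -/
def shapeOperator (g : SmoothMetric (EuclideanSpace ℝ (Fin (n + 1))) P) (f : M → P)
    (N : ∀ x, TangentSpace (𝓡 (n + 1)) (f x)) (x : M) :
    TangentSpace (𝓡 n) x →ₗ[ℝ] TangentSpace (𝓡 n) x :=
  (mfderiv (𝓡 n) (𝓡 (n + 1)) f x).toLinearMap.leftInverse ∘ₗ
    (-(covDerivAlong g f N x)).toLinearMap

/-- The mean curvature `(1 / n) trace A_N` with respect to the unit normal field `N`. -/
def meanCurvature (g : SmoothMetric (EuclideanSpace ℝ (Fin (n + 1))) P) (f : M → P)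
    (N : ∀ x, TangentSpace (𝓡 (n + 1)) (f x)) (x : M) : ℝ :=
  LinearMap.trace ℝ (TangentSpace (𝓡 n) x) (shapeOperator g f N x) / n

/-- The interval `[0, T)`, where `T = ∞` is allowed. -/
def timeInterval (T : EReal) : Set ℝ := {t | 0 ≤ t ∧ (t : EReal) < T}

/-- `F : M × [0, T) → P` is a solution of the mean curvature flow with initial data `f`: a smooth
family of hypersurfaces with `∂_t F = H N` and `F(·, 0) = f`. The product `H N` does not depend
on the choice of the unit normal field of `F(·, t)`. -/
def IsMCFSolution (g : SmoothMetric (EuclideanSpace ℝ (Fin (n + 1))) P) (f : M → P)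
    (T : EReal) (F : M → ℝ → P) : Prop :=
  ContMDiffOn ((𝓡 n).prod 𝓘(ℝ, ℝ)) (𝓡 (n + 1)) ∞ (fun p : M × ℝ => F p.1 p.2)
      (univ ×ˢ timeInterval T) ∧
    (∀ x, F x 0 = f x) ∧
    ∀ t ∈ timeInterval T, IsHypersurface n (fun x => F x t) ∧
      ∃ ν : ∀ x, TangentSpace (𝓡 (n + 1)) (F x t), IsUnitNormal g (fun x => F x t) ν ∧
        ∀ x, mfderivWithin 𝓘(ℝ, ℝ) (𝓡 (n + 1)) (F x) (timeInterval T) t (1 : ℝ) =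
          meanCurvature g (fun x => F x t) ν x • ν x

/-- The normal geodesic `γ_x(r) = exp_x (r N(x))`. -/
def normalGeodesic (g : SmoothMetric (EuclideanSpace ℝ (Fin (n + 1))) P) (f : M → P)
    (N : ∀ x, TangentSpace (𝓡 (n + 1)) (f x)) (x : M) (r : ℝ) : P :=
  expMap g (f x) (r • N x)

/-- The interval of all `r` for which `exp_x (r N(x))` is defined. -/
def normalDomain (g : SmoothMetric (EuclideanSpace ℝ (Fin (n + 1))) P) (f : M → P)
    (N : ∀ x, TangentSpace (𝓡 (n + 1)) (f x)) (x : M) : Set ℝ :=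
  {r | ExpDefined g (f x) (r • N x)}

/-- The flow `F` is, on `[0, δ)`, a reparametrization of the parallel flow with parameter `ε`:
`F(x, t) = exp_x (ε(t) N(x))`, and in particular the exponential is defined there. The parameter
is continuous. -/
def IsRPF (g : SmoothMetric (EuclideanSpace ℝ (Fin (n + 1))) P) (f : M → P)
    (N : ∀ x, TangentSpace (𝓡 (n + 1)) (f x)) (F : M → ℝ → P) (δ : EReal) (ε : ℝ → ℝ) : Prop :=
  ContinuousOn ε (timeInterval δ) ∧ ε 0 = 0 ∧
    ∀ t ∈ timeInterval δ, ∀ x, ε t ∈ normalDomain g f N x ∧ F x t = normalGeodesic g f N x (ε t)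

/-- The hypersurface `f` is isoparametric on the side of its unit normal field `N`: for all small
`r ≥ 0` the parallel displacement `Φ_r(x) = exp_x (r N(x))` is defined, is a hypersurface with unit
normal field `γ_x'(r)`, and has constant mean curvature. -/
def IsIsoparametric (g : SmoothMetric (EuclideanSpace ℝ (Fin (n + 1))) P) (f : M → P)
    (N : ∀ x, TangentSpace (𝓡 (n + 1)) (f x)) : Prop :=
  ∃ r₀ : ℝ, 0 < r₀ ∧ ∀ r : ℝ, 0 ≤ r → r < r₀ →
    (∀ x, r ∈ normalDomain g f N x) ∧
    IsHypersurface n (fun x => normalGeodesic g f N x r) ∧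
    IsUnitNormal g (fun x => normalGeodesic g f N x r)
      (fun x => velocity (normalGeodesic g f N x) r) ∧
    ∃ c : ℝ, ∀ x, meanCurvature g (fun x => normalGeodesic g f N x r)
      (fun x => velocity (normalGeodesic g f N x) r) x = c

/-- `D` is the solution, along the normal geodesic `γ = γ_x`, of
`D'' + R(D, γ') γ' = 0`, `D(0) = id`, `D'(0) = -A_N` (on `T_x M = γ'(0)^⊥`). -/
structure IsJacobiTensor (g : SmoothMetric (EuclideanSpace ℝ (Fin (n + 1))) P) (f : M → P)
    (N : ∀ x, TangentSpace (𝓡 (n + 1)) (f x)) (x : M)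
    (D : NormalEndField g (normalGeodesic g f N x)) : Prop where
  contDiffAt : ∀ r ∈ normalDomain g f N x, ContDiffAt ℝ 2
    (fun s => endInChart (normalGeodesic g f N x r) (normalGeodesic g f N x s) (D.toFun s)) r
  jacobi : ∀ r ∈ normalDomain g f N x, ∀ v ∈ normalSpace g (normalGeodesic g f N x) r,
    covDerivEnd g (normalGeodesic g f N x) (covDerivEnd g (normalGeodesic g f N x) D.toFun) r v
      + curvature g (normalGeodesic g f N x r) (D.toFun r v)
          (velocity (normalGeodesic g f N x) r) (velocity (normalGeodesic g f N x) r) = 0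
  initial : ∀ v ∈ normalSpace g (normalGeodesic g f N x) 0, D.toFun 0 v = v
  initial_deriv : ∀ X : TangentSpace (𝓡 n) x,
    (covDerivEnd g (normalGeodesic g f N x) D.toFun 0
        (show EuclideanSpace ℝ (Fin (n + 1)) from mfderiv (𝓡 n) (𝓡 (n + 1)) f x X) :
      EuclideanSpace ℝ (Fin (n + 1))) =
      -mfderiv (𝓡 n) (𝓡 (n + 1)) f x (shapeOperator g f N x X)

/-- The function `r ↦ -(det D)'(r) / (n det D(r))`. -/
def jacobiMeanCurvature {g : SmoothMetric (EuclideanSpace ℝ (Fin (n + 1))) P} {γ : ℝ → P}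
    (D : NormalEndField g γ) (r : ℝ) : ℝ :=
  -(deriv D.det r / (n * D.det r))

end Hypersurfaces

/-! Write `Φ_r(x) = exp_{f(x)}(r N(x))`, so that `F(·, t) = Φ_{ε(t)}`. The proof compares two
descriptions of the speed at which these hypersurfaces move along the normal geodesics.

Jacobi side. For fixed `x`, the differential of `Φ_r` at `x`, as a function of `r`, is a Jacobi
field along `γ_x` with initial value `df` and initial derivative `∇N = -df ∘ A_N`. If `L` is the
parallel transport of `df` along `γ_x`, then `D L` solves the same linear equation with the same
initial data, so `dΦ_r = D(r) L(r)` and the covariant derivative of the normal `γ_x'(r)` is `D'(r)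
L(r)` (`IsJacobiTensor.exists_hasVariation`). Since `D` takes values in `γ'^⊥`, the velocity
`γ_x'(r)` is normal to `Φ_r`. If `Φ_r` is an immersion at `x`, then `D(r)` is invertible on `γ'^⊥`,
the shape operator is conjugate to `-D⁻¹ D'`, and Jacobi's formula gives mean curvature `-(det D)' /
(n det D)` (`NormalEndField.trace_eq`, `IsJacobiTensor.meanCurvature_eq`).

Flow side. The flow moves `F(x, t)` by `H ν`, and any unit normal of `Φ_{ε(t)}` is locally `± γ_x'`;
the vector `H ν` does not see the sign. As `F(x, t) = γ_x(ε(t))` and `γ_x` has unit speed, the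
merely continuous function `ε` can be recovered locally from the differentiable curve `F(x, ·)`.
Hence `ε` is differentiable, with derivative the mean curvature of `Φ_{ε(t)}` at `x`
(`IsRPF.hasDerivWithinAt`). The two sides together are the differential equation for `ε`.

The left-hand side of this equation does not involve `x`. Uniqueness of derivatives therefore gives
independence of `x`, and it also shows that each `Φ_{ε(t)}` has constant mean curvature. If `ε(t₁) >
0`, the intermediate value theorem and `ε(0) = 0` show that every `r` in `[0, ε(t₁))` is some
`ε(t)`, so `f` is isoparametric on the side of `N`. The other side follows by replacing `(N, ε)`
with `(-N, -ε)`.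

Most of the work is the foundation of the Jacobi side: invariance of the chart formulas for the
Levi-Civita connection and the curvature, uniqueness of geodesics and rescaling, global solutions of
linear equations along a geodesic, and differentiable dependence of geodesics on their initial data.
Completeness is not available, so differentiability of `Φ_r` is propagated from time `0` through
times at which all the geodesics exist. -/

open Topology

/-! ### Changes of coordinates and the metric in a chart -/

noncomputable section Charts

variable {E : Type*} [NormedAddCommGroup E] [NormedSpace ℝ E]
  {P : Type*} [TopologicalSpace P] [ChartedSpace E P] [IsManifold 𝓘(ℝ, E) ∞ P]

/-- `toChart` as an endomorphism of the model space. -/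
def coordMap (p x : P) : E →L[ℝ] E := toChart (E := E) p x

/-- `mfderiv` between the model spaces. -/
def mfderivE {E₀ : Type*} [NormedAddCommGroup E₀] [NormedSpace ℝ E₀]
    {S : Type*} [TopologicalSpace S] [ChartedSpace E₀ S] {E : Type*} [NormedAddCommGroup E]
    [NormedSpace ℝ E] {P : Type*} [TopologicalSpace P] [ChartedSpace E P]
    (f : S → P) (s : S) : E₀ →L[ℝ] E :=
  mfderiv 𝓘(ℝ, E₀) 𝓘(ℝ, E) f s

/-- `velocity` in the model space. -/
def velocityE {E : Type*} [NormedAddCommGroup E] [NormedSpace ℝ E] {P : Type*}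
    [TopologicalSpace P] [ChartedSpace E P] (γ : ℝ → P) (t : ℝ) : E := velocity (E := E) γ t

/-- `covDerivAlong` between the model spaces. -/
def covAlong {E₀ : Type*} [NormedAddCommGroup E₀] [NormedSpace ℝ E₀]
    {S : Type*} [TopologicalSpace S] [ChartedSpace E₀ S] (g : SmoothMetric E P)
    (f : S → P) (V : S → E) (s : S) : E₀ →L[ℝ] E :=
  covDerivAlong (E₀ := E₀) g f V s

/-- The metric as a family of bilinear forms on the model space. -/
def innerE (g : SmoothMetric E P) (x : P) : E →L[ℝ] E →L[ℝ] ℝ := g.inner x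

/-- The transition map from the chart at `q` to the chart at `p`. -/
def transition (E : Type*) [NormedAddCommGroup E] [NormedSpace ℝ E]
    {P : Type*} [TopologicalSpace P] [ChartedSpace E P] (q p : P) (u : E) : E :=
  extChartAt 𝓘(ℝ, E) p ((extChartAt 𝓘(ℝ, E) q).symm u)

/-- The domain of the transition map. -/
def transitionDomain (E : Type*) [NormedAddCommGroup E] [NormedSpace ℝ E]
    {P : Type*} [TopologicalSpace P] [ChartedSpace E P] (q p : P) : Set E :=
  (extChartAt 𝓘(ℝ, E) q).target ∩
    (extChartAt 𝓘(ℝ, E) q).symm ⁻¹' (extChartAt 𝓘(ℝ, E) p).source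

theorem isOpen_transitionDomain (E : Type*) [NormedAddCommGroup E] [NormedSpace ℝ E]
    {P : Type*} [TopologicalSpace P] [ChartedSpace E P] (q p : P) :
    IsOpen (transitionDomain E q p) :=
  (continuousOn_extChartAt_symm q).isOpen_inter_preimage (isOpen_extChartAt_target q)
    (isOpen_extChartAt_source p)

theorem mem_transitionDomain {E : Type*} [NormedAddCommGroup E] [NormedSpace ℝ E]
    {P : Type*} [TopologicalSpace P] [ChartedSpace E P]
    {q p x : P} (hq : x ∈ (extChartAt 𝓘(ℝ, E) q).source)
    (hp : x ∈ (extChartAt 𝓘(ℝ, E) p).source) :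
    extChartAt 𝓘(ℝ, E) q x ∈ transitionDomain E q p := by
  refine ⟨(extChartAt 𝓘(ℝ, E) q).map_source hq, ?_⟩
  rwa [mem_preimage, (extChartAt 𝓘(ℝ, E) q).left_inv hq]

theorem transition_mem_target {E : Type*} [NormedAddCommGroup E] [NormedSpace ℝ E]
    {P : Type*} [TopologicalSpace P] [ChartedSpace E P] {q p : P} {u : E}
    (hu : u ∈ transitionDomain E q p) :
    transition E q p u ∈ (extChartAt 𝓘(ℝ, E) p).target :=
  (extChartAt 𝓘(ℝ, E) p).map_source hu.2

theorem transition_extChartAt {E : Type*} [NormedAddCommGroup E] [NormedSpace ℝ E]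
    {P : Type*} [TopologicalSpace P] [ChartedSpace E P] {q x : P} (hq : x ∈ (extChartAt 𝓘(ℝ, E) q).source) (p : P) :
    transition E q p (extChartAt 𝓘(ℝ, E) q x) = extChartAt 𝓘(ℝ, E) p x := by
  rw [transition, (extChartAt 𝓘(ℝ, E) q).left_inv hq]

theorem eventually_mem_source {E : Type*} [NormedAddCommGroup E] [NormedSpace ℝ E]
    {P : Type*} [TopologicalSpace P] [ChartedSpace E P] {S : Type*} [TopologicalSpace S]
    {f : S → P} {s : S} {q : P} (hf : ContinuousAt f s)
    (hq : f s ∈ (extChartAt 𝓘(ℝ, E) q).source) :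
    ∀ᶠ s' in 𝓝 s, f s' ∈ (extChartAt 𝓘(ℝ, E) q).source :=
  hf.eventually_mem (extChartAt_source_mem_nhds' hq)

theorem contDiffOn_transition (q p : P) :
    ContDiffOn ℝ ∞ (transition E q p) (transitionDomain E q p) := by
  have h := contDiffOn_ext_coord_change (I := 𝓘(ℝ, E)) (n := ∞) p q
  have e : ((extChartAt 𝓘(ℝ, E) q).symm ≫ extChartAt 𝓘(ℝ, E) p).source = transitionDomain E q p := by
    rw [PartialEquiv.trans_source, PartialEquiv.symm_source]; rfl
  rw [e] at h
  exact h

/-- This identification makes the cocycle identities of `tangentCoordChange` available. All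
inversion and composition rules for `coordMap` come from them. -/
theorem coordMap_eq {p x : P} (h : x ∈ (extChartAt 𝓘(ℝ, E) p).source) :
    coordMap (E := E) p x = tangentCoordChange 𝓘(ℝ, E) x p x := by
  have := mfderiv_chartAt_eq_tangentCoordChange (I := 𝓘(ℝ, E)) (x := x) (y := p)
    (by simpa using h)
  rw [coordMap, toChart, ← this]
  rfl

theorem coordMap_self (p : P) : coordMap (E := E) p p = ContinuousLinearMap.id ℝ E := by
  rw [coordMap_eq (mem_extChartAt_source p)]
  ext v
  exact tangentCoordChange_self (mem_extChartAt_source p)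

/-- The inverse of `coordMap`. -/
def coordInv (p x : P) : E →L[ℝ] E := tangentCoordChange 𝓘(ℝ, E) p x x

theorem coordInv_coordMap {p x : P} (h : x ∈ (extChartAt 𝓘(ℝ, E) p).source) (v : E) :
    coordInv p x (coordMap p x v) = v := by
  rw [coordMap_eq h, coordInv, tangentCoordChange_comp]
  · exact tangentCoordChange_self (mem_extChartAt_source x)
  · exact ⟨⟨mem_extChartAt_source x, h⟩, mem_extChartAt_source x⟩

theorem coordMap_coordInv {p x : P} (h : x ∈ (extChartAt 𝓘(ℝ, E) p).source) (v : E) :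
    coordMap p x (coordInv p x v) = v := by
  rw [coordMap_eq h, coordInv, tangentCoordChange_comp]
  · exact tangentCoordChange_self h
  · exact ⟨⟨h, mem_extChartAt_source x⟩, h⟩

/-- `fromChart` as an endomorphism of the model space. -/
def fromChartE (p : P) (u : E) : E →L[ℝ] E := fromChart (E := E) p u

theorem fromChart_eq {p : P} {u : E} (h : u ∈ (extChartAt 𝓘(ℝ, E) p).target) :
    fromChartE p u = coordInv p ((extChartAt 𝓘(ℝ, E) p).symm u) := by
  have h1 := mfderiv_extChartAt_comp_mfderivWithin_extChartAt_symm (I := 𝓘(ℝ, E)) h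
  simp only [modelWithCornersSelf_coe, range_id, mfderivWithin_univ] at h1
  have hs := (extChartAt 𝓘(ℝ, E) p).map_target h
  ext1 v
  have h2 : coordMap p ((extChartAt 𝓘(ℝ, E) p).symm u) (fromChartE p u v) = v :=
    DFunLike.congr_fun (F := E →L[ℝ] E) h1 v
  rw [← coordInv_coordMap hs (fromChartE p u v), h2]

theorem hasFDerivAt_transition {q p x : P} (hq : x ∈ (extChartAt 𝓘(ℝ, E) q).source)
    (hp : x ∈ (extChartAt 𝓘(ℝ, E) p).source) :
    HasFDerivAt (transition E q p) (tangentCoordChange 𝓘(ℝ, E) q p x)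
      (extChartAt 𝓘(ℝ, E) q x) := by
  have := hasFDerivWithinAt_tangentCoordChange (I := 𝓘(ℝ, E)) ⟨hq, hp⟩
  simp only [modelWithCornersSelf_coe, range_id, hasFDerivWithinAt_univ] at this
  exact this

/-- The cocycle identity, read as a chain rule. It is the standard means of carrying coordinates of
tangent vectors from one chart to another. -/
theorem fderiv_transition_coordMap {q p x : P} (hq : x ∈ (extChartAt 𝓘(ℝ, E) q).source)
    (hp : x ∈ (extChartAt 𝓘(ℝ, E) p).source) (v : E) :
    fderiv ℝ (transition E q p) (extChartAt 𝓘(ℝ, E) q x) (coordMap q x v) = coordMap p x v := by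
  rw [(hasFDerivAt_transition hq hp).fderiv, coordMap_eq hq, coordMap_eq hp,
    tangentCoordChange_comp]
  exact ⟨⟨mem_extChartAt_source x, hq⟩, hp⟩

variable (g : SmoothMetric E P)

theorem chartMetric_apply {p : P} {u : E} (h : u ∈ (extChartAt 𝓘(ℝ, E) p).target) (v w : E) :
    chartMetric g p u v w = innerE g ((extChartAt 𝓘(ℝ, E) p).symm u)
      (coordInv p ((extChartAt 𝓘(ℝ, E) p).symm u) v)
      (coordInv p ((extChartAt 𝓘(ℝ, E) p).symm u) w) := by
  rw [← fromChart_eq h]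
  rfl

theorem chartMetric_coordMap {p x : P} (h : x ∈ (extChartAt 𝓘(ℝ, E) p).source) (v w : E) :
    chartMetric g p (extChartAt 𝓘(ℝ, E) p x) (coordMap p x v) (coordMap p x w) =
      innerE g x v w := by
  rw [chartMetric_apply g ((extChartAt 𝓘(ℝ, E) p).map_source h),
    (extChartAt 𝓘(ℝ, E) p).left_inv h, coordInv_coordMap h, coordInv_coordMap h]

theorem innerE_symm (x : P) (v w : E) : innerE g x v w = innerE g x w v := g.symm x v w

theorem innerE_pos (x : P) {v : E} (hv : v ≠ 0) : 0 < innerE g x v v := g.pos x v hv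

theorem chartMetric_symm {p : P} {u : E} (h : u ∈ (extChartAt 𝓘(ℝ, E) p).target) (v w : E) :
    chartMetric g p u v w = chartMetric g p u w v := by
  rw [chartMetric_apply g h, chartMetric_apply g h, innerE_symm]

theorem chartMetric_pos {p : P} {u : E} (h : u ∈ (extChartAt 𝓘(ℝ, E) p).target) {v : E}
    (hv : v ≠ 0) : 0 < chartMetric g p u v v := by
  rw [chartMetric_apply g h]
  apply innerE_pos
  intro h0
  apply hv
  rw [← coordMap_coordInv ((extChartAt 𝓘(ℝ, E) p).map_target h) v, h0, map_zero]

theorem chartMetric_transition {q p : P} {u : E} (hu : u ∈ transitionDomain E q p) (v w : E) :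
    chartMetric g q u v w = chartMetric g p (transition E q p u)
      (fderiv ℝ (transition E q p) u v) (fderiv ℝ (transition E q p) u w) := by
  obtain ⟨x, hx, rfl⟩ : ∃ x ∈ (extChartAt 𝓘(ℝ, E) q).source, extChartAt 𝓘(ℝ, E) q x = u :=
    ⟨_, (extChartAt 𝓘(ℝ, E) q).map_target hu.1, (extChartAt 𝓘(ℝ, E) q).right_inv hu.1⟩
  have hp : x ∈ (extChartAt 𝓘(ℝ, E) p).source := by
    have := hu.2
    rwa [mem_preimage, (extChartAt 𝓘(ℝ, E) q).left_inv hx] at this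
  have e : transition E q p (extChartAt 𝓘(ℝ, E) q x) = extChartAt 𝓘(ℝ, E) p x := by
    rw [transition, (extChartAt 𝓘(ℝ, E) q).left_inv hx]
  rw [e, ← coordMap_coordInv hx v, ← coordMap_coordInv hx w,
    fderiv_transition_coordMap hx hp, fderiv_transition_coordMap hx hp,
    chartMetric_coordMap g hx, chartMetric_coordMap g hp]

/-- In finite dimension it suffices to treat the entries `g(v, w)`. Each is the smooth bundle metric
evaluated on two coordinate fields, and a coordinate field is the image of a constant field under
the tangent map of the inverse chart. -/
theorem contDiffOn_chartMetric [FiniteDimensional ℝ E] (p : P) :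
    ContDiffOn ℝ ∞ (chartMetric g p) (extChartAt 𝓘(ℝ, E) p).target := by
  rw [contDiffOn_clm_apply]
  intro v
  rw [contDiffOn_clm_apply]
  intro w
  rw [← contMDiffOn_iff_contDiffOn]
  set S := (extChartAt 𝓘(ℝ, E) p).target
  have hS : UniqueMDiffOn 𝓘(ℝ, E) S :=
    (isOpen_extChartAt_target (I := 𝓘(ℝ, E)) p).uniqueMDiffOn
  have hsymm : ContMDiffOn 𝓘(ℝ, E) 𝓘(ℝ, E) ∞ (extChartAt 𝓘(ℝ, E) p).symm S :=
    contMDiffOn_extChartAt_symm p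
  have hV : ∀ v : E, ContMDiffOn 𝓘(ℝ, E) 𝓘(ℝ, E).tangent ∞
      (fun u : E => (⟨(extChartAt 𝓘(ℝ, E) p).symm u, fromChart p u v⟩ :
        TangentBundle 𝓘(ℝ, E) P)) S := by
    intro v
    have h1 := hsymm.contMDiffOn_tangentMapWithin (m := ∞) (by simp) hS
    have h2 : ContMDiffOn 𝓘(ℝ, E) 𝓘(ℝ, E).tangent ∞
        (fun u : E => (⟨u, v⟩ : TangentBundle 𝓘(ℝ, E) E)) S := by
      intro u hu
      rw [Bundle.contMDiffWithinAt_totalSpace]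
      refine ⟨contMDiffWithinAt_id, ?_⟩
      simp only [TangentBundle.trivializationAt_apply]
      simp [chartAt_self_eq, contMDiffWithinAt_const]
    refine (h1.comp h2 (fun u hu => hu)).congr ?_
    intro u hu
    simp only [Function.comp, tangentMapWithin]
    rw [mfderivWithin_of_isOpen (isOpen_extChartAt_target p) hu]
    rfl
  have hg := g.contMDiff.contMDiffOn (s := univ)
  have hg' := hg.comp hsymm (fun _ _ => mem_univ _)
  have := ContMDiffOn.clm_bundle_apply₂ (E₃ := Bundle.Trivial P ℝ) (F₃ := ℝ) hg' (hV v) (hV w)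
  intro u hu
  have := this u hu
  rw [Bundle.contMDiffWithinAt_totalSpace] at this
  exact this.2

end Charts

/-! ### The Levi-Civita connection in charts and the tensoriality of curvature -/

noncomputable section Christoffel

variable {E : Type*} [NormedAddCommGroup E] [NormedSpace ℝ E]
  {P : Type*} [TopologicalSpace P] [ChartedSpace E P] [IsManifold 𝓘(ℝ, E) ∞ P]
  (g : SmoothMetric E P)

theorem two_le_infty : minSmoothness ℝ 2 ≤ (∞ : WithTop ℕ∞) := by
  simp only [minSmoothness_of_isRCLikeNormedField]
  exact ENat.LEInfty.out

/-- The curvature tensor in the coordinates of the chart at `q`. -/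
def chartCurvature (q : P) (u : E) (X Y Z : E) : E :=
  fderiv ℝ (christoffel g q) u X Y Z - fderiv ℝ (christoffel g q) u Y X Z
    + christoffel g q u X (christoffel g q u Y Z) - christoffel g q u Y (christoffel g q u X Z)

section Transition

variable {q p : P} {u : E}

theorem contDiffAt_transition (hu : u ∈ transitionDomain E q p) :
    ContDiffAt ℝ ∞ (transition E q p) u :=
  (contDiffOn_transition q p).contDiffAt ((isOpen_transitionDomain E q p).mem_nhds hu)

theorem contDiffAt_fderiv_transition (hu : u ∈ transitionDomain E q p) :
    ContDiffAt ℝ ∞ (fderiv ℝ (transition E q p)) u :=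
  (contDiffAt_transition hu).fderiv_right (by simp)

theorem hasFDerivAt_fderiv_transition (hu : u ∈ transitionDomain E q p) :
    HasFDerivAt (fderiv ℝ (transition E q p)) (fderiv ℝ (fderiv ℝ (transition E q p)) u) u :=
  ((contDiffAt_fderiv_transition hu).differentiableAt (by simp)).hasFDerivAt

theorem snd_fderiv_transition_symm (hu : u ∈ transitionDomain E q p) (v w : E) :
    fderiv ℝ (fderiv ℝ (transition E q p)) u v w = fderiv ℝ (fderiv ℝ (transition E q p)) u w v :=
  ((contDiffAt_transition hu).isSymmSndFDerivAt two_le_infty) v w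

theorem exists_fderiv_transition_eq (hu : u ∈ transitionDomain E q p) (z : E) :
    ∃ z', fderiv ℝ (transition E q p) u z' = z := by
  have hq := (extChartAt 𝓘(ℝ, E) q).map_target hu.1
  refine ⟨coordMap q ((extChartAt 𝓘(ℝ, E) q).symm u) (coordInv p ((extChartAt 𝓘(ℝ, E) q).symm u) z), ?_⟩
  have := fderiv_transition_coordMap hq hu.2 (coordInv p ((extChartAt 𝓘(ℝ, E) q).symm u) z)
  rw [(extChartAt 𝓘(ℝ, E) q).right_inv hu.1] at this
  rw [this, coordMap_coordInv hu.2]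

end Transition

variable [FiniteDimensional ℝ E]

/-- The musical isomorphism of the metric in a chart. -/
def chartMetricEquiv {p : P} {u : E} (h : u ∈ (extChartAt 𝓘(ℝ, E) p).target) :
    E ≃L[ℝ] (E →L[ℝ] ℝ) :=
  (LinearEquiv.ofInjectiveOfFinrankEq (chartMetric g p u).toLinearMap (by
      rw [← LinearMap.ker_eq_bot, LinearMap.ker_eq_bot']
      intro v hv
      by_contra h0
      have := chartMetric_pos g h h0
      have h1 : chartMetric g p u v = 0 := hv
      rw [h1] at this
      simp at this) (by
      rw [← (LinearMap.toContinuousLinearMap : (E →ₗ[ℝ] ℝ) ≃ₗ[ℝ] (E →L[ℝ] ℝ)).finrank_eq]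
      exact (Subspace.dual_finrank_eq (K := ℝ) (V := E)).symm)).toContinuousLinearEquiv

theorem coe_chartMetricEquiv {p : P} {u : E} (h : u ∈ (extChartAt 𝓘(ℝ, E) p).target) :
    (chartMetricEquiv g h : E →L[ℝ] E →L[ℝ] ℝ) = chartMetric g p u := by
  ext v w
  rfl

/-- On the target of the chart the metric is an isomorphism onto the dual, so
`ContinuousLinearMap.inverse` in the definition of `christoffel` is a genuine inverse rather than
the default `0`. -/
theorem chartMetric_christoffel {p : P} {u : E} (h : u ∈ (extChartAt 𝓘(ℝ, E) p).target)
    (v w z : E) :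
    chartMetric g p u (christoffel g p u v w) z = christoffelFirst g p u v w z := by
  have : chartMetric g p u (christoffel g p u v w) = christoffelFirst g p u v w := by
    simp only [christoffel, ContinuousLinearMap.comp_apply, ContinuousLinearMap.compL_apply]
    rw [← coe_chartMetricEquiv g h, ContinuousLinearMap.inverse_equiv]
    simp
  rw [this]

theorem contDiffAt_chartMetric {p : P} {u : E} (h : u ∈ (extChartAt 𝓘(ℝ, E) p).target) :
    ContDiffAt ℝ ∞ (chartMetric g p) u :=
  (contDiffOn_chartMetric g p).contDiffAt ((isOpen_extChartAt_target p).mem_nhds h)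

theorem eq_of_chartMetric_eq {p : P} {u : E} (h : u ∈ (extChartAt 𝓘(ℝ, E) p).target) {a b : E}
    (hab : ∀ z, chartMetric g p u a z = chartMetric g p u b z) : a = b :=
  (chartMetricEquiv g h).injective (ContinuousLinearMap.ext hab)

theorem fderiv_chartMetric_symm {p : P} {u : E} (h : u ∈ (extChartAt 𝓘(ℝ, E) p).target)
    (z v w : E) :
    fderiv ℝ (chartMetric g p) u z v w = fderiv ℝ (chartMetric g p) u z w v := by
  have hd := ((contDiffAt_chartMetric g h).differentiableAt (by simp)).hasFDerivAt
  have h1 := (hd.clm_apply (hasFDerivAt_const v u)).clm_apply (hasFDerivAt_const w u)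
  have h2 := (hd.clm_apply (hasFDerivAt_const w u)).clm_apply (hasFDerivAt_const v u)
  have h3 : (fun u => chartMetric g p u v w) =ᶠ[𝓝 u] fun u => chartMetric g p u w v := by
    filter_upwards [(isOpen_extChartAt_target p).mem_nhds h] with u hu
    exact chartMetric_symm g hu v w
  have := DFunLike.congr_fun (h1.unique (h2.congr_of_eventuallyEq h3)) z
  simpa using this

theorem christoffel_symm {p : P} {u : E} (h : u ∈ (extChartAt 𝓘(ℝ, E) p).target) (v w : E) :
    christoffel g p u v w = christoffel g p u w v := by
  refine eq_of_chartMetric_eq g h fun z => ?_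
  rw [chartMetric_christoffel g h, chartMetric_christoffel g h, christoffelFirst_apply,
    christoffelFirst_apply, fderiv_chartMetric_symm g h z v w]
  ring

/-- The Levi-Civita connection is compatible with the metric. -/
theorem fderiv_chartMetric {p : P} {u : E} (h : u ∈ (extChartAt 𝓘(ℝ, E) p).target) (v w z : E) :
    fderiv ℝ (chartMetric g p) u v w z =
      chartMetric g p u (christoffel g p u v w) z + chartMetric g p u w (christoffel g p u v z) := by
  rw [chartMetric_symm g h w, chartMetric_christoffel g h, chartMetric_christoffel g h,
    christoffelFirst_apply, christoffelFirst_apply, fderiv_chartMetric_symm g h v z w,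
    fderiv_chartMetric_symm g h z v w, fderiv_chartMetric_symm g h w v z]
  ring

theorem contDiffAt_christoffel {p : P} {u : E} (h : u ∈ (extChartAt 𝓘(ℝ, E) p).target) :
    ContDiffAt ℝ ∞ (christoffel g p) u := by
  have hG := contDiffAt_chartMetric g h
  have hT : ContDiffAt ℝ ∞ (fderiv ℝ (chartMetric g p)) u := hG.fderiv_right (by simp)
  have h1 : ContDiffAt ℝ ∞ (fun u => (chartMetric g p u).inverse) u := by
    have := contDiffAt_map_inverse (n := ∞) (chartMetricEquiv g h)
    rw [coe_chartMetricEquiv] at this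
    exact this.comp u hG
  have h2 : ContDiffAt ℝ ∞ (christoffelFirst g p) u := by
    unfold christoffelFirst
    have hfl := (ContinuousLinearMap.flipₗᵢ ℝ E E (E →L[ℝ] ℝ)).contDiff (n := ∞)
    have hT' : ContDiffAt ℝ ∞ (fun u => (fderiv ℝ (chartMetric g p) u).flip) u :=
      hfl.contDiffAt.comp u hT
    exact ((hT.add hT').sub (contDiffAt_const.clm_comp hT')).const_smul (1 / 2 : ℝ)
  exact ((ContinuousLinearMap.compL ℝ E (E →L[ℝ] ℝ) E).contDiff.contDiffAt.comp u h1).clm_comp h2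

section Transition

variable {q p : P} {u : E}

theorem fderiv_chartMetric_transition (hu : u ∈ transitionDomain E q p) (z v w : E) :
    fderiv ℝ (chartMetric g q) u z v w =
      fderiv ℝ (chartMetric g p) (transition E q p u) (fderiv ℝ (transition E q p) u z)
        (fderiv ℝ (transition E q p) u v) (fderiv ℝ (transition E q p) u w)
      + chartMetric g p (transition E q p u) (fderiv ℝ (fderiv ℝ (transition E q p)) u z v)
        (fderiv ℝ (transition E q p) u w)
      + chartMetric g p (transition E q p u) (fderiv ℝ (transition E q p) u v)
        (fderiv ℝ (fderiv ℝ (transition E q p)) u z w) := by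
  have hd := ((contDiffAt_chartMetric g hu.1).differentiableAt (by simp)).hasFDerivAt
  have hd' := ((contDiffAt_chartMetric g (transition_mem_target hu)).differentiableAt
    (by simp)).hasFDerivAt
  have hψ := ((contDiffAt_transition hu).differentiableAt (by simp)).hasFDerivAt
  have h2 := hasFDerivAt_fderiv_transition hu
  have h1 := (hd.clm_apply (hasFDerivAt_const v u)).clm_apply (hasFDerivAt_const w u)
  have h3 := ((hd'.comp u hψ).clm_apply (h2.clm_apply (hasFDerivAt_const v u))).clm_apply
    (h2.clm_apply (hasFDerivAt_const w u))
  have h4 : (fun u => chartMetric g q u v w) =ᶠ[𝓝 u] fun u => chartMetric g p (transition E q p u)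
      (fderiv ℝ (transition E q p) u v) (fderiv ℝ (transition E q p) u w) := by
    filter_upwards [(isOpen_transitionDomain E q p).mem_nhds hu] with u hu
    exact chartMetric_transition g hu v w
  have := DFunLike.congr_fun (h1.unique (h3.congr_of_eventuallyEq h4)) z
  simp at this
  rw [this]
  ring

/-- The transformation law of the Christoffel symbols. -/
theorem christoffel_transition (hu : u ∈ transitionDomain E q p) (v w : E) :
    fderiv ℝ (transition E q p) u (christoffel g q u v w) =
      christoffel g p (transition E q p u) (fderiv ℝ (transition E q p) u v)
        (fderiv ℝ (transition E q p) u w) + fderiv ℝ (fderiv ℝ (transition E q p)) u v w := by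
  have ht := transition_mem_target hu
  -- By nondegeneracy it is enough to pair with vectors, and every vector is the image of some `z`
  -- under the transition. In the Koszul combination of the transformed metric derivatives, four of
  -- the six terms with second derivatives of the transition cancel by symmetry, and the other two
  -- are equal.
  refine eq_of_chartMetric_eq g ht fun z => ?_
  obtain ⟨z, rfl⟩ := exists_fderiv_transition_eq hu z
  rw [← chartMetric_transition g hu, chartMetric_christoffel g hu.1, map_add,
    add_apply, chartMetric_christoffel g ht, christoffelFirst_apply,
    christoffelFirst_apply, fderiv_chartMetric_transition g hu, fderiv_chartMetric_transition g hu,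
    fderiv_chartMetric_transition g hu, snd_fderiv_transition_symm hu w v,
    snd_fderiv_transition_symm hu z v, snd_fderiv_transition_symm hu z w,
    chartMetric_symm g ht (fderiv ℝ (transition E q p) u v),
    chartMetric_symm g ht (fderiv ℝ (transition E q p) u w)]
  rw [chartMetric_symm g ht (fderiv ℝ (fderiv ℝ (transition E q p)) u w z)]
  ring

end Transition

theorem hasFDerivAt_christoffel {p : P} {u : E} (h : u ∈ (extChartAt 𝓘(ℝ, E) p).target) :
    HasFDerivAt (christoffel g p) (fderiv ℝ (christoffel g p) u) u :=
  ((contDiffAt_christoffel g h).differentiableAt (by simp)).hasFDerivAt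

/-- The derivative of the transformation law. Its last term, a third derivative of the transition,
is symmetric in `z` and `v`, hence disappears from the curvature, which is antisymmetrized in these
two. -/
theorem fderiv_christoffel_transition {q p : P} {u : E} (hu : u ∈ transitionDomain E q p)
    (z v w : E) :
    fderiv ℝ (fderiv ℝ (transition E q p)) u z (christoffel g q u v w) +
      fderiv ℝ (transition E q p) u (fderiv ℝ (christoffel g q) u z v w) =
    fderiv ℝ (christoffel g p) (transition E q p u) (fderiv ℝ (transition E q p) u z)
        (fderiv ℝ (transition E q p) u v) (fderiv ℝ (transition E q p) u w)
      + christoffel g p (transition E q p u) (fderiv ℝ (fderiv ℝ (transition E q p)) u z v)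
        (fderiv ℝ (transition E q p) u w)
      + christoffel g p (transition E q p u) (fderiv ℝ (transition E q p) u v)
        (fderiv ℝ (fderiv ℝ (transition E q p)) u z w)
      + fderiv ℝ (fderiv ℝ (fderiv ℝ (transition E q p))) u z v w := by
  have hd := hasFDerivAt_christoffel g hu.1
  have hd' := hasFDerivAt_christoffel g (transition_mem_target hu)
  have hψ := ((contDiffAt_transition hu).differentiableAt (by simp)).hasFDerivAt
  have h2 := hasFDerivAt_fderiv_transition hu
  have h5 : HasFDerivAt (fderiv ℝ (fderiv ℝ (transition E q p)))
      (fderiv ℝ (fderiv ℝ (fderiv ℝ (transition E q p))) u) u :=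
    (((contDiffAt_fderiv_transition hu).fderiv_right (m := ∞) (by simp)).differentiableAt
      (by simp)).hasFDerivAt
  have h1 := h2.clm_apply ((hd.clm_apply (hasFDerivAt_const v u)).clm_apply
    (hasFDerivAt_const w u))
  have h3 := (((hd'.comp u hψ).clm_apply (h2.clm_apply (hasFDerivAt_const v u))).clm_apply
    (h2.clm_apply (hasFDerivAt_const w u))).add
    ((h5.clm_apply (hasFDerivAt_const v u)).clm_apply (hasFDerivAt_const w u))
  have h4 : (fun u => fderiv ℝ (transition E q p) u (christoffel g q u v w)) =ᶠ[𝓝 u]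
      fun u => christoffel g p (transition E q p u) (fderiv ℝ (transition E q p) u v)
        (fderiv ℝ (transition E q p) u w) + fderiv ℝ (fderiv ℝ (transition E q p)) u v w := by
    filter_upwards [(isOpen_transitionDomain E q p).mem_nhds hu] with u hu
    exact christoffel_transition g hu v w
  have := DFunLike.congr_fun (h1.unique (h3.congr_of_eventuallyEq h4)) z
  simp at this
  rw [add_comm, this]
  abel

/-- The curvature is a tensor. -/
theorem chartCurvature_transition {q p : P} {u : E} (hu : u ∈ transitionDomain E q p)
    (X Y Z : E) :
    fderiv ℝ (transition E q p) u (chartCurvature g q u X Y Z) =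
      chartCurvature g p (transition E q p u) (fderiv ℝ (transition E q p) u X)
        (fderiv ℝ (transition E q p) u Y) (fderiv ℝ (transition E q p) u Z) := by
  have h1 := fderiv_christoffel_transition g hu X Y Z
  have h2 := fderiv_christoffel_transition g hu Y X Z
  have h3 : fderiv ℝ (fderiv ℝ (fderiv ℝ (transition E q p))) u X Y Z =
      fderiv ℝ (fderiv ℝ (fderiv ℝ (transition E q p))) u Y X Z := by
    have := ((contDiffAt_fderiv_transition hu).isSymmSndFDerivAt two_le_infty) X Y
    rw [this]
  have h4 := christoffel_transition g hu X (christoffel g q u Y Z)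
  have h5 := christoffel_transition g hu Y (christoffel g q u X Z)
  rw [christoffel_transition g hu Y Z, map_add] at h4
  rw [christoffel_transition g hu X Z, map_add] at h5
  rw [snd_fderiv_transition_symm hu Y X] at h2
  simp only [chartCurvature, map_add, map_sub, h4, h5]
  rw [eq_sub_of_add_eq' h1, eq_sub_of_add_eq' h2, h3]
  abel

/-- Differentiating `∂_Y g(Z, Z) = 2 g(Γ(Y, Z), Z)` once more expresses the Hessian of `g(Z, Z)` for
constant `Z`. Its antisymmetric part in `X, Y` is `2 g(R(X, Y)Z, Z)`, which vanishes because second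
derivatives commute. This is needed to see that `R(·, v)v` is orthogonal to `v`. -/
theorem chartMetric_chartCurvature_self {q : P} {u : E}
    (h : u ∈ (extChartAt 𝓘(ℝ, E) q).target) (X Y Z : E) :
    chartMetric g q u (chartCurvature g q u X Y Z) Z = 0 := by
  have key : ∀ X Y : E, fderiv ℝ (fderiv ℝ (chartMetric g q)) u X Y Z Z =
      2 * (chartMetric g q u (fderiv ℝ (christoffel g q) u X Y Z) Z
        + chartMetric g q u (christoffel g q u X (christoffel g q u Y Z)) Z
        + chartMetric g q u (christoffel g q u Y Z) (christoffel g q u X Z)) := by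
    intro X Y
    have hG := ((contDiffAt_chartMetric g h).differentiableAt (by simp)).hasFDerivAt
    have hG2 : HasFDerivAt (fderiv ℝ (chartMetric g q)) (fderiv ℝ (fderiv ℝ (chartMetric g q)) u) u :=
      (((contDiffAt_chartMetric g h).fderiv_right (m := ∞) (by simp)).differentiableAt
        (by simp)).hasFDerivAt
    have hΓ := hasFDerivAt_christoffel g h
    have h1 := ((hG2.clm_apply (hasFDerivAt_const Y u)).clm_apply (hasFDerivAt_const Z u)).clm_apply
      (hasFDerivAt_const Z u)
    have h2 := ((hG.clm_apply ((hΓ.clm_apply (hasFDerivAt_const Y u)).clm_apply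
      (hasFDerivAt_const Z u))).clm_apply (hasFDerivAt_const Z u)).const_mul 2
    have h4 : (fun u => fderiv ℝ (chartMetric g q) u Y Z Z) =ᶠ[𝓝 u]
        fun u => 2 * chartMetric g q u (christoffel g q u Y Z) Z := by
      filter_upwards [(isOpen_extChartAt_target q).mem_nhds h] with u hu
      rw [fderiv_chartMetric g hu, chartMetric_symm g hu Z]
      ring
    have := DFunLike.congr_fun (h1.unique (h2.congr_of_eventuallyEq h4)) X
    simp at this
    rw [this, fderiv_chartMetric g h]
    ring
  have hs : fderiv ℝ (fderiv ℝ (chartMetric g q)) u X Y = fderiv ℝ (fderiv ℝ (chartMetric g q)) u Y X :=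
    ((contDiffAt_chartMetric g h).isSymmSndFDerivAt two_le_infty) X Y
  have h1 := key X Y
  have h2 := key Y X
  rw [hs] at h1
  have h3 := chartMetric_symm g h (christoffel g q u Y Z) (christoffel g q u X Z)
  simp only [chartCurvature, map_add, map_sub, add_apply,
    sub_apply]
  linarith

end Christoffel

/-! ### Covariant derivatives along maps and curves, in an arbitrary chart -/

noncomputable section CovariantDerivative

variable {E : Type*} [NormedAddCommGroup E] [NormedSpace ℝ E]
  {P : Type*} [TopologicalSpace P] [ChartedSpace E P] [IsManifold 𝓘(ℝ, E) ∞ P]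

theorem hasFDerivAt_transition_fderiv {q p x : P} (hq : x ∈ (extChartAt 𝓘(ℝ, E) q).source)
    (hp : x ∈ (extChartAt 𝓘(ℝ, E) p).source) :
    HasFDerivAt (transition E q p) (fderiv ℝ (transition E q p) (extChartAt 𝓘(ℝ, E) q x))
      (extChartAt 𝓘(ℝ, E) q x) :=
  (hasFDerivAt_transition hq hp).differentiableAt.hasFDerivAt

section Along

variable {E₀ : Type*} [NormedAddCommGroup E₀] [NormedSpace ℝ E₀]
  {S : Type*} [TopologicalSpace S] [ChartedSpace E₀ S]

theorem hasMFDerivAt_extChartAt_comp {f : S → P} {s : S} {q p : P} (hf : ContinuousAt f s)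
    (hq : f s ∈ (extChartAt 𝓘(ℝ, E) q).source) (hp : f s ∈ (extChartAt 𝓘(ℝ, E) p).source)
    {u' : E₀ →L[ℝ] E}
    (hu : HasMFDerivAt 𝓘(ℝ, E₀) 𝓘(ℝ, E) (fun s => extChartAt 𝓘(ℝ, E) q (f s)) s u') :
    HasMFDerivAt 𝓘(ℝ, E₀) 𝓘(ℝ, E) (fun s => extChartAt 𝓘(ℝ, E) p (f s)) s
      ((fderiv ℝ (transition E q p) (extChartAt 𝓘(ℝ, E) q (f s))).comp u' : E₀ →L[ℝ] E) := by
  have h := (hasFDerivAt_transition_fderiv hq hp).hasMFDerivAt.comp s hu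
  refine h.congr_of_eventuallyEq ?_
  filter_upwards [eventually_mem_source hf hq] with s' hs'
  exact (transition_extChartAt hs' p).symm

/-- A map is differentiable if it is so in a chart. -/
theorem hasMFDerivAt_of_extChartAt {f : S → P} {s : S} {q : P} (hf : ContinuousAt f s)
    (hq : f s ∈ (extChartAt 𝓘(ℝ, E) q).source) {u' : E₀ →L[ℝ] E}
    (hu : HasMFDerivAt 𝓘(ℝ, E₀) 𝓘(ℝ, E) (fun s => extChartAt 𝓘(ℝ, E) q (f s)) s u') :
    HasMFDerivAt 𝓘(ℝ, E₀) 𝓘(ℝ, E) f s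
      ((coordInv q (f s)).comp u' : E₀ →L[ℝ] E) := by
  have h := hasMFDerivAt_extChartAt_comp hf hq (mem_extChartAt_source (f s)) hu
  refine ⟨hf, ?_⟩
  have h2 := h.2
  have e : (fderiv ℝ (transition E q (f s)) (extChartAt 𝓘(ℝ, E) q (f s))).comp u' =
      (coordInv q (f s)).comp u' := by
    rw [(hasFDerivAt_transition hq (mem_extChartAt_source (f s))).fderiv]
    rfl
  rw [e] at h2
  exact h2

theorem coordMap_mfderiv {f : S → P} {s : S} {q : P} (hf : ContinuousAt f s)
    (hq : f s ∈ (extChartAt 𝓘(ℝ, E) q).source) {u' : E₀ →L[ℝ] E}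
    (hu : HasMFDerivAt 𝓘(ℝ, E₀) 𝓘(ℝ, E) (fun s => extChartAt 𝓘(ℝ, E) q (f s)) s u') (X : E₀) :
    coordMap q (f s) (mfderivE (E₀ := E₀) f s X) = u' X := by
  rw [mfderivE, (hasMFDerivAt_of_extChartAt hf hq hu).mfderiv]
  exact coordMap_coordInv hq _

/-- Coordinates of a vector field along a map in another chart. -/
theorem hasMFDerivAt_coordMap {f : S → P} {V : S → E} {s : S} {q p : P} (hf : ContinuousAt f s)
    (hq : f s ∈ (extChartAt 𝓘(ℝ, E) q).source) (hp : f s ∈ (extChartAt 𝓘(ℝ, E) p).source)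
    {u' V' : E₀ →L[ℝ] E}
    (hu : HasMFDerivAt 𝓘(ℝ, E₀) 𝓘(ℝ, E) (fun s => extChartAt 𝓘(ℝ, E) q (f s)) s u')
    (hV : HasMFDerivAt 𝓘(ℝ, E₀) 𝓘(ℝ, E) (fun s => coordMap q (f s) (V s)) s V') :
    HasMFDerivAt 𝓘(ℝ, E₀) 𝓘(ℝ, E) (fun s => coordMap p (f s) (V s)) s
      ((fderiv ℝ (transition E q p) (extChartAt 𝓘(ℝ, E) q (f s))).comp V'
        + ((fderiv ℝ (fderiv ℝ (transition E q p)) (extChartAt 𝓘(ℝ, E) q (f s))).flip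
            (coordMap q (f s) (V s))).comp u' : E₀ →L[ℝ] E) := by
  have h2 := hasFDerivAt_fderiv_transition (mem_transitionDomain hq hp)
  have hΨ : HasFDerivAt (fun z : E × E => fderiv ℝ (transition E q p) z.1 z.2) _
      (extChartAt 𝓘(ℝ, E) q (f s), coordMap q (f s) (V s)) :=
    (HasFDerivAt.comp (extChartAt 𝓘(ℝ, E) q (f s), coordMap q (f s) (V s)) h2
      hasFDerivAt_fst).clm_apply hasFDerivAt_snd
  have hW : HasMFDerivAt 𝓘(ℝ, E₀) 𝓘(ℝ, E × E)
      (fun s => (extChartAt 𝓘(ℝ, E) q (f s), coordMap q (f s) (V s))) s (u'.prod V') :=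
    ⟨hu.1.prodMk hV.1, hu.2.prodMk hV.2⟩
  have h := HasMFDerivAt.comp s hΨ.hasMFDerivAt hW
  have h' := h.congr_of_eventuallyEq (f₁ := fun s => coordMap p (f s) (V s)) (by
    filter_upwards [eventually_mem_source hf hq, eventually_mem_source hf hp] with s' hs hs'
    exact (fderiv_transition_coordMap hs hs' _).symm)
  have e : (fderiv ℝ (transition E q p) (extChartAt 𝓘(ℝ, E) q (f s))).comp V'
        + ((fderiv ℝ (fderiv ℝ (transition E q p)) (extChartAt 𝓘(ℝ, E) q (f s))).flip
            (coordMap q (f s) (V s))).comp u' =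
      (((fderiv ℝ (transition E q p) (extChartAt 𝓘(ℝ, E) q (f s))).comp
        (ContinuousLinearMap.snd ℝ E E)) + ((fderiv ℝ (fderiv ℝ (transition E q p))
          (extChartAt 𝓘(ℝ, E) q (f s))).comp (ContinuousLinearMap.fst ℝ E E)).flip
            (coordMap q (f s) (V s))).comp (u'.prod V') := by
    ext X
    simp
  rw [e]
  exact h'

theorem fderiv_transition_injective {q p x : P} (hq : x ∈ (extChartAt 𝓘(ℝ, E) q).source)
    (hp : x ∈ (extChartAt 𝓘(ℝ, E) p).source) :
    Function.Injective (fderiv ℝ (transition E q p) (extChartAt 𝓘(ℝ, E) q x)) := by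
  intro a b hab
  rw [← coordMap_coordInv hq a, ← coordMap_coordInv hq b, fderiv_transition_coordMap hq hp,
    fderiv_transition_coordMap hq hp] at hab
  have := congrArg (coordInv p x) hab
  rw [coordInv_coordMap hp, coordInv_coordMap hp] at this
  rw [← coordMap_coordInv hq a, this, coordMap_coordInv hq b]

/-- The definition unfolded in the chart at `f s` itself; the passage to other charts is
`coordMap_covAlong`. -/
theorem covAlong_eq (g : SmoothMetric E P) {f : S → P} {V : S → E} {s : S} (hf : ContinuousAt f s) {u' V' : E₀ →L[ℝ] E}
    (hu : HasMFDerivAt 𝓘(ℝ, E₀) 𝓘(ℝ, E) (fun s' => extChartAt 𝓘(ℝ, E) (f s) (f s')) s u')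
    (hV : HasMFDerivAt 𝓘(ℝ, E₀) 𝓘(ℝ, E) (fun s' => coordMap (f s) (f s') (V s')) s V') (X : E₀) :
    covAlong g f V s X =
      V' X + christoffel g (f s) (extChartAt 𝓘(ℝ, E) (f s) (f s)) (u' X) (V s) := by
  have h := coordMap_mfderiv hf (mem_extChartAt_source (f s)) hu X
  rw [coordMap_self] at h
  have h4 : covAlong g f V s X =
      mfderivE (E₀ := E₀) (E := E) (fun s' => coordMap (f s) (f s') (V s')) s X
      + christoffelAt g (f s) (mfderivE (E₀ := E₀) f s X) (V s) := rfl
  rw [h4, ← h, mfderivE, hV.mfderiv]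
  rfl

variable [FiniteDimensional ℝ E] (g : SmoothMetric E P)

/-- The covariant derivative of a vector field along a map, in any chart. -/
theorem coordMap_covAlong {f : S → P} {V : S → E} {s : S} {q : P} (hf : ContinuousAt f s)
    (hq : f s ∈ (extChartAt 𝓘(ℝ, E) q).source) {u' V' : E₀ →L[ℝ] E}
    (hu : HasMFDerivAt 𝓘(ℝ, E₀) 𝓘(ℝ, E) (fun s => extChartAt 𝓘(ℝ, E) q (f s)) s u')
    (hV : HasMFDerivAt 𝓘(ℝ, E₀) 𝓘(ℝ, E) (fun s => coordMap q (f s) (V s)) s V') (X : E₀) :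
    coordMap q (f s) (covAlong g f V s X) =
      V' X + christoffel g q (extChartAt 𝓘(ℝ, E) q (f s)) (u' X) (coordMap q (f s) (V s)) := by
  have hp : f s ∈ (extChartAt 𝓘(ℝ, E) (f s)).source := mem_extChartAt_source (f s)
  apply fderiv_transition_injective hq hp
  have hc := christoffel_transition g (mem_transitionDomain hq hp) (u' X) (coordMap q (f s) (V s))
  rw [transition_extChartAt hq, fderiv_transition_coordMap hq hp, coordMap_self] at hc
  rw [map_add, hc, fderiv_transition_coordMap hq hp, coordMap_self,
    covAlong_eq g hf (hasMFDerivAt_extChartAt_comp hf hq hp hu)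
      (hasMFDerivAt_coordMap hf hq hp hu hV)]
  simp only [ContinuousLinearMap.id_apply, add_apply, ContinuousLinearMap.comp_apply,
    ContinuousLinearMap.flip_apply]
  abel

end Along

section Curves

variable {γ : ℝ → P} {t : ℝ} {q p : P}

theorem coordMap_velocityE (hγ : ContinuousAt γ t) (hq : γ t ∈ (extChartAt 𝓘(ℝ, E) q).source)
    {u' : E} (hu : HasDerivAt (fun s => extChartAt 𝓘(ℝ, E) q (γ s)) u' t) :
    coordMap q (γ t) (velocityE γ t) = u' := by
  have := coordMap_mfderiv hγ hq hu.hasFDerivAt.hasMFDerivAt (1 : ℝ)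
  rw [ContinuousLinearMap.toSpanSingleton_apply, one_smul] at this
  exact this

theorem hasDerivAt_extChartAt_comp (hγ : ContinuousAt γ t)
    (hq : γ t ∈ (extChartAt 𝓘(ℝ, E) q).source) (hp : γ t ∈ (extChartAt 𝓘(ℝ, E) p).source)
    {u' : E} (hu : HasDerivAt (fun s => extChartAt 𝓘(ℝ, E) q (γ s)) u' t) :
    HasDerivAt (fun s => extChartAt 𝓘(ℝ, E) p (γ s))
      (fderiv ℝ (transition E q p) (extChartAt 𝓘(ℝ, E) q (γ t)) u') t := by
  refine ((hasFDerivAt_transition_fderiv hq hp).comp_hasDerivAt t hu).congr_of_eventuallyEq ?_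
  filter_upwards [eventually_mem_source hγ hq] with s hs
  exact (transition_extChartAt hs p).symm

theorem coordMap_covAlong_curve [FiniteDimensional ℝ E] (g : SmoothMetric E P) {V : ℝ → E}
    (hγ : ContinuousAt γ t) (hq : γ t ∈ (extChartAt 𝓘(ℝ, E) q).source) {u' V' : E}
    (hu : HasDerivAt (fun s => extChartAt 𝓘(ℝ, E) q (γ s)) u' t)
    (hV : HasDerivAt (fun s => coordMap q (γ s) (V s)) V' t) :
    coordMap q (γ t) (covAlong g γ V t (1 : ℝ)) =
      V' + christoffel g q (extChartAt 𝓘(ℝ, E) q (γ t)) u' (coordMap q (γ t) (V t)) := by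
  have := coordMap_covAlong g hγ hq hu.hasFDerivAt.hasMFDerivAt hV.hasFDerivAt.hasMFDerivAt (1 : ℝ)
  rw [ContinuousLinearMap.toSpanSingleton_apply, one_smul,
    ContinuousLinearMap.toSpanSingleton_apply, one_smul] at this
  exact this

end Curves

section Endomorphisms

/-- An endomorphism of the tangent space in coordinates. -/
def endE (q x : P) (L : E →L[ℝ] E) : E →L[ℝ] E :=
  (coordMap q x).comp (L.comp (coordInv q x))

theorem endE_apply {q x : P} (L : E →L[ℝ] E) (v : E) :
    endE q x L v = coordMap q x (L (coordInv q x v)) := rfl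

theorem endE_coordMap {q x : P} (hq : x ∈ (extChartAt 𝓘(ℝ, E) q).source) (L : E →L[ℝ] E) (v : E) :
    endE q x L (coordMap q x v) = coordMap q x (L v) := by
  rw [endE_apply, coordInv_coordMap hq]

theorem endE_self (x : P) (L : E →L[ℝ] E) : endE x x L = L := by
  ext v
  have := endE_coordMap (mem_extChartAt_source x) L v
  simpa [coordMap_self] using this

theorem endInChart_eq {q x : P} (hq : x ∈ (extChartAt 𝓘(ℝ, E) q).source) (L : E →L[ℝ] E) :
    endInChart q x L = endE q x L := by
  have h := fromChart_eq ((extChartAt 𝓘(ℝ, E) q).map_source hq)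
  rw [(extChartAt 𝓘(ℝ, E) q).left_inv hq] at h
  rw [endE, ← h]
  rfl

theorem fderiv_transition_comp_fderiv_transition {q p x : P}
    (hq : x ∈ (extChartAt 𝓘(ℝ, E) q).source) (hp : x ∈ (extChartAt 𝓘(ℝ, E) p).source) (v : E) :
    fderiv ℝ (transition E p q) (extChartAt 𝓘(ℝ, E) p x)
      (fderiv ℝ (transition E q p) (extChartAt 𝓘(ℝ, E) q x) v) = v := by
  rw [← coordMap_coordInv hq v, fderiv_transition_coordMap hq hp, fderiv_transition_coordMap hp hq]

theorem endE_transition {q p x : P} (hq : x ∈ (extChartAt 𝓘(ℝ, E) q).source)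
    (hp : x ∈ (extChartAt 𝓘(ℝ, E) p).source) (L : E →L[ℝ] E) :
    endE p x L = (fderiv ℝ (transition E q p) (extChartAt 𝓘(ℝ, E) q x)).comp
      ((endE q x L).comp (fderiv ℝ (transition E p q) (extChartAt 𝓘(ℝ, E) p x))) := by
  ext v
  rw [← coordMap_coordInv hp v, endE_coordMap hp]
  simp only [ContinuousLinearMap.comp_apply]
  rw [fderiv_transition_coordMap hp hq, endE_coordMap hq, fderiv_transition_coordMap hq hp]

theorem endE_comp_fderiv_transition {q p x : P} (hq : x ∈ (extChartAt 𝓘(ℝ, E) q).source)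
    (hp : x ∈ (extChartAt 𝓘(ℝ, E) p).source) (L : E →L[ℝ] E) :
    (endE p x L).comp (fderiv ℝ (transition E q p) (extChartAt 𝓘(ℝ, E) q x)) =
      (fderiv ℝ (transition E q p) (extChartAt 𝓘(ℝ, E) q x)).comp (endE q x L) := by
  ext v
  simp only [endE_transition hq hp, ContinuousLinearMap.comp_apply,
    fderiv_transition_comp_fderiv_transition hq hp]

/-- Only the relation between the two derivatives is needed, and it comes from differentiating the
intertwining identity `endE_comp_fderiv_transition` on both sides. In this way the derivative of the
inverse transition is never written out. -/
theorem hasDerivAt_endE {γ : ℝ → P} {t : ℝ} {q p : P} {D : ℝ → E →L[ℝ] E} (hγ : ContinuousAt γ t)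
    (hq : γ t ∈ (extChartAt 𝓘(ℝ, E) q).source) (hp : γ t ∈ (extChartAt 𝓘(ℝ, E) p).source)
    {u' : E} {D' : E →L[ℝ] E} (hu : HasDerivAt (fun s => extChartAt 𝓘(ℝ, E) q (γ s)) u' t)
    (hD : HasDerivAt (fun s => endE q (γ s) (D s)) D' t) :
    ∃ D'' : E →L[ℝ] E, HasDerivAt (fun s => endE p (γ s) (D s)) D'' t ∧ ∀ v,
      D'' (fderiv ℝ (transition E q p) (extChartAt 𝓘(ℝ, E) q (γ t)) v) =
        fderiv ℝ (fderiv ℝ (transition E q p)) (extChartAt 𝓘(ℝ, E) q (γ t)) u'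
            (endE q (γ t) (D t) v)
          + fderiv ℝ (transition E q p) (extChartAt 𝓘(ℝ, E) q (γ t)) (D' v)
          - endE p (γ t) (D t)
            (fderiv ℝ (fderiv ℝ (transition E q p)) (extChartAt 𝓘(ℝ, E) q (γ t)) u' v) := by
  have h1 := (hasFDerivAt_fderiv_transition (mem_transitionDomain hq hp)).comp_hasDerivAt t hu
  have h2 := (hasFDerivAt_fderiv_transition (mem_transitionDomain hp hq)).comp_hasDerivAt t
    (hasDerivAt_extChartAt_comp hγ hq hp hu)
  have h3 := (h1.clm_comp (hD.clm_comp h2)).congr_of_eventuallyEq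
    (f₁ := fun s => endE p (γ s) (D s)) (by
    filter_upwards [eventually_mem_source hγ hq, eventually_mem_source hγ hp] with s hs hs'
    exact endE_transition hs hs' _)
  refine ⟨_, h3, fun v => ?_⟩
  have h4 := h3.clm_comp h1
  have h5 := h1.clm_comp hD
  have h6 := h4.unique (h5.congr_of_eventuallyEq (by
    filter_upwards [eventually_mem_source hγ hq, eventually_mem_source hγ hp] with s hs hs'
    exact endE_comp_fderiv_transition hs hs' _))
  have h7 := DFunLike.congr_fun h6 v
  rw [eq_sub_iff_add_eq]
  exact h7

/-- `covDerivEnd` in the model space. -/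
def covEnd (g : SmoothMetric E P) (γ : ℝ → P) (D : ℝ → E →L[ℝ] E) (t : ℝ) : E →L[ℝ] E :=
  covDerivEnd g γ D t

theorem covEnd_eq (g : SmoothMetric E P) {γ : ℝ → P} {D : ℝ → E →L[ℝ] E} {t : ℝ}
    (hγ : ContinuousAt γ t) {D' : E →L[ℝ] E}
    (hD : HasDerivAt (fun s => endE (γ t) (γ s) (D s)) D' t) :
    covEnd g γ D t = D' + (christoffelAt g (γ t) (velocityE γ t)).comp (D t)
      - (D t).comp (christoffelAt g (γ t) (velocityE γ t)) := by
  have h : HasDerivAt (fun s => endInChart (γ t) (γ s) (D s)) D' t := by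
    refine hD.congr_of_eventuallyEq ?_
    filter_upwards [eventually_mem_source hγ (mem_extChartAt_source (I := 𝓘(ℝ, E)) (γ t))] with s hs
    exact endInChart_eq hs _
  rw [← h.deriv]
  rfl

/-- The covariant derivative of a field of endomorphisms, in any chart. -/
theorem endE_covEnd [FiniteDimensional ℝ E] (g : SmoothMetric E P) {γ : ℝ → P} {t : ℝ} {q : P}
    {D : ℝ → E →L[ℝ] E} (hγ : ContinuousAt γ t)
    (hq : γ t ∈ (extChartAt 𝓘(ℝ, E) q).source)
    {u' : E} {D' : E →L[ℝ] E} (hu : HasDerivAt (fun s => extChartAt 𝓘(ℝ, E) q (γ s)) u' t)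
    (hD : HasDerivAt (fun s => endE q (γ s) (D s)) D' t) :
    endE q (γ t) (covEnd g γ D t) =
      D' + (christoffel g q (extChartAt 𝓘(ℝ, E) q (γ t)) u').comp (endE q (γ t) (D t))
        - (endE q (γ t) (D t)).comp (christoffel g q (extChartAt 𝓘(ℝ, E) q (γ t)) u') := by
  have hp : γ t ∈ (extChartAt 𝓘(ℝ, E) (γ t)).source := mem_extChartAt_source (γ t)
  obtain ⟨D'', hD'', h⟩ := hasDerivAt_endE hγ hq hp hu hD
  have hv := coordMap_velocityE hγ hp (hasDerivAt_extChartAt_comp hγ hq hp hu)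
  rw [coordMap_self, ContinuousLinearMap.id_apply] at hv
  have hc := christoffel_transition g (mem_transitionDomain hq hp) u'
  rw [transition_extChartAt hq, ← hv] at hc
  set A := fderiv ℝ (transition E q (γ t)) (extChartAt 𝓘(ℝ, E) q (γ t)) with hA
  have hAE : ∀ (L : E →L[ℝ] E) v, A (endE q (γ t) L v) = L (A v) := fun L v => by
    have := DFunLike.congr_fun (endE_comp_fderiv_transition hq hp L) v
    rw [endE_self] at this
    exact this.symm
  ext v
  apply fderiv_transition_injective hq hp
  rw [← hA, hAE, covEnd_eq g hγ hD'']
  simp only [add_apply, sub_apply, ContinuousLinearMap.comp_apply, map_add, map_sub, h, hAE, hc,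
    christoffelAt, endE_self]
  abel

end Endomorphisms

end CovariantDerivative

/-! ### Ordinary differential equations: local flows, linear equations, dependence on parameters -/

noncomputable section ODE

open Metric Filter

variable {W : Type*} [NormedAddCommGroup W] [NormedSpace ℝ W]

theorem hasDerivAt_prod_fst {W' : Type*} [NormedAddCommGroup W'] [NormedSpace ℝ W'] {β : ℝ → W × W'}
    {b : W × W'} {t : ℝ} (h : HasDerivAt β b t) : HasDerivAt (fun s => (β s).1) b.1 t :=
  (hasFDerivAt_fst (𝕜 := ℝ) (p := β t)).comp_hasDerivAt t h

theorem hasDerivAt_prod_snd {W' : Type*} [NormedAddCommGroup W'] [NormedSpace ℝ W'] {β : ℝ → W × W'}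
    {b : W × W'} {t : ℝ} (h : HasDerivAt β b t) : HasDerivAt (fun s => (β s).2) b.2 t :=
  (hasFDerivAt_snd (𝕜 := ℝ) (p := β t)).comp_hasDerivAt t h

/-- Local flow of an autonomous `C¹` vector field, staying in a prescribed neighbourhood. -/
theorem exists_localFlow_mem [CompleteSpace W] {X : W → W} {z₀ : W} (hX : ContDiffAt ℝ 1 X z₀)
    {Ω : Set W} (hΩ : Ω ∈ 𝓝 z₀) :
    ∃ h > (0 : ℝ), ∃ U ∈ 𝓝 z₀, ∀ z ∈ U, ∃ α : ℝ → W, α 0 = z ∧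
      ∀ t ∈ Ioo (-h) h, HasDerivAt α (X (α t)) t ∧ α t ∈ Ω := by
  obtain ⟨ε, hε, a, r, L, K, hr, hpl⟩ := IsPicardLindelof.of_contDiffAt_one hX
  obtain ⟨α, hα, hc⟩ := (hpl 0).exists_forall_mem_closedBall_eq_hasDerivWithinAt_continuousOn
  have hr' : closedBall z₀ (r : ℝ) ∈ 𝓝 z₀ := closedBall_mem_nhds _ hr
  have hε' : Icc (0 - ε) (0 + ε) ∈ 𝓝 (0 : ℝ) := Icc_mem_nhds (by linarith) (by linarith)
  have hct : ContinuousAt α (z₀, 0) :=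
    hc.continuousAt (by rw [nhds_prod_eq]; exact prod_mem_prod hr' hε')
  have h0 : α (z₀, 0) = z₀ := (hα z₀ (mem_closedBall_self hr.le)).1
  have hev : ∀ᶠ y in 𝓝 (z₀, (0 : ℝ)), α y ∈ Ω := hct.eventually_mem (by rwa [h0])
  rw [nhds_prod_eq, eventually_prod_iff] at hev
  obtain ⟨p, hp, q, hq, hpq⟩ := hev
  obtain ⟨h, hh, hq'⟩ := Metric.eventually_nhds_iff.1 hq
  refine ⟨min h ε, lt_min hh hε, closedBall z₀ r ∩ {z | p z}, inter_mem hr' hp, fun z hz => ?_⟩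
  refine ⟨fun t => α (z, t), (hα z hz.1).1, fun t ht => ⟨?_, hpq hz.2 (hq' ?_)⟩⟩
  · have ht' : -ε < t ∧ t < ε :=
      ⟨by linarith [ht.1, min_le_right h ε], by linarith [ht.2, min_le_right h ε]⟩
    exact ((hα z hz.1).2 t ⟨by linarith, by linarith⟩).hasDerivAt
      (Icc_mem_nhds (by linarith) (by linarith))
  · rw [Real.dist_eq, sub_zero, abs_lt]
    exact ⟨by linarith [ht.1, min_le_left h ε], by linarith [ht.2, min_le_left h ε]⟩

/-- Solutions of a linear equation on an interval, through any point. -/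
theorem exists_linearODE_solution [CompleteSpace W] {B : ℝ → W →L[ℝ] W} {s₀ : ℝ} {O : Set ℝ}
    (hO : O ∈ 𝓝 s₀) (hB : ContinuousOn B O) :
    ∃ h > (0 : ℝ), Ioo (s₀ - h) (s₀ + h) ⊆ O ∧
      ∃ C : NNReal, (∀ s ∈ Ioo (s₀ - h) (s₀ + h), LipschitzWith C (B s)) ∧
      ∀ a ∈ Ioo (s₀ - h) (s₀ + h), ∀ y : W, ∃ α : ℝ → W, α a = y ∧
        ∀ s ∈ Ioo (s₀ - h) (s₀ + h), HasDerivAt α (B s (α s)) s := by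
  have hs₀ : ContinuousAt B s₀ := hB.continuousAt hO
  have h1 : ∀ᶠ s in 𝓝 s₀, ‖B s‖ < ‖B s₀‖ + 1 :=
    hs₀.norm.eventually_lt continuousAt_const (by simp)
  obtain ⟨e, he, h2⟩ := Metric.eventually_nhds_iff.1 (h1.and hO)
  set C : NNReal := ‖B s₀‖₊ + 1 with hC
  have hCpos : (0 : ℝ) < C := by rw [hC]; positivity
  -- From any starting time in the interval the ends are at distance at most `2h`, and on the ball
  -- of radius `R = ‖y‖ + 1` about `y` the field is bounded by `C · 2R`. The bound `4Ch ≤ 1` keeps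
  -- solutions in that ball; by linearity `h` depends neither on `y` nor on the starting time.
  set h : ℝ := min (e / 2) (1 / (4 * C)) with hh
  have hpos : 0 < h := lt_min (by linarith) (by positivity)
  have hCh : 4 * C * h ≤ 1 := by
    calc 4 * C * h ≤ 4 * C * (1 / (4 * C)) := by gcongr; exact min_le_right _ _
      _ = 1 := by field_simp
  have hI : ∀ s ∈ Icc (s₀ - h) (s₀ + h), ‖B s‖ ≤ C ∧ s ∈ O := fun s hs => by
    have : dist s s₀ < e := by
      rw [Real.dist_eq, abs_lt]
      constructor <;> linarith [hs.1, hs.2, min_le_left (e / 2) (1 / (4 * (C : ℝ)))]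
    exact ⟨(h2 this).1.le, (h2 this).2⟩
  refine ⟨h, hpos, fun s hs => (hI s (Ioo_subset_Icc_self hs)).2, C, fun s hs => ?_,
    fun a ha y => ?_⟩
  · exact (B s).lipschitz.weaken (hI s (Ioo_subset_Icc_self hs)).1
  · set R : NNReal := ‖y‖₊ + 1 with hR
    have hpl : IsPicardLindelof (fun s => B s) (tmin := s₀ - h) (tmax := s₀ + h)
        ⟨a, Ioo_subset_Icc_self ha⟩ y R 0 (C * (2 * R)) C := by
      refine ⟨fun s hs => ((B s).lipschitz.weaken (hI s hs).1).lipschitzOnWith, fun x _ => ?_,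
        fun s hs x hx => ?_, ?_⟩
      · exact (hB.mono fun s hs => (hI s hs).2).clm_apply continuousOn_const
      · have hx' : ‖x‖ ≤ 2 * R := by
          have h3 := mem_closedBall_iff_norm.1 hx
          have h4 : ‖x‖ ≤ ‖x - y‖ + ‖y‖ := by simpa using norm_add_le (x - y) y
          have h5 : ‖y‖ ≤ R := by rw [hR]; simp
          linarith
        calc ‖B s x‖ ≤ ‖B s‖ * ‖x‖ := (B s).le_opNorm x
          _ ≤ C * (2 * R) := by gcongr; exact (hI s hs).1
      · have h5 : max (s₀ + h - a) (a - (s₀ - h)) ≤ 2 * h :=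
          max_le (by linarith [ha.1]) (by linarith [ha.2])
        have hRpos : (0 : ℝ) ≤ R := R.2
        push_cast
        calc (C : ℝ) * (2 * R) * max (s₀ + h - a) (a - (s₀ - h)) ≤ C * (2 * R) * (2 * h) := by
              gcongr
          _ = R * (4 * C * h) := by ring
          _ ≤ R * 1 := by gcongr
          _ = R - 0 := by ring
    obtain ⟨α, hα, hα'⟩ := hpl.exists_eq_forall_mem_Icc_hasDerivWithinAt₀
    exact ⟨α, hα, fun s hs => (hα' s (Ioo_subset_Icc_self hs)).hasDerivAt
      (Icc_mem_nhds hs.1 hs.2)⟩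

/-- Gluing of local solutions along an interval: local existence, locality and local uniqueness of
sections imply global existence. -/
theorem exists_global_of_local {F : Type*} (I : Set ℝ) (hI : I.OrdConnected)
    (Sol : (ℝ → F) → ℝ → Prop)
    (hcongr : ∀ Y Y' s, Y =ᶠ[𝓝 s] Y' → Sol Y s → Sol Y' s)
    (hloc : ∀ s ∈ I, ∃ h > (0 : ℝ), Ioo (s - h) (s + h) ⊆ I ∧
      (∀ a ∈ Ioo (s - h) (s + h), ∀ y : F, ∃ Y, Y a = y ∧ ∀ b ∈ Ioo (s - h) (s + h), Sol Y b) ∧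
      ∀ a b, s - h ≤ a → b ≤ s + h → ∀ Y Y' : ℝ → F, (∀ c ∈ Ioo a b, Sol Y c) →
        (∀ c ∈ Ioo a b, Sol Y' c) → ∀ c₀ ∈ Ioo a b, Y c₀ = Y' c₀ → EqOn Y Y' (Ioo a b))
    {s₀ : ℝ} (hs₀ : s₀ ∈ I) (y₀ : F) :
    ∃ Y : ℝ → F, Y s₀ = y₀ ∧ ∀ s ∈ I, Sol Y s := by
  -- uniqueness on arbitrary open intervals
  have huniq : ∀ J : Set ℝ, IsOpen J → J.OrdConnected → J ⊆ I → ∀ Y Y' : ℝ → F,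
      (∀ c ∈ J, Sol Y c) → (∀ c ∈ J, Sol Y' c) → ∀ c₀ ∈ J, Y c₀ = Y' c₀ → EqOn Y Y' J := by
    intro J hJo hJ hJI Y Y' hY hY' c₀ hc₀ h0 c hc
    have := hJ.isPreconnected.induction₂ (fun a b => Y a = Y' a ↔ Y b = Y' b) (fun x hx => ?_)
      (fun x y z _ _ _ => Iff.trans) (fun x y _ _ => Iff.symm) hc₀ hc
    · exact this.1 h0
    · obtain ⟨h, hh, -, -, hu⟩ := hloc x (hJI hx)
      obtain ⟨e, he, hJe⟩ := Metric.isOpen_iff.1 hJo x hx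
      rw [Real.ball_eq_Ioo] at hJe
      set m := min h e
      have hm : 0 < m := lt_min hh he
      have hsub : Ioo (x - m) (x + m) ⊆ J := (Ioo_subset_Ioo (by linarith [min_le_right h e])
        (by linarith [min_le_right h e])).trans hJe
      have hu' := hu (x - m) (x + m) (by linarith [min_le_left h e])
        (by linarith [min_le_left h e]) Y Y' (fun c hc => hY c (hsub hc))
        (fun c hc => hY' c (hsub hc))
      have hx' : x ∈ Ioo (x - m) (x + m) := ⟨by linarith, by linarith⟩
      filter_upwards [nhdsWithin_le_nhds (Ioo_mem_nhds hx'.1 hx'.2)] with y hy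
      exact ⟨fun hxy => hu' x hx' hxy hy, fun hxy => hu' y hy hxy hx'⟩
  -- the union of all intervals which carry a solution
  let Good : Set ℝ → (ℝ → F) → Prop := fun J Y =>
    IsOpen J ∧ J.OrdConnected ∧ J ⊆ I ∧ s₀ ∈ J ∧ Y s₀ = y₀ ∧ ∀ c ∈ J, Sol Y c
  let A : Set ℝ := {s | ∃ J Y, Good J Y ∧ s ∈ J}
  have hagree : ∀ J Y J' Y', Good J Y → Good J' Y' → EqOn Y Y' (J ∩ J') := by
    rintro J Y J' Y' ⟨h1, h2, h3, h4, h5, h6⟩ ⟨h1', h2', h3', h4', h5', h6'⟩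
    exact huniq _ (h1.inter h1') (h2.inter h2') (inter_subset_left.trans h3) Y Y'
      (fun c hc => h6 c hc.1) (fun c hc => h6' c hc.2) s₀ ⟨h4, h4'⟩ (h5.trans h5'.symm)
  have hs₀A : s₀ ∈ A := by
    obtain ⟨h, hh, hsub, hex, -⟩ := hloc s₀ hs₀
    have hm : s₀ ∈ Ioo (s₀ - h) (s₀ + h) := ⟨by linarith, by linarith⟩
    obtain ⟨Y, hY, hY'⟩ := hex s₀ hm y₀
    exact ⟨_, Y, ⟨isOpen_Ioo, ordConnected_Ioo, hsub, hm, hY, hY'⟩, hm⟩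
  have hAI : A = I := by
    refine Subset.antisymm (fun s ⟨J, Y, hJ, hs⟩ => hJ.2.2.1 hs) fun s hs => ?_
    have := hI.isPreconnected.induction₂ (fun a b => a ∈ A ↔ b ∈ A) (fun x hx => ?_)
      (fun x y z _ _ _ => Iff.trans) (fun x y _ _ => Iff.symm) hs₀ hs
    · exact this.1 hs₀A
    · obtain ⟨h, hh, hsub, hex, hu⟩ := hloc x hx
      have hxm : x ∈ Ioo (x - h) (x + h) := ⟨by linarith, by linarith⟩
      have key : ∀ a ∈ Ioo (x - h) (x + h), a ∈ A → ∀ b ∈ Ioo (x - h) (x + h), b ∈ A := by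
        classical
        rintro a ha ⟨J, Y, ⟨h1, h2, h3, h4, h5, h6⟩, haJ⟩ b hb
        obtain ⟨Z, hZ, hZ'⟩ := hex a ha (Y a)
        have hag : EqOn Y Z (J ∩ Ioo (x - h) (x + h)) :=
          huniq _ (h1.inter isOpen_Ioo) (h2.inter ordConnected_Ioo) (inter_subset_left.trans h3)
            Y Z (fun c hc => h6 c hc.1) (fun c hc => hZ' c hc.2) a ⟨haJ, ha⟩ hZ.symm
        -- The solution on `J` is extended across the local interval. Uniqueness makes the two
        -- pieces agree on the overlap, so near each point `Q` coincides with a single solution.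
        let Q : ℝ → F := fun s => if s ∈ J then Y s else Z s
        have hQJ : EqOn Q Y J := fun s hs => if_pos hs
        have hQZ : EqOn Q Z (Ioo (x - h) (x + h)) := fun s hs => by
          by_cases hsJ : s ∈ J
          · exact (if_pos hsJ).trans (hag ⟨hsJ, hs⟩)
          · exact if_neg hsJ
        have hconn : (J ∪ Ioo (x - h) (x + h)).OrdConnected := by
          rw [← isPreconnected_iff_ordConnected]
          exact IsPreconnected.union a haJ ha h2.isPreconnected isPreconnected_Ioo
        refine ⟨J ∪ Ioo (x - h) (x + h), Q, ⟨h1.union isOpen_Ioo, hconn, union_subset h3 hsub,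
          Or.inl h4, (hQJ h4).trans h5, ?_⟩, Or.inr hb⟩
        rintro c (hc | hc)
        · exact hcongr Y Q c ((hQJ.symm).eventuallyEq_of_mem (h1.mem_nhds hc)) (h6 c hc)
        · exact hcongr Z Q c ((hQZ.symm).eventuallyEq_of_mem (isOpen_Ioo.mem_nhds hc)) (hZ' c hc)
      filter_upwards [nhdsWithin_le_nhds (Ioo_mem_nhds hxm.1 hxm.2)] with y hy
      exact ⟨fun hxA => key x hxm hxA y hy, fun hyA => key y hy hyA x hxm⟩
  have : Nonempty F := ⟨y₀⟩
  choose! J Y hJ hsJ using fun s (hs : s ∈ A) => hs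
  -- The value at `s` is taken from a solution chosen for `s`. Near `s` all these choices agree with
  -- the one at `s`, by `hagree`.
  refine ⟨fun s => Y s s, ?_, fun s hs => ?_⟩
  · exact (hJ s₀ hs₀A).2.2.2.2.1
  · rw [← hAI] at hs
    refine hcongr (Y s) _ s ?_ ((hJ s hs).2.2.2.2.2 s (hsJ s hs))
    filter_upwards [(hJ s hs).1.mem_nhds (hsJ s hs)] with c hc
    have hcA : c ∈ A := ⟨_, _, hJ s hs, hc⟩
    exact hagree _ _ _ _ (hJ s hs) (hJ c hcA) ⟨hc, hsJ c hcA⟩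

/-- Global solutions of a linear equation on an interval which is given in local trivializations:
`τ i s` are the coordinates at `s` in the trivialization `i`, and `σ i s` is the inverse. -/
theorem exists_global_linearODE [CompleteSpace W] {ι : Type*} (I : Set ℝ) (hIo : IsOpen I)
    (hI : I.OrdConnected) (U : ι → Set ℝ) (hU : ∀ i, IsOpen (U i))
    (hcover : ∀ s ∈ I, ∃ i, s ∈ U i) (τ σ : ι → ℝ → W → W)
    (hτσ : ∀ i, ∀ s ∈ U i, ∀ y, τ i s (σ i s y) = y)
    (hστ : ∀ i, ∀ s ∈ U i, ∀ y, σ i s (τ i s y) = y)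
    (B : ι → ℝ → W →L[ℝ] W) (hB : ∀ i, ContinuousOn (B i) (I ∩ U i))
    (hcompat : ∀ i j, ∀ s ∈ I, s ∈ U i → s ∈ U j → ∀ Y : ℝ → W,
      HasDerivAt (fun s => τ i s (Y s)) (B i s (τ i s (Y s))) s →
        HasDerivAt (fun s => τ j s (Y s)) (B j s (τ j s (Y s))) s)
    {s₀ : ℝ} (hs₀ : s₀ ∈ I) (y₀ : W) :
    ∃ Y : ℝ → W, Y s₀ = y₀ ∧ ∀ s ∈ I, ∀ i, s ∈ U i →
      HasDerivAt (fun s => τ i s (Y s)) (B i s (τ i s (Y s))) s := by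
  refine exists_global_of_local I hI (fun Y s => ∀ i, s ∈ U i →
      HasDerivAt (fun s => τ i s (Y s)) (B i s (τ i s (Y s))) s) ?_ ?_ hs₀ y₀
  · intro Y Y' s hYY' h i hi
    rw [← hYY'.eq_of_nhds]
    refine (h i hi).congr_of_eventuallyEq ?_
    filter_upwards [hYY'] with c hc
    rw [hc]
  · intro s hs
    obtain ⟨i, hi⟩ := hcover s hs
    obtain ⟨h, hh, hsub, C, hC, hex⟩ :=
      exists_linearODE_solution ((hIo.inter (hU i)).mem_nhds ⟨hs, hi⟩) (hB i)
    refine ⟨h, hh, fun c hc => (hsub hc).1, fun a ha y => ?_, fun a b ha hb Y Y' hY hY' c₀ hc₀ h0 => ?_⟩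
    · obtain ⟨α, hα, hα'⟩ := hex a ha (τ i a y)
      refine ⟨fun s => σ i s (α s), ?_, fun b hb j hj => ?_⟩
      · simp only [hα, hστ i a (hsub ha).2]
      · refine hcompat i j b (hsub hb).1 (hsub hb).2 hj _ ?_
        simp only [hτσ i b (hsub hb).2]
        refine (hα' b hb).congr_of_eventuallyEq ?_
        filter_upwards [(hU i).mem_nhds (hsub hb).2] with c hc
        exact hτσ i c hc _
    · have hsub' : ∀ c ∈ Ioo a b, c ∈ Ioo (s - h) (s + h) := fun c hc =>
        ⟨by linarith [hc.1], by linarith [hc.2]⟩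
      have := ODE_solution_unique_of_mem_Ioo (v := fun s => B i s) (s := fun _ => univ) (K := C)
        (fun t ht => (hC t (hsub' t ht)).lipschitzOnWith) hc₀
        (fun t ht => ⟨hY t ht i (hsub (hsub' t ht)).2, mem_univ _⟩)
        (fun t ht => ⟨hY' t ht i (hsub (hsub' t ht)).2, mem_univ _⟩) (by simp only [h0])
      intro c hc
      have h1 := this hc
      simp only at h1
      rw [← hστ i c (hsub (hsub' c hc)).2 (Y c), h1, hστ i c (hsub (hsub' c hc)).2]

/-- The mean value inequality for `X - X' z`, applied on `Ω` intersected with the ball of radius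
`‖k‖` about `z`, where the derivative differs from `X' z` by at most `L ‖k‖`. -/
theorem norm_image_sub_le_of_lipschitzOnWith_deriv {X : W → W} {X' : W → W →L[ℝ] W} {Ω : Set W}
    (hΩ : Convex ℝ Ω) (hX : ∀ z ∈ Ω, HasFDerivAt X (X' z) z) {L : NNReal}
    (hL : LipschitzOnWith L X' Ω) {z k : W} (hz : z ∈ Ω) (hk : z + k ∈ Ω) :
    ‖X (z + k) - X z - X' z k‖ ≤ L * ‖k‖ * ‖k‖ := by
  have h := (hΩ.inter (convex_closedBall z ‖k‖)).norm_image_sub_le_of_norm_hasFDerivWithin_le'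
    (f := X) (f' := X') (φ := X' z) (C := L * ‖k‖) (x := z) (y := z + k)
    (fun x hx => (hX x hx.1).hasFDerivWithinAt) (fun x hx => ?_)
    ⟨hz, mem_closedBall_self (norm_nonneg k)⟩ ⟨hk, by simp⟩
  · simpa using h
  · have h1 := hL.dist_le_mul x hx.1 z hz
    rw [dist_eq_norm] at h1
    have h2 : dist x z ≤ ‖k‖ := hx.2
    calc ‖X' x - X' z‖ ≤ L * dist x z := h1
      _ ≤ L * ‖k‖ := by gcongr

/-- Differentiable dependence on parameters: the derivative of the solutions of `y' = c X(y)` with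
respect to a parameter solves the linearized equation. -/
theorem hasFDerivAt_solution {V : Type*} [NormedAddCommGroup V] [NormedSpace ℝ V]
    {X : W → W} {X' : W → W →L[ℝ] W} {Ω : Set W}
    (hΩ : Convex ℝ Ω) (hX : ∀ z ∈ Ω, HasFDerivAt X (X' z) z) {K L : NNReal}
    (hK : LipschitzOnWith K X Ω) (hL : LipschitzOnWith L X' Ω) {α : V → ℝ → W} {v₀ : V} {c : ℝ}
    (hα : ∀ᶠ v in 𝓝 v₀, ∀ s ∈ Icc (0 : ℝ) 1, HasDerivAt (α v) (c • X (α v s)) s ∧ α v s ∈ Ω)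
    {ρ : ℝ} (hρ : 0 < ρ) (hball : ∀ s ∈ Icc (0 : ℝ) 1, closedBall (α v₀ s) ρ ⊆ Ω)
    {w : ℝ → V →L[ℝ] W}
    (hw : ∀ s ∈ Icc (0 : ℝ) 1, HasDerivAt w (c • (X' (α v₀ s)).comp (w s)) s)
    (h0 : HasFDerivAt (fun v => α v 0) (w 0) v₀) :
    HasFDerivAt (fun v => α v 1) (w 1) v₀ := by
  have hwc : ContinuousOn w (Icc 0 1) := fun s hs => (hw s hs).continuousAt.continuousWithinAt
  obtain ⟨Cw, hCw⟩ := isCompact_Icc.exists_bound_of_continuousOn hwc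
  have hCw0 : 0 ≤ Cw := (norm_nonneg _).trans (hCw 0 ⟨le_rfl, zero_le_one⟩)
  -- The summand `1` only keeps the constant nonzero, as required by the closed form of the Grönwall
  -- bound.
  set K' : NNReal := ‖c‖₊ * K + 1 with hK'
  have hK'0 : (K' : ℝ) ≠ 0 := by rw [hK']; positivity
  have hα₀ := hα.self_of_nhds
  have hsmall : ∀ᶠ v in 𝓝 v₀, Cw * ‖v - v₀‖ < ρ := by
    have : ContinuousAt (fun v => Cw * ‖v - v₀‖) v₀ := by fun_prop
    exact this.eventually_lt continuousAt_const (by simpa using hρ)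
  set δ : V → ℝ := fun v => ‖α v 0 - α v₀ 0 - w 0 (v - v₀)‖ with hδ
  have hbound : ∀ᶠ v in 𝓝 v₀, ‖α v 1 - α v₀ 1 - w 1 (v - v₀)‖ ≤
      δ v * Real.exp K' + (‖c‖ * L * Cw * Cw * (Real.exp K' - 1) / K') * (‖v - v₀‖ * ‖v - v₀‖) := by
    filter_upwards [hα, hsmall] with v hv hv'
    set h := v - v₀
    have hwh : ∀ s ∈ Icc (0 : ℝ) 1, ‖w s h‖ ≤ Cw * ‖h‖ := fun s hs =>
      ((w s).le_opNorm h).trans (by gcongr; exact hCw s hs)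
    have hy : ∀ s ∈ Icc (0 : ℝ) 1, α v₀ s + w s h ∈ Ω := fun s hs => by
      apply hball s hs
      rw [mem_closedBall_iff_norm, add_sub_cancel_left]
      exact (hwh s hs).trans hv'.le
    have hyd : ∀ s ∈ Icc (0 : ℝ) 1, HasDerivAt (fun s => α v₀ s + w s h)
        (c • X (α v₀ s) + c • X' (α v₀ s) (w s h)) s := fun s hs => by
      have := (hα₀ s hs).1.fun_add ((hw s hs).clm_apply (hasDerivAt_const s h))
      simpa using this
    have hlip : ∀ t ∈ Ico (0 : ℝ) 1, LipschitzOnWith K' (fun z => c • X z) Ω := fun t _ =>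
      LipschitzOnWith.of_dist_le_mul fun x hx y hy => by
        rw [dist_eq_norm, ← smul_sub, norm_smul, ← dist_eq_norm, hK']
        have h1 := hK.dist_le_mul x hx y hy
        push_cast
        calc ‖c‖ * dist (X x) (X y) ≤ ‖c‖ * (K * dist x y) := by gcongr
          _ ≤ (‖c‖ * K + 1) * dist x y := by nlinarith [dist_nonneg (x := x) (y := y)]
    -- The curve `α v₀ + w h` solves the equation up to an error quadratic in `h`. Grönwall's
    -- inequality then bounds its distance at time `1` from the true solution `α v` by the initial
    -- error, which is `o(‖h‖)`, plus a multiple of `‖h‖²`.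
    have hgr := dist_le_of_approx_trajectories_ODE_of_mem (v := fun _ z => c • X z)
      (s := fun _ => Ω) (K := K') (f := α v) (f' := fun s => c • X (α v s))
      (g := fun s => α v₀ s + w s h) (g' := fun s => c • X (α v₀ s) + c • X' (α v₀ s) (w s h))
      (a := 0) (b := 1) (εf := 0) (εg := ‖c‖ * L * Cw * Cw * (‖h‖ * ‖h‖)) (δ := δ v)
      hlip (fun s hs => (hv s hs).1.continuousAt.continuousWithinAt)
      (fun s hs => (hv s (Ico_subset_Icc_self hs)).1.hasDerivWithinAt)
      (fun s _ => by simp) (fun s hs => (hv s (Ico_subset_Icc_self hs)).2)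
      (fun s hs => (hyd s hs).continuousAt.continuousWithinAt)
      (fun s hs => (hyd s (Ico_subset_Icc_self hs)).hasDerivWithinAt)
      (fun s hs => ?_) (fun s hs => hy s (Ico_subset_Icc_self hs)) ?_ 1 ⟨zero_le_one, le_rfl⟩
    · rw [gronwallBound_of_K_ne_0 hK'0, dist_eq_norm, ← sub_sub] at hgr
      refine hgr.trans (le_of_eq ?_)
      simp only [zero_add, sub_zero, mul_one]
      ring
    · have hs' := Ico_subset_Icc_self hs
      have h1 := norm_image_sub_le_of_lipschitzOnWith_deriv hΩ hX hL (hα₀ s hs').2 (hy s hs')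
      rw [dist_comm, dist_eq_norm, ← smul_add, ← smul_sub, norm_smul, ← sub_sub]
      calc ‖c‖ * ‖X (α v₀ s + w s h) - X (α v₀ s) - X' (α v₀ s) (w s h)‖
          ≤ ‖c‖ * (L * ‖w s h‖ * ‖w s h‖) := by gcongr
        _ ≤ ‖c‖ * (L * (Cw * ‖h‖) * (Cw * ‖h‖)) := by gcongr <;> exact hwh s hs'
        _ = ‖c‖ * L * Cw * Cw * (‖h‖ * ‖h‖) := by ring
    · rw [dist_eq_norm, ← sub_sub]
  rw [hasFDerivAt_iff_isLittleO]
  have h1 : (fun v => δ v * Real.exp K') =o[𝓝 v₀] fun v => v - v₀ := by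
    have h2 := (hasFDerivAt_iff_isLittleO.1 h0).norm_left.const_mul_left (Real.exp K')
    simpa [hδ, mul_comm] using h2
  have h2 : (fun v => (‖c‖ * L * Cw * Cw * (Real.exp K' - 1) / K') * (‖v - v₀‖ * ‖v - v₀‖))
      =o[𝓝 v₀] fun v => v - v₀ := by
    refine Asymptotics.IsLittleO.const_mul_left ?_ _
    have h3 : (fun v => ‖v - v₀‖) =o[𝓝 v₀] fun _ => (1 : ℝ) := by
      rw [Asymptotics.isLittleO_one_iff]
      have : ContinuousAt (fun v => ‖v - v₀‖) v₀ := by fun_prop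
      simpa [ContinuousAt] using this
    have h4 := h3.mul_isBigO (Asymptotics.isBigO_refl (fun v => ‖v - v₀‖) (𝓝 v₀))
    simp only [one_mul] at h4
    exact h4.trans_isBigO (Asymptotics.isBigO_refl (fun v => v - v₀) (𝓝 v₀)).norm_left
  refine Asymptotics.IsBigO.trans_isLittleO (Asymptotics.IsBigO.of_bound 1 ?_) (h1.add h2)
  filter_upwards [hbound] with v hv
  rw [one_mul]
  exact hv.trans (le_abs_self _)

end ODE

/-! ### Geodesics as integral curves of the spray in charts -/

noncomputable section Geodesics

variable {E : Type*} [NormedAddCommGroup E] [NormedSpace ℝ E]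
  {P : Type*} [TopologicalSpace P] [ChartedSpace E P] [IsManifold 𝓘(ℝ, E) ∞ P]

/-- The geodesic spray in the chart at `q`. -/
def spray (g : SmoothMetric E P) (q : P) (z : E × E) : E × E :=
  (z.2, -christoffel g q z.1 z.2 z.2)

/-- Position and velocity of a curve in the chart at `q`. -/
def chartState (q : P) (γ : ℝ → P) (s : ℝ) : E × E :=
  (extChartAt 𝓘(ℝ, E) q (γ s), coordMap q (γ s) (velocityE γ s))

theorem velocityE_comp_mul {E : Type*} [NormedAddCommGroup E] [NormedSpace ℝ E]
    {P : Type*} [TopologicalSpace P] [ChartedSpace E P] {γ : ℝ → P} {c t : ℝ} (h : MDifferentiableAt 𝓘(ℝ, ℝ) 𝓘(ℝ, E) γ (c * t)) :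
    (velocityE (fun s => γ (c * s)) t : E) = c • velocityE γ (c * t) := by
  have h1 : HasDerivAt (fun s : ℝ => c * s) c t := by
    simpa using (hasDerivAt_id t).const_mul c
  have h2 := (HasMFDerivAt.comp t h.hasMFDerivAt h1.hasFDerivAt.hasMFDerivAt).mfderiv
  have h3 : (velocityE (fun s => γ (c * s)) t : E) = mfderivE (E₀ := ℝ) (E := E) γ (c * t)
      (ContinuousLinearMap.toSpanSingleton ℝ c (1 : ℝ)) :=
    DFunLike.congr_fun (F := ℝ →L[ℝ] E) h2 (1 : ℝ)
  have h4 : (velocityE γ (c * t) : E) = mfderivE (E₀ := ℝ) (E := E) γ (c * t) (1 : ℝ) := rfl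
  rw [h3, h4, ← map_smul]
  simp

theorem contDiffAt_extChartAt_comp {γ : ℝ → P} {J : Set ℝ} (hJ : IsOpen J)
    (hγ : ContMDiffOn 𝓘(ℝ, ℝ) 𝓘(ℝ, E) ∞ γ J) {t : ℝ} (ht : t ∈ J) {q : P}
    (hq : γ t ∈ (extChartAt 𝓘(ℝ, E) q).source) :
    ContDiffAt ℝ ∞ (fun s => extChartAt 𝓘(ℝ, E) q (γ s)) t := by
  have h1 : ContMDiffAt 𝓘(ℝ, ℝ) 𝓘(ℝ, E) ∞ γ t := hγ.contMDiffAt (hJ.mem_nhds ht)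
  have h2 : ContMDiffAt 𝓘(ℝ, E) 𝓘(ℝ, E) ∞ (extChartAt 𝓘(ℝ, E) q) (γ t) :=
    contMDiffAt_extChartAt' (by simpa using hq)
  exact (h2.comp t h1).contDiffAt

theorem eventually_chartState {γ : ℝ → P} {J : Set ℝ} (hJ : IsOpen J)
    (hγ : ContMDiffOn 𝓘(ℝ, ℝ) 𝓘(ℝ, E) ∞ γ J) {t : ℝ} (ht : t ∈ J) {q : P}
    (hq : γ t ∈ (extChartAt 𝓘(ℝ, E) q).source) :
    ∀ᶠ s in 𝓝 t, HasDerivAt (fun s => extChartAt 𝓘(ℝ, E) q (γ s))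
      (coordMap q (γ s) (velocityE γ s)) s := by
  have hc : ContinuousAt γ t := (hγ.contMDiffAt (hJ.mem_nhds ht)).continuousAt
  filter_upwards [eventually_mem_source (E := E) hc hq, hJ.mem_nhds ht] with s hs hsJ
  have hd := ((contDiffAt_extChartAt_comp hJ hγ hsJ hs).differentiableAt (by simp)).hasDerivAt
  rwa [coordMap_velocityE (hγ.contMDiffAt (hJ.mem_nhds hsJ)).continuousAt hs hd]

theorem contDiffAt_chartState {γ : ℝ → P} {J : Set ℝ} (hJ : IsOpen J)
    (hγ : ContMDiffOn 𝓘(ℝ, ℝ) 𝓘(ℝ, E) ∞ γ J) {t : ℝ} (ht : t ∈ J) {q : P}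
    (hq : γ t ∈ (extChartAt 𝓘(ℝ, E) q).source) :
    ContDiffAt ℝ ∞ ((chartState q γ : ℝ → E × E)) t := by
  have h1 := contDiffAt_extChartAt_comp hJ hγ ht hq
  refine h1.prodMk ?_
  have h2 : ContDiffAt ℝ ∞ (deriv fun s => extChartAt 𝓘(ℝ, E) q (γ s)) t := by
    have h3 : ContDiffAt ℝ ∞ (fun s' => fderiv ℝ (fun s => extChartAt 𝓘(ℝ, E) q (γ s)) s' (1 : ℝ)) t :=
      (h1.fderiv_right (m := ∞) (by simp)).clm_apply contDiffAt_const
    simpa only [fderiv_apply_one_eq_deriv] using h3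
  refine h2.congr_of_eventuallyEq ?_
  filter_upwards [eventually_chartState (E := E) hJ hγ ht hq] with s hs
  exact hs.deriv.symm

theorem velocityE_congr {γ γ' : ℝ → P} {t : ℝ} (h : γ =ᶠ[𝓝 t] γ') :
    (velocityE γ t : E) = velocityE γ' t := by
  unfold velocityE velocity
  rw [h.mfderiv_eq]
  rfl

theorem chartState_congr {γ γ' : ℝ → P} {t : ℝ} (h : γ =ᶠ[𝓝 t] γ') (q : P) :
    (chartState q γ t : E × E) = chartState q γ' t := by
  rw [chartState, chartState, velocityE_congr h, h.eq_of_nhds]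

/-- Allows uniqueness for the first-order spray equation in a chart to be read as a statement about
position and velocity. -/
theorem chartState_eq_iff {γ γ' : ℝ → P} {t t' : ℝ} {q : P}
    (h : γ t ∈ (extChartAt 𝓘(ℝ, E) q).source) (h' : γ' t' ∈ (extChartAt 𝓘(ℝ, E) q).source) :
    (chartState q γ t : E × E) = chartState q γ' t' ↔
      γ t = γ' t' ∧ (velocityE γ t : E) = velocityE γ' t' := by
  constructor
  · intro he
    have h1 : γ t = γ' t' := (extChartAt 𝓘(ℝ, E) q).injOn h h' (congrArg Prod.fst he)
    have h2 : coordMap q (γ t) (velocityE γ t) = coordMap q (γ' t') (velocityE γ' t' : E) :=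
      congrArg Prod.snd he
    refine ⟨h1, ?_⟩
    rw [← coordInv_coordMap h (velocityE γ t), h2, h1, coordInv_coordMap h']
  · rintro ⟨h1, h2⟩
    rw [chartState, chartState, h1, h2]

variable [FiniteDimensional ℝ E] (g : SmoothMetric E P)

theorem IsGeodesicOn.hasDerivAt_chartState {g : SmoothMetric E P} {γ : ℝ → P} {J : Set ℝ}
    (h : IsGeodesicOn g γ J) {t : ℝ} (ht : t ∈ J) {q : P}
    (hq : γ t ∈ (extChartAt 𝓘(ℝ, E) q).source) :
    HasDerivAt (chartState q γ) (spray g q (chartState q γ t)) t := by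
  have hc : ContinuousAt γ t := (h.2.1.contMDiffAt (h.1.mem_nhds ht)).continuousAt
  have h1 := (eventually_chartState h.1 h.2.1 ht hq).self_of_nhds
  have h2 : HasDerivAt (chartState q γ) (deriv (chartState q γ) t) t :=
    ((contDiffAt_chartState h.1 h.2.1 ht hq).differentiableAt (by simp)).hasDerivAt
  have h3 : HasDerivAt (fun s => coordMap q (γ s) (velocityE γ s))
      (deriv (chartState q γ) t).2 t := hasDerivAt_prod_snd h2
  have h4 := coordMap_covAlong_curve g hc hq h1 h3
  have h5 : covAlong g γ (velocityE γ) t (1 : ℝ) = 0 := h.2.2 t ht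
  rw [h5, map_zero] at h4
  have h6 : HasDerivAt (chartState q γ) (coordMap q (γ t) (velocityE γ t),
      (deriv (chartState q γ) t).2) t := h1.prodMk h3
  have h7 : (deriv (chartState q γ) t).2 = -christoffel g q (extChartAt 𝓘(ℝ, E) q (γ t))
    (coordMap q (γ t) (velocityE γ t)) (coordMap q (γ t) (velocityE γ t)) := eq_neg_of_add_eq_zero_left h4.symm
  rw [h7] at h6
  exact h6

theorem isGeodesicOn_of_hasDerivAt {γ : ℝ → P} {J : Set ℝ} (hJ : IsOpen J)
    (hγ : ContMDiffOn 𝓘(ℝ, ℝ) 𝓘(ℝ, E) ∞ γ J)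
    (h : ∀ t ∈ J, ∃ q, γ t ∈ (extChartAt 𝓘(ℝ, E) q).source ∧
      HasDerivAt (chartState q γ) (spray g q (chartState q γ t)) t) : IsGeodesicOn g γ J := by
  refine ⟨hJ, hγ, fun t ht => ?_⟩
  obtain ⟨q, hq, hd⟩ := h t ht
  have hc : ContinuousAt γ t := (hγ.contMDiffAt (hJ.mem_nhds ht)).continuousAt
  have h4 := coordMap_covAlong_curve g (V := velocityE γ) hc hq (hasDerivAt_prod_fst hd) (hasDerivAt_prod_snd hd)
  have h5 : coordMap q (γ t) (covAlong g γ (velocityE γ) t (1 : ℝ)) = 0 := by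
    rw [h4]
    simp [spray, chartState]
  have h6 := congrArg (coordInv q (γ t)) h5
  rw [coordInv_coordMap hq, map_zero] at h6
  exact h6

theorem contDiffAt_spray {q : P} {z : E × E} (hz : z.1 ∈ (extChartAt 𝓘(ℝ, E) q).target) :
    ContDiffAt ℝ ∞ (spray g q) z :=
  contDiffAt_snd.prodMk ((((contDiffAt_christoffel g hz).comp z contDiffAt_fst).clm_apply
    contDiffAt_snd).clm_apply contDiffAt_snd).neg

/-- Solutions of the spray equation in a chart are geodesics. -/
theorem isGeodesicOn_of_spray {q : P} {β : ℝ → E × E} {J : Set ℝ} (hJ : IsOpen J)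
    (hβ : ∀ t ∈ J, HasDerivAt β (spray g q (β t)) t)
    (ht : ∀ t ∈ J, (β t).1 ∈ (extChartAt 𝓘(ℝ, E) q).target) :
    IsGeodesicOn g (fun s => (extChartAt 𝓘(ℝ, E) q).symm (β s).1) J ∧
      ∀ t ∈ J, (extChartAt 𝓘(ℝ, E) q).symm (β t).1 ∈ (extChartAt 𝓘(ℝ, E) q).source ∧
        chartState q (fun s => (extChartAt 𝓘(ℝ, E) q).symm (β s).1) t = β t := by
  -- Bootstrapping: if `β` is of class `C^k`, so is `β' = spray(β)`, hence `β` is of class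
  -- `C^(k+1)`.
  have hsm : ∀ k : ℕ, ContDiffOn ℝ k β J := by
    intro k
    induction k with
    | zero =>
      simp only [Nat.cast_zero, contDiffOn_zero]
      exact fun t ht => (hβ t ht).continuousAt.continuousWithinAt
    | succ k ih =>
      push_cast
      rw [contDiffOn_succ_iff_deriv_of_isOpen hJ]
      refine ⟨fun t ht => (hβ t ht).differentiableAt.differentiableWithinAt, by simp, ?_⟩
      have hk : (k : WithTop ℕ∞) ≤ ∞ := by exact_mod_cast le_top
      refine ContDiffOn.congr (f := fun t => spray g q (β t)) (fun t ht' => ?_)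
        fun t ht' => (hβ t ht').deriv
      exact ((contDiffAt_spray g (ht t ht')).of_le hk).comp_contDiffWithinAt t (ih t ht')
  have hsm' : ContDiffOn ℝ ∞ β J := contDiffOn_infty.2 hsm
  set γ : ℝ → P := fun s => (extChartAt 𝓘(ℝ, E) q).symm (β s).1 with hγdef
  have hγ : ContMDiffOn 𝓘(ℝ, ℝ) 𝓘(ℝ, E) ∞ γ J :=
    (contMDiffOn_extChartAt_symm q).comp (contDiff_fst.comp_contDiffOn hsm').contMDiffOn ht
  have hsrc : ∀ t ∈ J, γ t ∈ (extChartAt 𝓘(ℝ, E) q).source := fun t h =>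
    (extChartAt 𝓘(ℝ, E) q).map_target (ht t h)
  have hst : ∀ t ∈ J, chartState q γ t = β t := by
    intro t h
    have h1 : HasDerivAt (fun s => extChartAt 𝓘(ℝ, E) q (γ s)) (β t).2 t := by
      refine (hasDerivAt_prod_fst (hβ t h)).congr_of_eventuallyEq ?_
      filter_upwards [hJ.mem_nhds h] with s hs
      exact (extChartAt 𝓘(ℝ, E) q).right_inv (ht s hs)
    have h2 := coordMap_velocityE (hγ.contMDiffAt (hJ.mem_nhds h)).continuousAt (hsrc t h) h1
    rw [chartState, h2]
    exact Prod.ext ((extChartAt 𝓘(ℝ, E) q).right_inv (ht t h)) rfl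
  refine ⟨isGeodesicOn_of_hasDerivAt g hJ hγ fun t h => ⟨q, hsrc t h, ?_⟩,
    fun t h => ⟨hsrc t h, hst t h⟩⟩
  rw [hst t h]
  refine (hβ t h).congr_of_eventuallyEq ?_
  filter_upwards [hJ.mem_nhds h] with s hs
  exact hst s hs

theorem IsGeodesicOn.congr {g : SmoothMetric E P} {γ γ' : ℝ → P} {J : Set ℝ}
    (h : IsGeodesicOn g γ J) (he : EqOn γ' γ J) : IsGeodesicOn g γ' J := by
  have hγ' : ContMDiffOn 𝓘(ℝ, ℝ) 𝓘(ℝ, E) ∞ γ' J := h.2.1.congr he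
  refine isGeodesicOn_of_hasDerivAt g h.1 hγ' fun t ht => ⟨γ t, ?_, ?_⟩
  · rw [he ht]; exact mem_extChartAt_source _
  · have h1 := h.hasDerivAt_chartState ht (mem_extChartAt_source (γ t))
    have h2 : ∀ s ∈ J, (chartState (γ t) γ' s : E × E) = chartState (γ t) γ s := fun s hs =>
      chartState_congr (he.eventuallyEq_of_mem (h.1.mem_nhds hs)) _
    rw [h2 t ht]
    refine h1.congr_of_eventuallyEq ?_
    filter_upwards [h.1.mem_nhds ht] with s hs
    exact h2 s hs

/-- The spray is quadratic in the velocity: rescaling time by `c` multiplies velocity by `c` and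
acceleration by `c²`. The case `c = 0`, a constant curve, is included. -/
theorem IsGeodesicOn.comp_mul {g : SmoothMetric E P} {γ : ℝ → P} {J : Set ℝ}
    (h : IsGeodesicOn g γ J) (c : ℝ) :
    IsGeodesicOn g (fun s => γ (c * s)) ((fun s => c * s) ⁻¹' J) := by
  have hJ : IsOpen ((fun s => c * s) ⁻¹' J) := h.1.preimage (by fun_prop)
  have hsm : ContMDiffOn 𝓘(ℝ, ℝ) 𝓘(ℝ, E) ∞ (fun s => γ (c * s)) ((fun s => c * s) ⁻¹' J) := by
    refine h.2.1.comp (t := J) ?_ (fun s hs => hs)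
    exact (contDiff_const.mul contDiff_id).contMDiff.contMDiffOn
  refine isGeodesicOn_of_hasDerivAt g hJ hsm fun t ht => ⟨γ (c * t), mem_extChartAt_source _, ?_⟩
  have h1 := h.hasDerivAt_chartState ht (mem_extChartAt_source (γ (c * t)))
  have h2 : ∀ s ∈ (fun s => c * s) ⁻¹' J, (chartState (γ (c * t)) (fun s => γ (c * s)) s : E × E) =
      ((chartState (γ (c * t)) γ (c * s) : E × E).1, c • (chartState (γ (c * t)) γ (c * s)).2) := by
    intro s hs
    rw [chartState, velocityE_comp_mul
      ((h.2.1.contMDiffAt (h.1.mem_nhds hs)).mdifferentiableAt (by simp)), map_smul]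
    rfl
  have hm : HasDerivAt (fun s : ℝ => c * s) c t := by
    simpa using (hasDerivAt_id t).const_mul c
  have h3 := h1.scomp t hm
  have h4 := (hasDerivAt_prod_fst h3).prodMk ((hasDerivAt_prod_snd h3).const_smul c)
  rw [h2 t ht]
  have h5 : spray g (γ (c * t)) ((chartState (γ (c * t)) γ (c * t) : E × E).1,
      c • (chartState (γ (c * t)) γ (c * t)).2) =
      ((c • spray g (γ (c * t)) (chartState (γ (c * t)) γ (c * t))).1,
        c • (c • spray g (γ (c * t)) (chartState (γ (c * t)) γ (c * t))).2) := by
    simp [spray]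
  rw [h5]
  refine h4.congr_of_eventuallyEq ?_
  filter_upwards [hJ.mem_nhds ht] with s hs
  exact h2 s hs

end Geodesics

/-! ### Uniqueness of geodesics and the exponential map along a ray -/

noncomputable section ExponentialMap

variable {E : Type*} [NormedAddCommGroup E] [NormedSpace ℝ E]
  {P : Type*} [TopologicalSpace P] [ChartedSpace E P] [IsManifold 𝓘(ℝ, E) ∞ P]
  {g : SmoothMetric E P}

theorem IsGeodesicOn.continuousAt {γ : ℝ → P} {J : Set ℝ} (h : IsGeodesicOn g γ J) {t : ℝ}
    (ht : t ∈ J) : ContinuousAt γ t :=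
  (h.2.1.contMDiffAt (h.1.mem_nhds ht)).continuousAt

theorem IsGeodesicOn.velocityE_comp_mul {γ : ℝ → P} {J : Set ℝ} (h : IsGeodesicOn g γ J) {c t : ℝ}
    (ht : c * t ∈ J) : (velocityE (fun s => γ (c * s)) t : E) = c • velocityE γ (c * t) :=
  _root_.velocityE_comp_mul ((h.2.1.contMDiffAt (h.1.mem_nhds ht)).mdifferentiableAt (by simp))

theorem isExpGeodesic_initial {E : Type*} [NormedAddCommGroup E] [NormedSpace ℝ E] {P : Type*} [TopologicalSpace P]
    [ChartedSpace E P] {x : P} {v : E} {γ : ℝ → P} :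
    (⟨γ 0, velocity γ 0⟩ : TangentBundle 𝓘(ℝ, E) P) = ⟨x, v⟩ ↔
      γ 0 = x ∧ (velocityE γ 0 : E) = v := by
  constructor
  · intro h
    exact ⟨congrArg (fun z : TangentBundle 𝓘(ℝ, E) P => z.1) h,
      congrArg (fun z : TangentBundle 𝓘(ℝ, E) P => (show E from z.2)) h⟩
  · rintro ⟨rfl, rfl⟩
    rfl

variable [FiniteDimensional ℝ E]

theorem IsGeodesicOn.eventuallyEq {γ γ' : ℝ → P} {J J' : Set ℝ} (h : IsGeodesicOn g γ J)
    (h' : IsGeodesicOn g γ' J') {t : ℝ} (ht : t ∈ J) (ht' : t ∈ J') (h0 : γ t = γ' t)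
    (h1 : (velocityE γ t : E) = velocityE γ' t) : γ =ᶠ[𝓝 t] γ' := by
  have hq : γ t ∈ (extChartAt 𝓘(ℝ, E) (γ t)).source := mem_extChartAt_source _
  have hq' : γ' t ∈ (extChartAt 𝓘(ℝ, E) (γ t)).source := h0 ▸ hq
  have hst : (chartState (γ t) γ t : E × E) = chartState (γ t) γ' t :=
    (chartState_eq_iff hq hq').2 ⟨h0, h1⟩
  have hz : (chartState (γ t) γ t : E × E).1 ∈ (extChartAt 𝓘(ℝ, E) (γ t)).target :=
    (extChartAt 𝓘(ℝ, E) (γ t)).map_source hq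
  obtain ⟨K, s, hs, hK⟩ := ((contDiffAt_spray g hz).of_le (m := 1) (by simp)).exists_lipschitzOnWith
  have e1 := eventually_mem_source (h.continuousAt ht) hq
  have e2 := eventually_mem_source (h'.continuousAt ht') hq'
  have key := ODE_solution_unique_of_eventually (v := fun _ => spray g (γ t)) (s := fun _ => s)
    (K := K) (f := chartState (γ t) γ) (g := chartState (γ t) γ') (t₀ := t)
    (Filter.Eventually.of_forall fun _ => hK) ?_ ?_ hst
  · filter_upwards [key, e1, e2] with c hc hc1 hc2
    exact ((chartState_eq_iff hc1 hc2).1 hc).1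
  · have hc := (h.hasDerivAt_chartState ht hq).continuousAt
    filter_upwards [e1, hc.eventually_mem hs, h.1.mem_nhds ht] with c hc1 hc2 hc3
    exact ⟨h.hasDerivAt_chartState hc3 hc1, hc2⟩
  · have hc := (h'.hasDerivAt_chartState ht' hq').continuousAt
    filter_upwards [e2, hc.eventually_mem (hst ▸ hs), h'.1.mem_nhds ht'] with c hc1 hc2 hc3
    exact ⟨h'.hasDerivAt_chartState hc3 hc1, hc2⟩

/-- Uniqueness of geodesics. -/
theorem IsGeodesicOn.eqOn [T2Space P] {γ γ' : ℝ → P} {J J' : Set ℝ} (h : IsGeodesicOn g γ J)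
    (h' : IsGeodesicOn g γ' J') {S : Set ℝ} (hS : S.OrdConnected) (hSJ : S ⊆ J) (hSJ' : S ⊆ J')
    {t : ℝ} (ht : t ∈ S) (h0 : γ t = γ' t) (h1 : (velocityE γ t : E) = velocityE γ' t) :
    EqOn γ γ' S := by
  let Q : ℝ → Prop := fun s => γ s = γ' s ∧ (velocityE γ s : E) = velocityE γ' s
  suffices H : ∀ s ∈ S, Q s from fun s hs => (H s hs).1
  intro s hs
  have := hS.isPreconnected.induction₂ (fun a b => Q a ↔ Q b) (fun x hx => ?_)
    (fun x y z _ _ _ => Iff.trans) (fun x y _ _ => Iff.symm) ht hs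
  · exact this.1 ⟨h0, h1⟩
  -- It remains to see that the truth of `Q` is locally constant. Where `Q` holds, this is local
  -- uniqueness. Where it fails with equal positions, the states in a common chart are distinct and
  -- stay so by continuity; where the positions differ, the Hausdorff property separates them.
  apply Filter.Eventually.filter_mono nhdsWithin_le_nhds
  by_cases hQ : Q x
  · have he := h.eventuallyEq h' (hSJ hx) (hSJ' hx) hQ.1 hQ.2
    filter_upwards [he.eventuallyEq_nhds] with y hy
    exact iff_of_true hQ ⟨hy.eq_of_nhds, velocityE_congr hy⟩
  have hc := h.continuousAt (hSJ hx)
  have hc' := h'.continuousAt (hSJ' hx)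
  by_cases hx0 : γ x = γ' x
  · have hq : γ x ∈ (extChartAt 𝓘(ℝ, E) (γ x)).source := mem_extChartAt_source _
    have hq' : γ' x ∈ (extChartAt 𝓘(ℝ, E) (γ x)).source := hx0 ▸ hq
    have hne : (chartState (γ x) γ x : E × E) ≠ chartState (γ x) γ' x := fun he =>
      hQ ((chartState_eq_iff hq hq').1 he)
    have hev := ((h.hasDerivAt_chartState (hSJ hx) hq).continuousAt.prodMk_nhds
      (h'.hasDerivAt_chartState (hSJ' hx) hq').continuousAt).eventually_mem
        (isClosed_diagonal.isOpen_compl.mem_nhds hne)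
    filter_upwards [hev, eventually_mem_source hc hq, eventually_mem_source hc' hq'] with y h1 h2 h3
    exact iff_of_false hQ fun hy => h1 ((chartState_eq_iff h2 h3).2 hy)
  · have hev := (hc.prodMk_nhds hc').eventually_mem (isClosed_diagonal.isOpen_compl.mem_nhds hx0)
    filter_upwards [hev] with y hy
    exact iff_of_false hQ fun h => hy h.1

/-- The geodesic with given initial position and velocity. -/
def geodesicCurve (g : SmoothMetric E P) (x : P) (v : E) (r : ℝ) : P := expMap g x (r • v : E)

/-- The domain of the geodesic with given initial position and velocity. -/
def geodesicDomain (g : SmoothMetric E P) (x : P) (v : E) : Set ℝ :=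
  {r | ExpDefined g x (r • v : E)}

/-- The curve `r ↦ γ (s r)` is a geodesic with initial velocity `s v` that reaches `γ s` at time
`1`. By uniqueness, the geodesic chosen in `expMap` has the same endpoint, so the choice is
irrelevant. -/
theorem mem_geodesicDomain_of_isGeodesicOn [T2Space P] {x : P} {v : E} {γ : ℝ → P} {J : Set ℝ}
    (hJ : J.OrdConnected) (h0 : (0 : ℝ) ∈ J) (h : IsGeodesicOn g γ J) (hx : γ 0 = x)
    (hv : (velocityE γ 0 : E) = v) {s : ℝ} (hs : s ∈ J) :
    s ∈ geodesicDomain g x v ∧ geodesicCurve g x v s = γ s := by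
  have hord : ((fun r => s * r) ⁻¹' J).OrdConnected := by
    rw [← isPreconnected_iff_ordConnected]
    have : Convex ℝ ((fun r => s * r) ⁻¹' J) :=
      (hJ.convex (𝕜 := ℝ)).is_linear_preimage (f := fun r : ℝ => s * r)
        ⟨fun a b => mul_add s a b, fun a b => by simp; ring⟩
    exact this.isPreconnected
  have hg := h.comp_mul s
  have hexp : IsExpGeodesic g x (s • v : E) (fun r => γ (s * r)) := by
    refine ⟨_, hord, by simpa using h0, by simpa using hs, hg,
      (isExpGeodesic_initial (γ := fun r => γ (s * r)) (v := s • v)).2 ⟨by simpa using hx, ?_⟩⟩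
    rw [h.velocityE_comp_mul (by simpa using h0), mul_zero, hv]
  have hdef : ExpDefined g x (s • v : E) := ⟨_, hexp⟩
  refine ⟨hdef, ?_⟩
  have hch := hdef.choose_spec
  obtain ⟨J', hJ', h0', h1', hg', hi'⟩ := hch
  have hi := (isExpGeodesic_initial (γ := fun r => γ (s * r)) (v := s • v)).1 hexp.choose_spec.2.2.2.2
  replace hi' := (isExpGeodesic_initial (v := s • v)).1 hi'
  have he := hg'.eqOn hg (hJ'.inter hord) inter_subset_left inter_subset_right
    (t := 0) ⟨h0', by simpa using h0⟩ (hi'.1.trans hi.1.symm) (hi'.2.trans hi.2.symm)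
  have h3 := he ⟨h1', by simpa using hs⟩
  have h4 : geodesicCurve g x v s = hdef.choose 1 := dif_pos hdef
  rw [h4]
  simpa using h3

theorem exists_isGeodesicOn (g : SmoothMetric E P) (x : P) (v : E) :
    ∃ h > (0 : ℝ), ∃ γ : ℝ → P, IsGeodesicOn g γ (Ioo (-h) h) ∧ γ 0 = x ∧
      (velocityE γ 0 : E) = v := by
  have hz : ((extChartAt 𝓘(ℝ, E) x x, v) : E × E).1 ∈ (extChartAt 𝓘(ℝ, E) x).target :=
    (extChartAt 𝓘(ℝ, E) x).map_source (mem_extChartAt_source x)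
  have hΩ : {z : E × E | z.1 ∈ (extChartAt 𝓘(ℝ, E) x).target} ∈
      𝓝 ((extChartAt 𝓘(ℝ, E) x x, v) : E × E) :=
    continuousAt_fst.preimage_mem_nhds ((isOpen_extChartAt_target x).mem_nhds hz)
  obtain ⟨h, hh, U, hU, H⟩ := exists_localFlow_mem
    ((contDiffAt_spray g hz).of_le (m := 1) (by simp)) hΩ
  obtain ⟨α, hα0, hα⟩ := H _ (mem_of_mem_nhds hU)
  obtain ⟨hg, hst⟩ := isGeodesicOn_of_spray g isOpen_Ioo (fun t ht => (hα t ht).1)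
    (fun t ht => (hα t ht).2)
  have h0 : (0 : ℝ) ∈ Ioo (-h) h := ⟨by linarith, hh⟩
  refine ⟨h, hh, _, hg, ?_, ?_⟩
  · simp only [hα0]
    exact (extChartAt 𝓘(ℝ, E) x).left_inv (mem_extChartAt_source x)
  · have h1 := (hst 0 h0).2
    rw [hα0] at h1
    have h2 := congrArg Prod.snd h1
    have h3 : (extChartAt 𝓘(ℝ, E) x).symm (α 0).1 = x := by
      rw [hα0]
      exact (extChartAt 𝓘(ℝ, E) x).left_inv (mem_extChartAt_source x)
    simp only [chartState, h3, coordMap_self, ContinuousLinearMap.id_apply] at h2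
    exact h2

/-- Rescaling by `r⁻¹` undoes the normalization to time `1`. For `r = 0` the hypothesis only
concerns the zero vector, and local existence is used instead. -/
theorem exists_isGeodesicOn_of_mem [T2Space P] {x : P} {v : E} {r : ℝ}
    (hr : r ∈ geodesicDomain g x v) :
    ∃ J : Set ℝ, J.OrdConnected ∧ (0 : ℝ) ∈ J ∧ r ∈ J ∧ ∃ γ : ℝ → P, IsGeodesicOn g γ J ∧
      γ 0 = x ∧ (velocityE γ 0 : E) = v := by
  rcases eq_or_ne r 0 with rfl | hr0
  · obtain ⟨h, hh, γ, hγ⟩ := exists_isGeodesicOn g x v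
    exact ⟨_, ordConnected_Ioo, ⟨by linarith, hh⟩, ⟨by linarith, hh⟩, γ, hγ⟩
  · obtain ⟨γ, J, hJ, h0, h1, hg, hi⟩ := hr
    replace hi := isExpGeodesic_initial.1 hi
    have hord : ((fun s => r⁻¹ * s) ⁻¹' J).OrdConnected := by
      rw [← isPreconnected_iff_ordConnected]
      have : Convex ℝ ((fun s => r⁻¹ * s) ⁻¹' J) :=
        (hJ.convex (𝕜 := ℝ)).is_linear_preimage (f := fun s : ℝ => r⁻¹ * s)
          ⟨fun a b => mul_add _ a b, fun a b => by simp; ring⟩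
      exact this.isPreconnected
    refine ⟨_, hord, by simpa using h0, by simpa [inv_mul_cancel₀ hr0] using h1, _,
      hg.comp_mul r⁻¹, by simpa using hi.1, ?_⟩
    rw [hg.velocityE_comp_mul (by simpa using h0), mul_zero, hi.2, smul_smul, inv_mul_cancel₀ hr0,
      one_smul]

theorem zero_mem_geodesicDomain [T2Space P] (g : SmoothMetric E P) (x : P) (v : E) :
    (0 : ℝ) ∈ geodesicDomain g x v := by
  obtain ⟨h, hh, γ, hγ, h0, h1⟩ := exists_isGeodesicOn g x v
  have hm : (0 : ℝ) ∈ Ioo (-h) h := ⟨by linarith, hh⟩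
  exact (mem_geodesicDomain_of_isGeodesicOn ordConnected_Ioo hm hγ h0 h1 hm).1

theorem ordConnected_geodesicDomain [T2Space P] (g : SmoothMetric E P) (x : P) (v : E) :
    (geodesicDomain g x v).OrdConnected := by
  rw [← isPreconnected_iff_ordConnected]
  refine isPreconnected_of_forall 0 fun r hr => ?_
  obtain ⟨J, hJ, h0, hrJ, γ, hγ, hi⟩ := exists_isGeodesicOn_of_mem hr
  exact ⟨J, fun s hs => (mem_geodesicDomain_of_isGeodesicOn hJ h0 hγ hi.1 hi.2 hs).1, h0, hrJ,
    hJ.isPreconnected⟩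

/-- Around each point of its domain the curve coincides with an honest geodesic issuing from `x`.
This gives the openness of the domain as well as the geodesic equation. -/
theorem isGeodesicOn_geodesicCurve [T2Space P] (g : SmoothMetric E P) (x : P) (v : E) :
    IsGeodesicOn g (geodesicCurve g x v) (geodesicDomain g x v) := by
  have key : ∀ r ∈ geodesicDomain g x v, ∃ J ⊆ geodesicDomain g x v, r ∈ J ∧
      IsGeodesicOn g (geodesicCurve g x v) J := fun r hr => by
    obtain ⟨J, hJ, h0, hrJ, γ, hγ, hi⟩ := exists_isGeodesicOn_of_mem hr
    exact ⟨J, fun s hs => (mem_geodesicDomain_of_isGeodesicOn hJ h0 hγ hi.1 hi.2 hs).1, hrJ,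
      hγ.congr fun s hs => (mem_geodesicDomain_of_isGeodesicOn hJ h0 hγ hi.1 hi.2 hs).2⟩
  refine ⟨?_, fun r hr => ?_, fun r hr => ?_⟩
  · rw [isOpen_iff_mem_nhds]
    intro r hr
    obtain ⟨J, hJ, hrJ, h⟩ := key r hr
    exact Filter.mem_of_superset (h.1.mem_nhds hrJ) hJ
  · obtain ⟨J, hJ, hrJ, h⟩ := key r hr
    exact (h.2.1.contMDiffAt (h.1.mem_nhds hrJ)).contMDiffWithinAt
  · obtain ⟨J, hJ, hrJ, h⟩ := key r hr
    exact h.2.2 r hrJ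

theorem geodesicCurve_zero [T2Space P] (g : SmoothMetric E P) (x : P) (v : E) :
    geodesicCurve g x v 0 = x ∧ (velocityE (geodesicCurve g x v) 0 : E) = v := by
  obtain ⟨h, hh, γ, hγ, h0, h1⟩ := exists_isGeodesicOn g x v
  have hm : (0 : ℝ) ∈ Ioo (-h) h := ⟨by linarith, hh⟩
  have he : EqOn (geodesicCurve g x v) γ (Ioo (-h) h) := fun s hs =>
    (mem_geodesicDomain_of_isGeodesicOn ordConnected_Ioo hm hγ h0 h1 hs).2
  exact ⟨(he hm).trans h0, (velocityE_congr (he.eventuallyEq_of_mem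
    (isOpen_Ioo.mem_nhds hm))).trans h1⟩

/-- Compatibility of the connection with the metric, along an arbitrary differentiable coordinate
curve `u`. Conservation of speed and the product rules for parallel frames are instances. -/
theorem hasDerivAt_chartMetric (g : SmoothMetric E P) {q : P} {u V V₁ : ℝ → E} {u' V' V₁' : E}
    {r : ℝ} (hu : HasDerivAt u u' r) (hV : HasDerivAt V V' r) (hV₁ : HasDerivAt V₁ V₁' r)
    (ht : u r ∈ (extChartAt 𝓘(ℝ, E) q).target) :
    HasDerivAt (fun s => chartMetric g q (u s) (V s) (V₁ s))
      (chartMetric g q (u r) (V' + christoffel g q (u r) u' (V r)) (V₁ r)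
        + chartMetric g q (u r) (V r) (V₁' + christoffel g q (u r) u' (V₁ r))) r := by
  have hG := ((contDiffAt_chartMetric g ht).differentiableAt (by simp)).hasFDerivAt
  have h1 := ((hG.comp_hasDerivAt r hu).clm_apply hV).clm_apply hV₁
  refine h1.congr_deriv ?_
  simp only [add_apply, fderiv_chartMetric g ht, map_add, Function.comp]
  ring

/-- A geodesic keeps its speed. -/
theorem IsGeodesicOn.innerE_velocityE {γ : ℝ → P} {J : Set ℝ} (h : IsGeodesicOn g γ J)
    (hJ : J.OrdConnected) {s t : ℝ} (hs : s ∈ J) (ht : t ∈ J) :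
    innerE g (γ s) (velocityE γ s) (velocityE γ s) =
      innerE g (γ t) (velocityE γ t) (velocityE γ t) := by
  set φ : ℝ → ℝ := fun s => innerE g (γ s) (velocityE γ s) (velocityE γ s) with hφ
  have hd : ∀ r ∈ J, HasDerivAt φ 0 r := by
    intro r hr
    have hq : γ r ∈ (extChartAt 𝓘(ℝ, E) (γ r)).source := mem_extChartAt_source _
    have hc := h.hasDerivAt_chartState hr hq
    have h1 := hasDerivAt_chartMetric g (hasDerivAt_prod_fst hc) (hasDerivAt_prod_snd hc)
      (hasDerivAt_prod_snd hc) ((extChartAt 𝓘(ℝ, E) (γ r)).map_source hq)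
    simp only [spray, neg_add_cancel, map_zero, zero_apply, add_zero] at h1
    refine h1.congr_of_eventuallyEq ?_
    filter_upwards [eventually_mem_source (h.continuousAt hr) hq] with s hs
    exact (chartMetric_coordMap g hs _ _).symm
  have hpre : IsPreconnected J := hJ.isPreconnected
  exact h.1.is_const_of_deriv_eq_zero hpre
    (fun r hr => (hd r hr).differentiableAt.differentiableWithinAt)
    (fun r hr => (hd r hr).deriv) hs ht

end ExponentialMap

/-! ### Calculus of endomorphism fields along a geodesic; the Jacobi operator -/

noncomputable section CovariantEndomorphisms

variable {E : Type*} [NormedAddCommGroup E] [NormedSpace ℝ E]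
  {P : Type*} [TopologicalSpace P] [ChartedSpace E P] [IsManifold 𝓘(ℝ, E) ∞ P]

/-- The connection form of the curve `γ` in the chart at `q`. -/
def connForm (g : SmoothMetric E P) (q : P) (γ : ℝ → P) (s : ℝ) : E →L[ℝ] E :=
  christoffel g q (chartState q γ s).1 (chartState q γ s).2

/-- `A'` is the covariant derivative at `t` of the field `A` of endomorphisms along `γ`. -/
def HasCovEnd (g : SmoothMetric E P) (γ : ℝ → P) (A : ℝ → E →L[ℝ] E) (A' : E →L[ℝ] E)
    (t : ℝ) : Prop :=
  HasDerivAt (fun s => endE (γ t) (γ s) (A s))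
    (A' - (connForm g (γ t) γ t).comp (A t) + (A t).comp (connForm g (γ t) γ t)) t

theorem endE_injective {q x : P} (hq : x ∈ (extChartAt 𝓘(ℝ, E) q).source) {L L' : E →L[ℝ] E}
    (h : endE q x L = endE q x L') : L = L' := by
  ext v
  have := DFunLike.congr_fun h (coordMap q x v)
  rw [endE_coordMap hq, endE_coordMap hq] at this
  rw [← coordInv_coordMap hq (L v), this, coordInv_coordMap hq]

theorem endE_comp {q x : P} (hq : x ∈ (extChartAt 𝓘(ℝ, E) q).source) (L L' : E →L[ℝ] E) :
    endE q x (L.comp L') = (endE q x L).comp (endE q x L') := by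
  ext v
  simp only [ContinuousLinearMap.comp_apply, endE_apply, coordInv_coordMap hq]

theorem endE_neg (q x : P) (L : E →L[ℝ] E) : endE q x (-L) = -endE q x L := by
  ext v; simp [endE_apply]

theorem connForm_self {g : SmoothMetric E P} {γ : ℝ → P} (t : ℝ) :
    connForm g (γ t) γ t = christoffelAt g (γ t) (velocityE γ t) := by
  rw [connForm, chartState, coordMap_self]
  rfl

/-- A linear equation has solutions as smooth as its coefficients. -/
theorem contDiffOn_of_linearODE {W : Type*} [NormedAddCommGroup W] [NormedSpace ℝ W]
    {B : ℝ → W →L[ℝ] W} {y : ℝ → W} {O : Set ℝ} (hO : IsOpen O) (k : ℕ) (hB : ContDiffOn ℝ k B O)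
    (hy : ∀ s ∈ O, HasDerivAt y (B s (y s)) s) : ContDiffOn ℝ k y O := by
  induction k with
  | zero =>
    simp only [Nat.cast_zero, contDiffOn_zero]
    exact fun t ht => (hy t ht).continuousAt.continuousWithinAt
  | succ k ih =>
    push_cast at hB ⊢
    have hB' := hB.of_le (m := k) (by exact_mod_cast Nat.le_succ k)
    rw [contDiffOn_succ_iff_deriv_of_isOpen hO]
    refine ⟨fun t ht => (hy t ht).differentiableAt.differentiableWithinAt, by simp, ?_⟩
    exact (hB'.clm_apply (ih hB')).congr fun t ht => (hy t ht).deriv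

variable {g : SmoothMetric E P}

section General

variable {γ : ℝ → P} {J : Set ℝ} {t : ℝ} {A A' : ℝ → E →L[ℝ] E} {q : P}

theorem HasCovEnd.covEnd (hγ : IsGeodesicOn g γ J) (ht : t ∈ J) {A' : E →L[ℝ] E}
    (h : HasCovEnd g γ A A' t) : covEnd g γ A t = A' := by
  rw [covEnd_eq g (hγ.continuousAt ht) h, connForm_self]
  abel

/-- `covEnd` is defined with `deriv`, which has a default value. Differentiability in one chart is
enough to make it the true covariant derivative. -/
theorem hasCovEnd_covEnd (hγ : IsGeodesicOn g γ J) (ht : t ∈ J)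
    (hq : γ t ∈ (extChartAt 𝓘(ℝ, E) q).source)
    (hd : DifferentiableAt ℝ (fun s => endE q (γ s) (A s)) t) :
    HasCovEnd g γ A (_root_.covEnd g γ A t) t := by
  have hc := hγ.continuousAt ht
  have hu := (eventually_chartState hγ.1 hγ.2.1 ht hq).self_of_nhds
  obtain ⟨D'', hD'', -⟩ := hasDerivAt_endE hc hq (mem_extChartAt_source (γ t)) hu hd.hasDerivAt
  unfold HasCovEnd
  rw [covEnd_eq g hc hD'', connForm_self]
  convert hD'' using 1
  abel

theorem HasCovEnd.hasDerivAt [FiniteDimensional ℝ E] (hγ : IsGeodesicOn g γ J) (ht : t ∈ J) {A' : E →L[ℝ] E}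
    (h : HasCovEnd g γ A A' t) (hq : γ t ∈ (extChartAt 𝓘(ℝ, E) q).source) :
    HasDerivAt (fun s => endE q (γ s) (A s)) (endE q (γ t) A'
      - (connForm g q γ t).comp (endE q (γ t) (A t))
      + (endE q (γ t) (A t)).comp (connForm g q γ t)) t := by
  have hc := hγ.continuousAt ht
  have hp := mem_extChartAt_source (I := 𝓘(ℝ, E)) (γ t)
  have hu := (eventually_chartState hγ.1 hγ.2.1 ht hp).self_of_nhds
  have hu' := (eventually_chartState hγ.1 hγ.2.1 ht hq).self_of_nhds
  obtain ⟨D'', hD'', -⟩ := hasDerivAt_endE hc hp hq hu h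
  have h1 := endE_covEnd g hc hq hu' hD''
  rw [h.covEnd hγ ht] at h1
  refine hD''.congr_deriv ?_
  rw [h1, connForm, chartState]
  abel

theorem hasCovEnd_of_hasDerivAt [FiniteDimensional ℝ E] (hγ : IsGeodesicOn g γ J) (ht : t ∈ J) {A' : E →L[ℝ] E}
    (hq : γ t ∈ (extChartAt 𝓘(ℝ, E) q).source)
    (h : HasDerivAt (fun s => endE q (γ s) (A s)) (endE q (γ t) A'
      - (connForm g q γ t).comp (endE q (γ t) (A t))
      + (endE q (γ t) (A t)).comp (connForm g q γ t)) t) : HasCovEnd g γ A A' t := by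
  have h1 := hasCovEnd_covEnd hγ ht hq h.differentiableAt
  have h2 := h.unique (h1.hasDerivAt hγ ht hq)
  have h3 : endE q (γ t) A' = endE q (γ t) (_root_.covEnd g γ A t) := by
    simpa using h2
  rwa [← endE_injective hq h3] at h1

/-- Leibniz rule: the two terms with the connection form between `A` and `B` cancel. -/
theorem HasCovEnd.comp (hγ : IsGeodesicOn g γ J) (ht : t ∈ J) {B : ℝ → E →L[ℝ] E}
    {A' B' : E →L[ℝ] E} (hA : HasCovEnd g γ A A' t) (hB : HasCovEnd g γ B B' t) :
    HasCovEnd g γ (fun s => (A s).comp (B s)) (A'.comp (B t) + (A t).comp B') t := by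
  unfold HasCovEnd at *
  have h := hA.clm_comp hB
  simp only [endE_self] at h
  refine (h.congr_of_eventuallyEq ?_).congr_deriv ?_
  · filter_upwards [eventually_mem_source (hγ.continuousAt ht)
      (mem_extChartAt_source (I := 𝓘(ℝ, E)) (γ t))] with s hs
    exact endE_comp hs _ _
  · ext v
    simp only [add_apply, sub_apply, ContinuousLinearMap.comp_apply, map_add, map_sub]
    abel

end General

section Curvature

theorem contDiffAt_of_clm_apply [FiniteDimensional ℝ E] {A : ℝ → E →L[ℝ] E} {s : ℝ}
    (h : ∀ w, ContDiffAt ℝ ∞ (fun r => A r w) s) : ContDiffAt ℝ ∞ A s := by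
  let b := Module.finBasis ℝ E
  have hA : A = fun r => ∑ i, ContinuousLinearMap.smulRightL ℝ E E
      (LinearMap.toContinuousLinearMap (b.coord i)) (A r (b i)) := by
    funext r
    ext w
    conv_lhs => rw [← b.sum_repr w, map_sum]
    rw [sum_apply]
    exact Finset.sum_congr rfl fun i _ => map_smul _ _ _
  rw [hA]
  exact ContDiffAt.sum fun i _ => (ContinuousLinearMap.contDiff _).contDiffAt.comp s (h (b i))

/-- The Jacobi operator `X ↦ R(X, v) v` in coordinates. -/
def chartJacobiOp (g : SmoothMetric E P) (q : P) (u v : E) : E →L[ℝ] E :=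
  ((fderiv ℝ (christoffel g q) u).flip v).flip v - (fderiv ℝ (christoffel g q) u v).flip v
    + (christoffel g q u).flip (christoffel g q u v v)
    - (christoffel g q u v).comp ((christoffel g q u).flip v)

theorem chartJacobiOp_apply (q : P) (u v X : E) :
    chartJacobiOp g q u v X = chartCurvature g q u X v v := rfl

/-- The Jacobi operator `X ↦ R(X, v) v` of `v` at `x`. -/
def jacobiOp (g : SmoothMetric E P) (x : P) (v : E) : E →L[ℝ] E :=
  chartJacobiOp g x (extChartAt 𝓘(ℝ, E) x x) v

theorem endE_jacobiOp [FiniteDimensional ℝ E] {q x : P} (hq : x ∈ (extChartAt 𝓘(ℝ, E) q).source) (v : E) :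
    endE q x (jacobiOp g x v) = chartJacobiOp g q (extChartAt 𝓘(ℝ, E) q x) (coordMap q x v) := by
  have hp := mem_extChartAt_source (I := 𝓘(ℝ, E)) x
  ext w
  rw [← coordMap_coordInv hq w, endE_coordMap hq, jacobiOp, chartJacobiOp_apply,
    chartJacobiOp_apply]
  have := chartCurvature_transition g (mem_transitionDomain hp hq) (coordInv q x w) v v
  have hA : ∀ z, fderiv ℝ (transition E x q) (extChartAt 𝓘(ℝ, E) x x) z = coordMap q x z := by
    intro z
    have := fderiv_transition_coordMap hp hq z
    rwa [coordMap_self] at this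
  simp only [hA, transition_extChartAt hp] at this
  exact this

theorem contDiffAt_chartJacobiOp [FiniteDimensional ℝ E] {q : P} {u v : ℝ → E} {s : ℝ} (hu : ContDiffAt ℝ ∞ u s)
    (hv : ContDiffAt ℝ ∞ v s) (ht : u s ∈ (extChartAt 𝓘(ℝ, E) q).target) :
    ContDiffAt ℝ ∞ (fun s => chartJacobiOp g q (u s) (v s)) s := by
  have hΓ : ContDiffAt ℝ ∞ (fun s => christoffel g q (u s)) s :=
    (contDiffAt_christoffel g ht).comp s hu
  have hdΓ : ContDiffAt ℝ ∞ (fun s => fderiv ℝ (christoffel g q) (u s)) s :=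
    ((contDiffAt_christoffel g ht).fderiv_right (m := ∞) (by simp)).comp s hu
  rw [show (fun s => chartJacobiOp g q (u s) (v s)) = fun s =>
    chartJacobiOp g q (u s) (v s) from rfl]
  have key : ∀ w, ContDiffAt ℝ ∞ (fun s => chartJacobiOp g q (u s) (v s) w) s := fun w => by
    simp only [chartJacobiOp_apply, chartCurvature]
    have c : ContDiffAt ℝ ∞ (fun _ : ℝ => w) s := contDiffAt_const
    exact (((((hdΓ.clm_apply c).clm_apply hv).clm_apply hv).sub
      (((hdΓ.clm_apply hv).clm_apply c).clm_apply hv)).add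
      ((hΓ.clm_apply c).clm_apply ((hΓ.clm_apply hv).clm_apply hv))).sub
      ((hΓ.clm_apply hv).clm_apply ((hΓ.clm_apply c).clm_apply hv))
  exact contDiffAt_of_clm_apply key

/-- The orthogonal projection along the unit vector `v`. -/
def normalProj (g : SmoothMetric E P) (x : P) (v : E) : E →L[ℝ] E :=
  ContinuousLinearMap.id ℝ E - (innerE g x v).smulRight v

theorem normalProj_apply (x : P) (v w : E) : normalProj g x v w = w - innerE g x v w • v := rfl

theorem normalProj_self {x : P} {v : E} (hv : innerE g x v v = 1) : normalProj g x v v = 0 := by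
  rw [normalProj_apply, hv, one_smul, sub_self]

theorem normalProj_of_innerE_eq_zero {x : P} {v w : E} (hw : innerE g x v w = 0) :
    normalProj g x v w = w := by
  rw [normalProj_apply, hw, zero_smul, sub_zero]

theorem innerE_normalProj {x : P} {v : E} (hv : innerE g x v v = 1) (w : E) :
    innerE g x v (normalProj g x v w) = 0 := by
  rw [normalProj_apply, map_sub, map_smul, hv, smul_eq_mul, mul_one, sub_self]

theorem innerE_jacobiOp [FiniteDimensional ℝ E] (x : P) (v w : E) : innerE g x v (jacobiOp g x v w) = 0 := by
  have hp := mem_extChartAt_source (I := 𝓘(ℝ, E)) x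
  have := chartMetric_chartCurvature_self g ((extChartAt 𝓘(ℝ, E) x).map_source hp) w v v
  have h2 := chartMetric_coordMap g hp (chartCurvature g x (extChartAt 𝓘(ℝ, E) x x) w v v) v
  rw [coordMap_self] at h2
  simp only [ContinuousLinearMap.id_apply] at h2
  rw [innerE_symm, jacobiOp, chartJacobiOp_apply, ← h2, this]

theorem jacobiOp_self (x : P) (v : E) : jacobiOp g x v v = 0 := by
  rw [jacobiOp, chartJacobiOp_apply, chartCurvature]
  abel

/-- With `normalProj_jacobiOp`, the Jacobi operator absorbs the projection on either side. Hence
projecting a solution of the Jacobi equation on both sides gives a solution again. -/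
theorem jacobiOp_normalProj (x : P) (v w : E) :
    jacobiOp g x v (normalProj g x v w) = jacobiOp g x v w := by
  rw [normalProj_apply, map_sub, map_smul, jacobiOp_self, smul_zero, sub_zero]

theorem normalProj_jacobiOp [FiniteDimensional ℝ E] (x : P) (v w : E) :
    normalProj g x v (jacobiOp g x v w) = jacobiOp g x v w :=
  normalProj_of_innerE_eq_zero (innerE_jacobiOp x v w)

theorem endE_normalProj {q x : P} (hq : x ∈ (extChartAt 𝓘(ℝ, E) q).source) (v : E) :
    endE q x (normalProj g x v) = ContinuousLinearMap.id ℝ E -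
      (ContinuousLinearMap.smulRightL ℝ E E
        (chartMetric g q (extChartAt 𝓘(ℝ, E) q x) (coordMap q x v))) (coordMap q x v) := by
  ext w
  rw [← coordMap_coordInv hq w, endE_coordMap hq, normalProj_apply, map_sub, map_smul,
    ← chartMetric_coordMap g hq]
  rfl

theorem contDiffAt_endE_normalProj [FiniteDimensional ℝ E] {γ : ℝ → P} {J : Set ℝ} (hγ : IsGeodesicOn g γ J) {t : ℝ}
    (ht : t ∈ J) {q : P} (hq : γ t ∈ (extChartAt 𝓘(ℝ, E) q).source) :
    ContDiffAt ℝ ∞ (fun s => endE q (γ s) (normalProj g (γ s) (velocityE γ s))) t := by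
  have hst := contDiffAt_chartState hγ.1 hγ.2.1 ht hq
  have hG : ContDiffAt ℝ ∞ (chartMetric g q ∘ fun s => (chartState q γ s : E × E).1) t :=
    ContDiffAt.comp t (contDiffAt_chartMetric g ((extChartAt 𝓘(ℝ, E) q).map_source hq)) hst.fst
  have hf : ContDiffAt ℝ ∞ (fun s => ContinuousLinearMap.smulRightL ℝ E E
      (chartMetric g q (chartState q γ s).1 (chartState q γ s).2)) t :=
    (ContinuousLinearMap.smulRightL ℝ E E).contDiff.contDiffAt.comp t (hG.clm_apply hst.snd)
  have h1 : ContDiffAt ℝ ∞ (fun s => ContinuousLinearMap.id ℝ E -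
      ContinuousLinearMap.smulRightL ℝ E E (chartMetric g q (chartState q γ s).1
        (chartState q γ s).2) (chartState q γ s).2) t :=
    contDiffAt_const.sub (hf.clm_apply hst.snd)
  refine h1.congr_of_eventuallyEq ?_
  filter_upwards [eventually_mem_source (hγ.continuousAt ht) hq] with s hs
  exact endE_normalProj hs _

/-- The orthogonal projection along the velocity of a geodesic is parallel. -/
theorem hasCovEnd_normalProj [FiniteDimensional ℝ E] {γ : ℝ → P} {J : Set ℝ} (hγ : IsGeodesicOn g γ J) {t : ℝ}
    (ht : t ∈ J) : HasCovEnd g γ (fun s => normalProj g (γ s) (velocityE γ s)) 0 t := by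
  obtain ⟨q, hq⟩ : ∃ q, γ t ∈ (extChartAt 𝓘(ℝ, E) q).source := ⟨_, mem_extChartAt_source (γ t)⟩
  have hd := (contDiffAt_endE_normalProj hγ ht hq).differentiableAt (by simp)
  refine hasCovEnd_of_hasDerivAt hγ ht hq ?_
  refine hd.hasDerivAt.congr_deriv ?_
  ext w
  have h1 : HasDerivAt (fun s => endE q (γ s) (normalProj g (γ s) (velocityE γ s)) w)
      (deriv (fun s => endE q (γ s) (normalProj g (γ s) (velocityE γ s))) t w) t := by
    simpa using hd.hasDerivAt.clm_apply (hasDerivAt_const t w)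
  have hst := hγ.hasDerivAt_chartState ht hq
  -- The projection is `w - g(γ', w) γ'` and the covariant derivative of `γ'` is zero, so only
  -- Christoffel terms acting on `w` and on `γ'` survive; these are exactly the connection terms of
  -- a parallel field.
  have h2 := hasDerivAt_chartMetric g (hasDerivAt_prod_fst hst) (hasDerivAt_prod_snd hst)
    (hasDerivAt_const t w) ((extChartAt 𝓘(ℝ, E) q).map_source hq)
  have h3 := (hasDerivAt_const t w).sub (h2.smul (hasDerivAt_prod_snd hst))
  have h4 : (fun s => endE q (γ s) (normalProj g (γ s) (velocityE γ s)) w) =ᶠ[𝓝 t] fun s =>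
      w - chartMetric g q (chartState q γ s).1 (chartState q γ s).2 w • (chartState q γ s).2 := by
    filter_upwards [eventually_mem_source (hγ.continuousAt ht) hq] with s hs
    rw [endE_normalProj hs]
    simp [chartState]
  rw [h1.unique (h3.congr_of_eventuallyEq h4), endE_normalProj hq]
  simp only [spray, connForm, add_apply, sub_apply, ContinuousLinearMap.comp_apply, chartState]
  have hs : ∀ (l : E →L[ℝ] ℝ) (v w : E),
      ContinuousLinearMap.smulRightL ℝ E E l v w = l w • v := fun _ _ _ => rfl
  have h0 : endE q (γ t) (0 : E →L[ℝ] E) w = 0 := by rw [endE_apply]; simp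
  rw [h0]
  simp only [hs, map_sub, map_smul, sub_apply, ContinuousLinearMap.id_apply, smul_neg,
    neg_add_cancel, map_zero, zero_apply, zero_add]
  abel

end Curvature

end CovariantEndomorphisms

/-! ### Jacobi tensors: existence along the whole geodesic, and restriction to the normal space -/

noncomputable section JacobiTensors

variable {E : Type*} [NormedAddCommGroup E] [NormedSpace ℝ E]
  {P : Type*} [TopologicalSpace P] [ChartedSpace E P] [IsManifold 𝓘(ℝ, E) ∞ P]
  {g : SmoothMetric E P} {γ : ℝ → P} {J : Set ℝ} {t : ℝ} {A B : ℝ → E →L[ℝ] E} {q : P}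

theorem HasCovEnd.congr_of_eventuallyEq {A' : E →L[ℝ] E} (h : HasCovEnd g γ A A' t)
    (hAB : B =ᶠ[𝓝 t] A) : HasCovEnd g γ B A' t := by
  unfold HasCovEnd at *
  rw [hAB.eq_of_nhds]
  refine h.congr_of_eventuallyEq ?_
  filter_upwards [hAB] with s hs
  rw [hs]

theorem isOpen_inter_preimage_source (hγ : IsGeodesicOn g γ J) (q : P) :
    IsOpen (J ∩ γ ⁻¹' (extChartAt 𝓘(ℝ, E) q).source) :=
  (continuousOn_of_forall_continuousAt fun _ ht => hγ.continuousAt ht).isOpen_inter_preimage hγ.1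
    (isOpen_extChartAt_source q)

/-- The commutator with `ψ`. -/
def commOp (ψ : E →L[ℝ] E) : (E →L[ℝ] E) →L[ℝ] E →L[ℝ] E :=
  (ContinuousLinearMap.compL ℝ E E E).flip ψ - ContinuousLinearMap.compL ℝ E E E ψ

/-- The coefficients, in the chart at `q`, of the first-order Jacobi system. -/
def jacobiSystem (g : SmoothMetric E P) (q : P) (γ : ℝ → P) (s : ℝ) :
    (E →L[ℝ] E) × (E →L[ℝ] E) →L[ℝ] (E →L[ℝ] E) × (E →L[ℝ] E) :=
  (ContinuousLinearMap.inl ℝ _ _).comp (ContinuousLinearMap.snd ℝ _ _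
      + (commOp (connForm g q γ s)).comp (ContinuousLinearMap.fst ℝ _ _))
    + (ContinuousLinearMap.inr ℝ _ _).comp ((commOp (connForm g q γ s)).comp
        (ContinuousLinearMap.snd ℝ _ _)
      - (ContinuousLinearMap.compL ℝ E E E (chartJacobiOp g q (chartState q γ s).1
          (chartState q γ s).2)).comp (ContinuousLinearMap.fst ℝ _ _))

theorem jacobiSystem_apply (q : P) (γ : ℝ → P) (s : ℝ) (y : (E →L[ℝ] E) × (E →L[ℝ] E)) :
    jacobiSystem g q γ s y = (y.2 - (connForm g q γ s).comp y.1 + y.1.comp (connForm g q γ s),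
      -(chartJacobiOp g q (chartState q γ s).1 (chartState q γ s).2).comp y.1
        - (connForm g q γ s).comp y.2 + y.2.comp (connForm g q γ s)) := by
  have h : jacobiSystem g q γ s y = (y.2 + (y.1.comp (connForm g q γ s)
      - (connForm g q γ s).comp y.1) + 0, 0 + (y.2.comp (connForm g q γ s)
      - (connForm g q γ s).comp y.2 - (chartJacobiOp g q (chartState q γ s).1
        (chartState q γ s).2).comp y.1)) := rfl
  rw [h]
  ext <;> simp <;> abel

/-- The field of endomorphisms in the model space. -/
def NormalEndField.toE (D : NormalEndField g γ) (s : ℝ) : E →L[ℝ] E := D.toFun s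

variable [FiniteDimensional ℝ E]

theorem contDiffAt_connForm (hγ : IsGeodesicOn g γ J) (ht : t ∈ J)
    (hq : γ t ∈ (extChartAt 𝓘(ℝ, E) q).source) : ContDiffAt ℝ ∞ (connForm g q γ) t := by
  have hst := contDiffAt_chartState hγ.1 hγ.2.1 ht hq
  have hG : ContDiffAt ℝ ∞ (christoffel g q ∘ fun s => (chartState q γ s : E × E).1) t :=
    ContDiffAt.comp t (contDiffAt_christoffel g ((extChartAt 𝓘(ℝ, E) q).map_source hq)) hst.fst
  exact hG.clm_apply hst.snd

theorem contDiffAt_jacobiSystem (hγ : IsGeodesicOn g γ J) (ht : t ∈ J)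
    (hq : γ t ∈ (extChartAt 𝓘(ℝ, E) q).source) : ContDiffAt ℝ ∞ (jacobiSystem g q γ) t := by
  have hω := contDiffAt_connForm hγ ht hq
  have hst := contDiffAt_chartState hγ.1 hγ.2.1 ht hq
  have hR := contDiffAt_chartJacobiOp (g := g) hst.fst hst.snd
    ((extChartAt 𝓘(ℝ, E) q).map_source hq)
  have hc : ContDiffAt ℝ ∞ (fun s => commOp (connForm g q γ s)) t :=
    ((ContinuousLinearMap.contDiff _).contDiffAt.comp t hω).sub
      ((ContinuousLinearMap.contDiff _).contDiffAt.comp t hω)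
  have hR' : ContDiffAt ℝ ∞ (fun s => ContinuousLinearMap.compL ℝ E E E
      (chartJacobiOp g q (chartState q γ s).1 (chartState q γ s).2)) t :=
    (ContinuousLinearMap.contDiff _).contDiffAt.comp t hR
  exact (contDiffAt_const.clm_comp (contDiffAt_const.add (hc.clm_comp contDiffAt_const))).add
    (contDiffAt_const.clm_comp ((hc.clm_comp contDiffAt_const).sub
      (hR'.clm_comp contDiffAt_const)))

/-- The right-hand side mentions no chart. Therefore the first-order systems in different charts are
compatible, which is the gluing hypothesis of `exists_global_linearODE`. -/
theorem hasCovEnd_jacobi_iff (hγ : IsGeodesicOn g γ J) (ht : t ∈ J)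
    (hq : γ t ∈ (extChartAt 𝓘(ℝ, E) q).source) :
    HasDerivAt (fun s => (endE q (γ s) (A s), endE q (γ s) (B s)))
      (jacobiSystem g q γ t (endE q (γ t) (A t), endE q (γ t) (B t))) t ↔
    HasCovEnd g γ A (B t) t ∧
      HasCovEnd g γ B (-(jacobiOp g (γ t) (velocityE γ t)).comp (A t)) t := by
  have hR : endE q (γ t) (-(jacobiOp g (γ t) (velocityE γ t)).comp (A t)) =
      -(chartJacobiOp g q (chartState q γ t).1 (chartState q γ t).2).comp
        (endE q (γ t) (A t)) := by
    rw [endE_neg, endE_comp hq, endE_jacobiOp hq]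
    rfl
  rw [jacobiSystem_apply]
  constructor
  · intro h
    refine ⟨hasCovEnd_of_hasDerivAt hγ ht hq (hasDerivAt_prod_fst h),
      hasCovEnd_of_hasDerivAt hγ ht hq ?_⟩
    rw [hR]
    exact hasDerivAt_prod_snd h
  · rintro ⟨h1, h2⟩
    have h2' := h2.hasDerivAt hγ ht hq
    rw [hR] at h2'
    exact (h1.hasDerivAt hγ ht hq).prodMk h2'

/-- Solutions of the Jacobi equation `A'' + R(A, γ') γ' = 0` exist along the whole geodesic. -/
theorem exists_jacobi (hγ : IsGeodesicOn g γ J) (hJ : J.OrdConnected) {s₀ : ℝ} (hs₀ : s₀ ∈ J)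
    (A₀ A₁ : E →L[ℝ] E) : ∃ A B : ℝ → E →L[ℝ] E, A s₀ = A₀ ∧ B s₀ = A₁ ∧
      ∀ s ∈ J, HasCovEnd g γ A (B s) s ∧
        HasCovEnd g γ B (-(jacobiOp g (γ s) (velocityE γ s)).comp (A s)) s := by
  let cj : P → ℝ → (E →L[ℝ] E) → E →L[ℝ] E := fun q s L =>
    (coordInv q (γ s)).comp (L.comp (coordMap q (γ s)))
  have hcj : ∀ q s, γ s ∈ (extChartAt 𝓘(ℝ, E) q).source → ∀ L,
      endE q (γ s) (cj q s L) = L := by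
    intro q s hq L
    ext v
    simp only [endE_apply, cj, ContinuousLinearMap.comp_apply, coordMap_coordInv hq]
  have hjc : ∀ q s, γ s ∈ (extChartAt 𝓘(ℝ, E) q).source → ∀ L,
      cj q s (endE q (γ s) L) = L := by
    intro q s hq L
    ext v
    simp only [endE_apply, cj, ContinuousLinearMap.comp_apply, coordInv_coordMap hq]
  obtain ⟨Y, hY0, hY⟩ := exists_global_linearODE J hγ.1 hJ
    (fun q => J ∩ γ ⁻¹' (extChartAt 𝓘(ℝ, E) q).source) (isOpen_inter_preimage_source hγ)
    (fun s hs => ⟨γ s, hs, mem_extChartAt_source _⟩)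
    (fun q s (y : (E →L[ℝ] E) × (E →L[ℝ] E)) => (endE q (γ s) y.1, endE q (γ s) y.2))
    (fun q s y => (cj q s y.1, cj q s y.2))
    (fun q s hs y => Prod.ext (hcj q s hs.2 _) (hcj q s hs.2 _))
    (fun q s hs y => Prod.ext (hjc q s hs.2 _) (hjc q s hs.2 _))
    (fun q => jacobiSystem g q γ)
    (fun q s hs => (contDiffAt_jacobiSystem hγ hs.1 hs.2.2).continuousAt.continuousWithinAt)
    (fun q p s hs hq hp Y h => by
      have := (hasCovEnd_jacobi_iff (A := fun s => (Y s).1) (B := fun s => (Y s).2)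
        hγ hs hq.2).1 h
      exact (hasCovEnd_jacobi_iff hγ hs hp.2).2 this) hs₀ (A₀, A₁)
  refine ⟨fun s => (Y s).1, fun s => (Y s).2, congrArg Prod.fst hY0, congrArg Prod.snd hY0, fun s hs => ?_⟩
  have hq := mem_extChartAt_source (I := 𝓘(ℝ, E)) (γ s)
  exact (hasCovEnd_jacobi_iff hγ hs hq).1 (hY s hs (γ s) ⟨hs, hq⟩)

theorem contDiffAt_jacobi (hγ : IsGeodesicOn g γ J) (hAB : ∀ s ∈ J, HasCovEnd g γ A (B s) s ∧
    HasCovEnd g γ B (-(jacobiOp g (γ s) (velocityE γ s)).comp (A s)) s) (k : ℕ) (ht : t ∈ J)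
    (hq : γ t ∈ (extChartAt 𝓘(ℝ, E) q).source) :
    ContDiffAt ℝ k (fun s => endE q (γ s) (A s)) t := by
  have hO := isOpen_inter_preimage_source hγ q
  have h : ContDiffOn ℝ k (fun s => (endE q (γ s) (A s), endE q (γ s) (B s)))
      (J ∩ γ ⁻¹' (extChartAt 𝓘(ℝ, E) q).source) :=
    contDiffOn_of_linearODE hO k (B := jacobiSystem g q γ)
      (fun s hs => ((contDiffAt_jacobiSystem hγ hs.1 hs.2).of_le
        (by exact_mod_cast le_top)).contDiffWithinAt)
      fun s hs => (hasCovEnd_jacobi_iff hγ hs.1 hs.2).2 (hAB s hs.1)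
  exact (h.contDiffAt (hO.mem_nhds ⟨ht, hq⟩)).fst

open Classical in
/-- The Jacobi tensor of `γ'^⊥` along a geodesic of unit speed, with initial data `id` and
`A₁`. -/
theorem exists_normalEndField (hγ : IsGeodesicOn g γ J) (hJ : J.OrdConnected) {s₀ : ℝ}
    (hs₀ : s₀ ∈ J) (hunit : ∀ s ∈ J, innerE g (γ s) (velocityE γ s) (velocityE γ s) = 1)
    (A₁ : E →L[ℝ] E) : ∃ D : NormalEndField g γ, ∃ D₀ D₁ : ℝ → E →L[ℝ] E,
      D.toE = D₀ ∧
      D₀ s₀ = normalProj g (γ s₀) (velocityE γ s₀) ∧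
      D₁ s₀ = (normalProj g (γ s₀) (velocityE γ s₀)).comp
        (A₁.comp (normalProj g (γ s₀) (velocityE γ s₀))) ∧
      (∀ s ∈ J, HasCovEnd g γ D₀ (D₁ s) s ∧
        HasCovEnd g γ D₁ (-(jacobiOp g (γ s) (velocityE γ s)).comp (D₀ s)) s) ∧
      ∀ r ∈ J, ContDiffAt ℝ 2 (fun s => endE (γ r) (γ s) (D₀ s)) r := by
  obtain ⟨A, B, hA0, hB0, hAB⟩ := exists_jacobi hγ hJ hs₀ (ContinuousLinearMap.id ℝ E) A₁
  let N : ℝ → E →L[ℝ] E := fun s => normalProj g (γ s) (velocityE γ s)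
  -- The projections are parallel and are absorbed by the Jacobi operator, so `N A N` still solves
  -- the equation, now with values in `γ'^⊥`. A `NormalEndField` must satisfy its conditions at
  -- every real parameter while unit speed is known only on `J`, hence the value `0` elsewhere.
  let D₀ : ℝ → E →L[ℝ] E := fun s => if s ∈ J then (N s).comp ((A s).comp (N s)) else 0
  let D₁ : ℝ → E →L[ℝ] E := fun s => (N s).comp ((B s).comp (N s))
  have hD₀ : ∀ s ∈ J, D₀ =ᶠ[𝓝 s] fun s => (N s).comp ((A s).comp (N s)) := by
    intro s hs
    filter_upwards [hγ.1.mem_nhds hs] with r hr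
    exact if_pos hr
  have hN : ∀ s ∈ J, HasCovEnd g γ N 0 s := fun s hs => hasCovEnd_normalProj hγ hs
  refine ⟨⟨fun s => D₀ s, fun s => ?_, fun s w hw => ?_⟩, D₀, D₁, rfl, ?_, ?_,
    fun s hs => ⟨?_, ?_⟩, fun r hr => ?_⟩
  · change D₀ s (velocityE γ s) = 0
    by_cases hs : s ∈ J
    · simp only [D₀, if_pos hs, N, ContinuousLinearMap.comp_apply]
      rw [normalProj_self (hunit s hs), map_zero, map_zero]
    · simp [D₀, if_neg hs]
  · change innerE g (γ s) (velocityE γ s) (D₀ s w) = 0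
    by_cases hs : s ∈ J
    · simp only [D₀, if_pos hs, N]
      exact innerE_normalProj (hunit s hs) _
    · simp only [D₀, if_neg hs]
      exact map_zero _
  · have h := innerE_normalProj (hunit s₀ hs₀)
    simp only [D₀, if_pos hs₀, N, hA0]
    ext w
    exact normalProj_of_innerE_eq_zero (h w)
  · simp only [D₁, hB0, N]
  · have := (hN s hs).comp hγ hs ((hAB s hs).1.comp hγ hs (hN s hs))
    refine HasCovEnd.congr_of_eventuallyEq ?_ (hD₀ s hs)
    simpa [D₁] using this
  · have := (hN s hs).comp hγ hs ((hAB s hs).2.comp hγ hs (hN s hs))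
    convert this using 1
    ext w
    simp only [D₀, if_pos hs, N, ContinuousLinearMap.comp_apply, add_apply, neg_apply, map_neg,
      zero_apply, zero_add, map_zero, add_zero, normalProj_jacobiOp, jacobiOp_normalProj]
  · have hq := mem_extChartAt_source (I := 𝓘(ℝ, E)) (γ r)
    have h1 : ContDiffAt ℝ 2 (fun s => endE (γ r) (γ s) (N s)) r :=
      (contDiffAt_endE_normalProj hγ hr hq).of_le (WithTop.coe_le_coe.2 le_top)
    have h2 : ContDiffAt ℝ 2 (fun s => endE (γ r) (γ s) (A s)) r :=
      contDiffAt_jacobi hγ hAB 2 hr hq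
    refine (h1.clm_comp (h2.clm_comp h1)).congr_of_eventuallyEq ?_
    filter_upwards [hD₀ r hr, eventually_mem_source (hγ.continuousAt hr) hq] with s hs hqs
    rw [hs, endE_comp hqs, endE_comp hqs]

/-- The covariant derivatives of a Jacobi tensor. -/
theorem NormalEndField.hasCovEnd (D : NormalEndField g γ) (hγ : IsGeodesicOn g γ J)
    (hunit : ∀ s ∈ J, innerE g (γ s) (velocityE γ s) (velocityE γ s) = 1)
    (hD : ∀ r ∈ J, ContDiffAt ℝ 2 (fun s => endInChart (γ r) (γ s) (D.toFun s)) r)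
    (hj : ∀ r ∈ J, ∀ v ∈ normalSpace g γ r, covDerivEnd g γ (covDerivEnd g γ D.toFun) r v
      + curvature g (γ r) (D.toFun r v) (velocity γ r) (velocity γ r) = 0) (ht : t ∈ J) :
    HasCovEnd g γ D.toE (covEnd g γ D.toE t) t ∧
      HasCovEnd g γ (covEnd g γ D.toE)
        (-(jacobiOp g (γ t) (velocityE γ t)).comp (D.toE t)) t := by
  have hC2 : ∀ r ∈ J, ContDiffAt ℝ 2 (fun s => endE (γ r) (γ s) (D.toE s)) r := by
    intro r hr
    refine (hD r hr).congr_of_eventuallyEq ?_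
    filter_upwards [eventually_mem_source (hγ.continuousAt hr)
      (mem_extChartAt_source (I := 𝓘(ℝ, E)) (γ r))] with s hs
    exact (endInChart_eq hs _).symm
  have h1 : ∀ r ∈ J, HasCovEnd g γ D.toE (covEnd g γ D.toE r) r := fun r hr =>
    hasCovEnd_covEnd hγ hr (mem_extChartAt_source (γ r))
      ((hC2 r hr).differentiableAt (by norm_num))
  -- The hypothesis gives the Jacobi equation on normal vectors only. Since `D = D N` and `N` is
  -- parallel, also `D' = D' N` and `D'' = D'' N`; together with the absorption of `N` in `D` this
  -- extends the equation to all vectors.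
  have hDN : ∀ r ∈ J, (D.toE r).comp (normalProj g (γ r) (velocityE γ r))
      = D.toE r := by
    intro r hr
    have hv : (D.toE r) (velocityE γ r) = 0 := D.map_velocity r
    ext w
    rw [ContinuousLinearMap.comp_apply, normalProj_apply, map_sub, map_smul, hv, smul_zero,
      sub_zero]
  have hD'N : ∀ r ∈ J, (covEnd g γ D.toE r).comp (normalProj g (γ r) (velocityE γ r))
      = covEnd g γ D.toE r := by
    intro r hr
    have h := (h1 r hr).comp hγ hr (hasCovEnd_normalProj hγ hr)
    have h' := h.congr_of_eventuallyEq (B := D.toE) (by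
      filter_upwards [hγ.1.mem_nhds hr] with s hs
      exact (hDN s hs).symm)
    have := h'.covEnd hγ hr
    rwa [ContinuousLinearMap.comp_zero, add_zero, eq_comm] at this
  refine ⟨h1 t ht, ?_⟩
  have hq := mem_extChartAt_source (I := 𝓘(ℝ, E)) (γ t)
  have hdiff : DifferentiableAt ℝ (fun s => endE (γ t) (γ s) (covEnd g γ D.toE s)) t := by
    have hω := (contDiffAt_connForm hγ ht hq).differentiableAt (by simp)
    have hd0 := (hC2 t ht).differentiableAt (by norm_num)
    have hd1 : DifferentiableAt ℝ (deriv fun s => endE (γ t) (γ s) (D.toE s)) t := by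
      have h : ContDiffAt ℝ 1 (fun r => fderiv ℝ (fun s => endE (γ t) (γ s) (D.toE s)) r (1 : ℝ))
          t := ((hC2 t ht).fderiv_right (m := 1) (by norm_num)).clm_apply contDiffAt_const
      simpa only [fderiv_apply_one_eq_deriv] using h.differentiableAt (by norm_num)
    refine ((hd1.add (hω.clm_comp hd0)).sub (hd0.clm_comp hω)).congr_of_eventuallyEq ?_
    filter_upwards [eventually_mem_source (hγ.continuousAt ht) hq, hγ.1.mem_nhds ht] with s hs hsJ
    have := ((h1 s hsJ).hasDerivAt hγ hsJ hs).deriv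
    simp only [Pi.add_apply, Pi.sub_apply]
    rw [this]
    abel
  have h2 := hasCovEnd_covEnd hγ ht hq hdiff
  have hD''N : (covEnd g γ (covEnd g γ D.toE) t).comp (normalProj g (γ t) (velocityE γ t))
      = covEnd g γ (covEnd g γ D.toE) t := by
    have h := h2.comp hγ ht (hasCovEnd_normalProj hγ ht)
    have h' := h.congr_of_eventuallyEq (B := covEnd g γ D.toE) (by
      filter_upwards [hγ.1.mem_nhds ht] with s hs
      exact (hD'N s hs).symm)
    have := h'.covEnd hγ ht
    rwa [ContinuousLinearMap.comp_zero, add_zero, eq_comm] at this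
  suffices h : covEnd g γ (covEnd g γ D.toE) t = -(jacobiOp g (γ t) (velocityE γ t)).comp
      (D.toE t) by rwa [h] at h2
  rw [← hD''N]
  ext w
  have h3 := hj t ht (normalProj g (γ t) (velocityE γ t) w) (innerE_normalProj (hunit t ht) w)
  have h4 : covEnd g γ (covEnd g γ D.toE) t (normalProj g (γ t) (velocityE γ t) w)
    + jacobiOp g (γ t) (velocityE γ t) (D.toE t
      (normalProj g (γ t) (velocityE γ t) w)) = 0 := h3
  have h5 := DFunLike.congr_fun (hDN t ht) w
  rw [ContinuousLinearMap.comp_apply] at h5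
  rw [h5] at h4
  rw [ContinuousLinearMap.comp_apply, eq_neg_of_add_eq_zero_left h4]
  rfl

end JacobiTensors

/-! ### Parallel frames and the linearized geodesic flow -/

noncomputable section JacobiFields

variable {E₀ : Type*} [NormedAddCommGroup E₀] [NormedSpace ℝ E₀]
  {E : Type*} [NormedAddCommGroup E] [NormedSpace ℝ E]
  {P : Type*} [TopologicalSpace P] [ChartedSpace E P] [IsManifold 𝓘(ℝ, E) ∞ P]
  {g : SmoothMetric E P} {γ : ℝ → P} {J : Set ℝ} {t : ℝ} {q p : P}

/-- `L'` is the covariant derivative at `t` of the field `L` of linear maps from `E₀` to the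
tangent spaces along `γ`. -/
def HasCovHom (g : SmoothMetric E P) (γ : ℝ → P) (L : ℝ → E₀ →L[ℝ] E) (L' : E₀ →L[ℝ] E)
    (t : ℝ) : Prop :=
  ∀ q, γ t ∈ (extChartAt 𝓘(ℝ, E) q).source →
    HasDerivAt (fun s => (coordMap q (γ s)).comp (L s))
      ((coordMap q (γ t)).comp L' - (connForm g q γ t).comp ((coordMap q (γ t)).comp (L t))) t

variable [FiniteDimensional ℝ E] {L : ℝ → E₀ →L[ℝ] E} {L' : E₀ →L[ℝ] E}

/-- `HasCovHom` asks for the formula in every chart. By the transformation law of the Christoffel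
symbols one chart suffices. -/
theorem hasCovHom_of_chart (hγ : IsGeodesicOn g γ J) (ht : t ∈ J)
    (hq : γ t ∈ (extChartAt 𝓘(ℝ, E) q).source)
    (h : HasDerivAt (fun s => (coordMap q (γ s)).comp (L s))
      ((coordMap q (γ t)).comp L' - (connForm g q γ t).comp ((coordMap q (γ t)).comp (L t))) t) :
    HasCovHom g γ L L' t := by
  intro p hp
  have hc := hγ.continuousAt ht
  have hu := (eventually_chartState hγ.1 hγ.2.1 ht hq).self_of_nhds
  have h1 := (hasFDerivAt_fderiv_transition (mem_transitionDomain hq hp)).comp_hasDerivAt t hu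
  refine ((h1.clm_comp h).congr_of_eventuallyEq ?_).congr_deriv ?_
  · filter_upwards [eventually_mem_source hc hq, eventually_mem_source hc hp] with s hs hs'
    ext v
    exact (fderiv_transition_coordMap hs hs' _).symm
  · ext v
    have := christoffel_transition g (mem_transitionDomain hq hp)
      (coordMap q (γ t) (velocityE γ t)) (coordMap q (γ t) (L t v))
    rw [transition_extChartAt hq, fderiv_transition_coordMap hq hp,
      fderiv_transition_coordMap hq hp] at this
    simp only [add_apply, sub_apply, ContinuousLinearMap.comp_apply, map_sub,
      fderiv_transition_coordMap hq hp, Function.comp, connForm, chartState]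
    rw [this]
    abel

theorem HasCovHom.comp {D : ℝ → E →L[ℝ] E} {D' : E →L[ℝ] E} (hγ : IsGeodesicOn g γ J)
    (ht : t ∈ J) (hD : HasCovEnd g γ D D' t) (hL : HasCovHom g γ L L' t) :
    HasCovHom g γ (fun s => (D s).comp (L s)) (D'.comp (L t) + (D t).comp L') t := by
  intro q hq
  refine (((hD.hasDerivAt hγ ht hq).clm_comp (hL q hq)).congr_of_eventuallyEq ?_).congr_deriv ?_
  · filter_upwards [eventually_mem_source (hγ.continuousAt ht) hq] with s hs
    ext v
    exact (endE_coordMap hs _ _).symm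
  · ext v
    simp only [add_apply, sub_apply, ContinuousLinearMap.comp_apply, map_sub, map_add,
      endE_coordMap hq]
    abel

/-- Parallel transport along a geodesic. -/
theorem exists_parallel (hγ : IsGeodesicOn g γ J) (hJ : J.OrdConnected) {s₀ : ℝ} (hs₀ : s₀ ∈ J)
    (L₀ : E₀ →L[ℝ] E) :
    ∃ L : ℝ → E₀ →L[ℝ] E, L s₀ = L₀ ∧ ∀ s ∈ J, HasCovHom g γ L 0 s := by
  obtain ⟨Y, hY0, hY⟩ := exists_global_linearODE (W := E₀ →L[ℝ] E) J hγ.1 hJ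
    (fun q => J ∩ γ ⁻¹' (extChartAt 𝓘(ℝ, E) q).source) (isOpen_inter_preimage_source hγ)
    (fun s hs => ⟨γ s, hs, mem_extChartAt_source _⟩)
    (fun q s y => (coordMap q (γ s)).comp y)
    (fun q s y => (coordInv q (γ s)).comp y)
    (fun q s hs y => by ext v; exact coordMap_coordInv hs.2 _)
    (fun q s hs y => by ext v; exact coordInv_coordMap hs.2 _)
    (fun q s => -ContinuousLinearMap.compL ℝ E₀ E E (connForm g q γ s))
    (fun q s hs => (((ContinuousLinearMap.compL ℝ E₀ E E).contDiff.contDiffAt.comp s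
      (contDiffAt_connForm hγ hs.1 hs.2.2)).neg).continuousAt.continuousWithinAt)
    (fun q p s hs hq hp Y h => by
      have := hasCovHom_of_chart (L' := 0) hγ hs hq.2 (h.congr_deriv (by
        rw [ContinuousLinearMap.comp_zero, zero_sub]; rfl)) p hp.2
      exact this.congr_deriv (by rw [ContinuousLinearMap.comp_zero, zero_sub]; rfl)) hs₀ L₀
  refine ⟨Y, hY0, fun s hs => ?_⟩
  have hq := mem_extChartAt_source (I := 𝓘(ℝ, E)) (γ s)
  exact hasCovHom_of_chart hγ hs hq ((hY s hs _ ⟨hs, hq⟩).congr_deriv (by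
        rw [ContinuousLinearMap.comp_zero, zero_sub]; rfl))

/-- The derivative of the scalar product of fields along a geodesic. -/
theorem HasCovHom.hasDerivAt_innerE {E₁ : Type*} [NormedAddCommGroup E₁] [NormedSpace ℝ E₁]
    {L₁ : ℝ → E₁ →L[ℝ] E} {L₁' : E₁ →L[ℝ] E} (hγ : IsGeodesicOn g γ J) (ht : t ∈ J)
    (hL : HasCovHom g γ L L' t) (hL₁ : HasCovHom g γ L₁ L₁' t) (X : E₀) (Y : E₁) :
    HasDerivAt (fun s => innerE g (γ s) (L s X) (L₁ s Y))
      (innerE g (γ t) (L' X) (L₁ t Y) + innerE g (γ t) (L t X) (L₁' Y)) t := by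
  have hq := mem_extChartAt_source (I := 𝓘(ℝ, E)) (γ t)
  have h1 := (hL _ hq).clm_apply (hasDerivAt_const t X)
  have h2 := (hL₁ _ hq).clm_apply (hasDerivAt_const t Y)
  have h3 := hasDerivAt_chartMetric g (hasDerivAt_prod_fst (hγ.hasDerivAt_chartState ht hq)) h1 h2
    ((extChartAt 𝓘(ℝ, E) (γ t)).map_source hq)
  refine (h3.congr_of_eventuallyEq ?_).congr_deriv ?_
  · filter_upwards [eventually_mem_source (hγ.continuousAt ht) hq] with s hs
    exact (chartMetric_coordMap g hs _ _).symm
  · rw [← chartMetric_coordMap g hq, ← chartMetric_coordMap g hq]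
    simp [connForm, spray, chartState]

/-- The derivative of the scalar product of a field along a geodesic with the velocity. -/
theorem HasCovHom.hasDerivAt_innerE_velocityE (hγ : IsGeodesicOn g γ J) (ht : t ∈ J)
    (hL : HasCovHom g γ L L' t) (X : E₀) :
    HasDerivAt (fun s => innerE g (γ s) (velocityE γ s) (L s X))
      (innerE g (γ t) (velocityE γ t) (L' X)) t := by
  have hq := mem_extChartAt_source (I := 𝓘(ℝ, E)) (γ t)
  have h1 := (hL _ hq).clm_apply (hasDerivAt_const t X)
  have hst := hγ.hasDerivAt_chartState ht hq
  have h3 := hasDerivAt_chartMetric g (hasDerivAt_prod_fst hst) (hasDerivAt_prod_snd hst) h1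
    ((extChartAt 𝓘(ℝ, E) (γ t)).map_source hq)
  refine (h3.congr_of_eventuallyEq ?_).congr_deriv ?_
  · filter_upwards [eventually_mem_source (hγ.continuousAt ht) hq] with s hs
    exact (chartMetric_coordMap g hs _ _).symm
  · rw [← chartMetric_coordMap g hq]
    simp [connForm, spray, chartState]

/-- The linearization of the geodesic flow along a Jacobi field, in the chart at `q`. -/
def jacobiState (g : SmoothMetric E P) (q : P) (γ : ℝ → P) (L L' : ℝ → E₀ →L[ℝ] E) (s : ℝ) :
    E₀ →L[ℝ] E × E :=
  ((coordMap q (γ s)).comp (L s)).prod ((coordMap q (γ s)).comp (L' s)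
    - (connForm g q γ s).comp ((coordMap q (γ s)).comp (L s)))

theorem fderiv_christoffel_symm {u : E} (hu : u ∈ (extChartAt 𝓘(ℝ, E) q).target) (a v w : E) :
    fderiv ℝ (christoffel g q) u a v w = fderiv ℝ (christoffel g q) u a w v := by
  have h := hasFDerivAt_christoffel g hu
  have h1 := (h.clm_apply (hasFDerivAt_const v u)).clm_apply (hasFDerivAt_const w u)
  have h2 := (h.clm_apply (hasFDerivAt_const w u)).clm_apply (hasFDerivAt_const v u)
  have h3 := h1.unique (h2.congr_of_eventuallyEq (by
    filter_upwards [(isOpen_extChartAt_target q).mem_nhds hu] with z hz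
    exact christoffel_symm g hz v w))
  simpa using DFunLike.congr_fun h3 a

theorem hasFDerivAt_spray {z : E × E} (hz : z.1 ∈ (extChartAt 𝓘(ℝ, E) q).target) :
    HasFDerivAt (spray g q) (fderiv ℝ (spray g q) z) z :=
  ((contDiffAt_spray g hz).differentiableAt (by simp)).hasFDerivAt

theorem fderiv_spray_apply {z : E × E} (hz : z.1 ∈ (extChartAt 𝓘(ℝ, E) q).target) (a b : E) :
    fderiv ℝ (spray g q) z (a, b) = (b, -(fderiv ℝ (christoffel g q) z.1 a z.2 z.2
      + christoffel g q z.1 z.2 b + christoffel g q z.1 z.2 b)) := by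
  have hΓ : HasFDerivAt (fun z : E × E => christoffel g q z.1) _ z :=
    (hasFDerivAt_christoffel g hz).comp z hasFDerivAt_fst
  have h := hasFDerivAt_snd.prodMk (((hΓ.clm_apply hasFDerivAt_snd).clm_apply
    hasFDerivAt_snd).neg) (x := z)
  have h' : HasFDerivAt (spray g q) _ z := h
  rw [h'.fderiv]
  ext
  · simp
  · simp [christoffel_symm g hz b z.2]
    abel

theorem hasDerivAt_connForm (hγ : IsGeodesicOn g γ J) (ht : t ∈ J)
    (hq : γ t ∈ (extChartAt 𝓘(ℝ, E) q).source) :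
    HasDerivAt (connForm g q γ) (fderiv ℝ (christoffel g q) (chartState q γ t).1
        (chartState q γ t).2 (chartState q γ t).2
      - christoffel g q (chartState q γ t).1 (connForm g q γ t (chartState q γ t).2)) t := by
  have hst := hγ.hasDerivAt_chartState ht hq
  have h0 : HasDerivAt (fun s => christoffel g q (chartState q γ s : E × E).1)
      (fderiv ℝ (christoffel g q) (chartState q γ t).1 (spray g q (chartState q γ t)).1) t :=
    HasFDerivAt.comp_hasDerivAt t
      (hasFDerivAt_christoffel g ((extChartAt 𝓘(ℝ, E) q).map_source hq)) (hasDerivAt_prod_fst hst)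
  have h : HasDerivAt (connForm g q γ) _ t := h0.clm_apply (hasDerivAt_prod_snd hst)
  refine h.congr_deriv ?_
  rw [spray, map_neg, ← sub_eq_add_neg]
  rfl

theorem hasDerivAt_clm_prod {W₁ W₂ : Type*} [NormedAddCommGroup W₁] [NormedSpace ℝ W₁]
    [NormedAddCommGroup W₂] [NormedSpace ℝ W₂] {a : ℝ → E₀ →L[ℝ] W₁} {b : ℝ → E₀ →L[ℝ] W₂}
    {a' : E₀ →L[ℝ] W₁} {b' : E₀ →L[ℝ] W₂} (ha : HasDerivAt a a' t) (hb : HasDerivAt b b' t) :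
    HasDerivAt (fun s => (a s).prod (b s)) (a'.prod b') t := by
  have h4 := ((hasDerivAt_const t (ContinuousLinearMap.inl ℝ W₁ W₂)).clm_comp ha).add
    ((hasDerivAt_const t (ContinuousLinearMap.inr ℝ W₁ W₂)).clm_comp hb)
  have e : ∀ (x : E₀ →L[ℝ] W₁) (y : E₀ →L[ℝ] W₂), (ContinuousLinearMap.inl ℝ W₁ W₂).comp x
      + (ContinuousLinearMap.inr ℝ W₁ W₂).comp y = x.prod y := fun x y => by ext X <;> simp
  rw [ContinuousLinearMap.zero_comp, ContinuousLinearMap.zero_comp, zero_add, zero_add, e] at h4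
  exact h4.congr_of_eventuallyEq (Filter.Eventually.of_forall fun s => (e _ _).symm)

/-- The Jacobi equation is the linearization of the spray after the substitution of the covariant
derivative `L'` for the coordinate derivative `L' - Γ(γ', L)`. The derivatives of `Γ` in the
curvature combine with that of the connection form, by symmetry of `Γ` in its two arguments. -/
theorem hasDerivAt_jacobiState {L L' : ℝ → E₀ →L[ℝ] E} (hγ : IsGeodesicOn g γ J) (ht : t ∈ J)
    (hq : γ t ∈ (extChartAt 𝓘(ℝ, E) q).source) (h1 : HasCovHom g γ L (L' t) t)
    (h2 : HasCovHom g γ L' (-(jacobiOp g (γ t) (velocityE γ t)).comp (L t)) t) :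
    HasDerivAt (jacobiState g q γ L L')
      ((fderiv ℝ (spray g q) (chartState q γ t)).comp (jacobiState g q γ L L' t)) t := by
  have hut := (extChartAt 𝓘(ℝ, E) q).map_source hq
  have h3 := hasDerivAt_clm_prod (h1 q hq)
    ((h2 q hq).sub ((hasDerivAt_connForm hγ ht hq).clm_comp (h1 q hq)))
  refine HasDerivAt.congr_deriv (f := jacobiState g q γ L L') h3 ?_
  refine ContinuousLinearMap.ext fun X => ?_
  have hR : coordMap q (γ t) (jacobiOp g (γ t) (velocityE γ t) (L t X))
      = chartCurvature g q (chartState q γ t).1 (coordMap q (γ t) (L t X))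
        (chartState q γ t).2 (chartState q γ t).2 := by
    rw [← endE_coordMap hq, endE_jacobiOp hq]
    rfl
  rw [ContinuousLinearMap.comp_apply]
  have hjs : jacobiState g q γ L L' t X = (coordMap q (γ t) (L t X), coordMap q (γ t) (L' t X)
    - connForm g q γ t (coordMap q (γ t) (L t X))) := rfl
  rw [hjs, fderiv_spray_apply hut]
  have hωt : connForm g q γ t = christoffel g q (chartState q γ t).1 (chartState q γ t).2 := rfl
  rw [ContinuousLinearMap.prod_apply]
  refine Prod.ext rfl ?_
  simp only [add_apply, sub_apply, neg_apply, ContinuousLinearMap.comp_apply,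
    map_neg, map_sub, hR, hωt, chartCurvature]
  have hut' : (chartState q γ t : E × E).1 ∈ (extChartAt 𝓘(ℝ, E) q).target := hut
  generalize (chartState q γ t : E × E) = z at *
  obtain ⟨u, v⟩ := z
  dsimp only at *
  rw [fderiv_christoffel_symm hut' v (coordMap q (γ t) (L t X)) v,
    christoffel_symm g hut' (coordMap q (γ t) (L t X)) (christoffel g q u v v),
    christoffel_symm g hut' (coordMap q (γ t) (L t X)) v]
  abel

end JacobiFields

/-! ### Differentiable dependence of geodesics on a parameter in a manifold -/

noncomputable section GeodesicVariations
open Metric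

variable {E₀ : Type*} [NormedAddCommGroup E₀] [NormedSpace ℝ E₀]
  {E : Type*} [NormedAddCommGroup E] [NormedSpace ℝ E]
  {P : Type*} [TopologicalSpace P] [ChartedSpace E P] [IsManifold 𝓘(ℝ, E) ∞ P]
  {M : Type*} [TopologicalSpace M] [ChartedSpace E₀ M]
  {g : SmoothMetric E P} {q p : P}

/-- Moves the parameter from `M` to its model space, where `hasFDerivAt_solution` applies. The only
extra content is that continuity follows from differentiability in the chart. -/
theorem hasMFDerivAt_iff_hasFDerivAt_symm {W : Type*} [NormedAddCommGroup W] [NormedSpace ℝ W]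
    {h : M → W} {x : M} {h' : E₀ →L[ℝ] W} :
    HasMFDerivAt 𝓘(ℝ, E₀) 𝓘(ℝ, W) h x h' ↔
      HasFDerivAt (fun v => h ((extChartAt 𝓘(ℝ, E₀) x).symm v)) h' (extChartAt 𝓘(ℝ, E₀) x x) := by
  constructor
  · intro H
    have := H.2
    rw [ModelWithCorners.range_eq_univ] at this
    exact hasFDerivWithinAt_univ.1 this
  · intro H
    refine ⟨?_, ?_⟩
    · have h1 : ContinuousAt (fun y => h ((extChartAt 𝓘(ℝ, E₀) x).symm (extChartAt 𝓘(ℝ, E₀) x y)))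
          x := ContinuousAt.comp (f := extChartAt 𝓘(ℝ, E₀) x)
            (g := fun v => h ((extChartAt 𝓘(ℝ, E₀) x).symm v)) H.continuousAt
            (continuousAt_extChartAt x)
      refine h1.congr ?_
      filter_upwards [extChartAt_source_mem_nhds (I := 𝓘(ℝ, E₀)) x] with y hy
      rw [(extChartAt 𝓘(ℝ, E₀) x).left_inv hy]
    · rw [ModelWithCorners.range_eq_univ]
      exact hasFDerivWithinAt_univ.2 H

variable [FiniteDimensional ℝ E]

/-- The variation `x ↦ G x r` of geodesics is differentiable at `x₀`, with variation field `L` whose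
covariant derivative along the geodesic is `L'`. -/
def HasVariation (g : SmoothMetric E P) (G : M → ℝ → P) (L L' : ℝ → E₀ →L[ℝ] E) (x₀ : M)
    (r : ℝ) : Prop :=
  ContinuousAt (fun x => G x r) x₀ ∧ ∀ q, G x₀ r ∈ (extChartAt 𝓘(ℝ, E) q).source →
    HasMFDerivAt 𝓘(ℝ, E₀) 𝓘(ℝ, E × E) (fun x => (chartState q (G x) r : E × E)) x₀
      (jacobiState g q (G x₀) L L' r : E₀ →L[ℝ] E × E)

variable {G : M → ℝ → P} {J : M → Set ℝ} {L L' : ℝ → E₀ →L[ℝ] E} {x₀ : M} {r : ℝ}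

/-- The coordinates of the velocity produce a second derivative of the transition, and the
connection form produces the same one through `christoffel_transition`; the two match by symmetry of
second derivatives. -/
theorem hasVariation_of_chart (hc : ContinuousAt (fun x => G x r) x₀)
    (hq : G x₀ r ∈ (extChartAt 𝓘(ℝ, E) q).source)
    (h : HasMFDerivAt 𝓘(ℝ, E₀) 𝓘(ℝ, E × E) (fun x => (chartState q (G x) r : E × E)) x₀
      (jacobiState g q (G x₀) L L' r : E₀ →L[ℝ] E × E)) : HasVariation g G L L' x₀ r := by
  refine ⟨hc, fun p hp => ?_⟩
  have h1 : HasMFDerivAt 𝓘(ℝ, E₀) 𝓘(ℝ, E) (fun x => extChartAt 𝓘(ℝ, E) q (G x r)) x₀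
      ((coordMap q (G x₀ r)).comp (L r) : E₀ →L[ℝ] E) :=
    hasMFDerivAt_iff_hasFDerivAt_symm.2
      ((hasMFDerivAt_iff_hasFDerivAt_symm.1 h).fst.congr_fderiv (by ext; rfl))
  have h2 : HasMFDerivAt 𝓘(ℝ, E₀) 𝓘(ℝ, E)
      (fun x => coordMap q (G x r) (velocityE (G x) r)) x₀ ((coordMap q (G x₀ r)).comp (L' r)
        - (connForm g q (G x₀) r).comp ((coordMap q (G x₀ r)).comp (L r)) : E₀ →L[ℝ] E) :=
    hasMFDerivAt_iff_hasFDerivAt_symm.2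
      ((hasMFDerivAt_iff_hasFDerivAt_symm.1 h).snd.congr_fderiv (by ext; rfl))
  have h3 := hasMFDerivAt_extChartAt_comp hc hq hp h1
  have h4 := hasMFDerivAt_coordMap (V := fun x => velocityE (G x) r) hc hq hp h1 h2
  have h5 : HasMFDerivAt 𝓘(ℝ, E₀) 𝓘(ℝ, E × E) (fun x => (chartState p (G x) r : E × E)) x₀ _ :=
    ⟨h3.1.prodMk h4.1, h3.2.prodMk h4.2⟩
  suffices e : (jacobiState g p (G x₀) L L' r : E₀ →L[ℝ] E × E) =
      ((fderiv ℝ (transition E q p) (extChartAt 𝓘(ℝ, E) q (G x₀ r))).comp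
        ((coordMap q (G x₀ r)).comp (L r))).prod
      ((fderiv ℝ (transition E q p) (extChartAt 𝓘(ℝ, E) q (G x₀ r))).comp
        ((coordMap q (G x₀ r)).comp (L' r)
          - (connForm g q (G x₀) r).comp ((coordMap q (G x₀ r)).comp (L r)))
        + ((fderiv ℝ (fderiv ℝ (transition E q p)) (extChartAt 𝓘(ℝ, E) q (G x₀ r))).flip
            (coordMap q (G x₀ r) (velocityE (G x₀) r))).comp
          ((coordMap q (G x₀ r)).comp (L r))) by
    rw [e]
    exact h5
  refine ContinuousLinearMap.ext fun X => Prod.ext ?_ ?_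
  · exact (fderiv_transition_coordMap hq hp (L r X)).symm
  · have := christoffel_transition g (mem_transitionDomain hq hp)
      (coordMap q (G x₀ r) (velocityE (G x₀) r)) (coordMap q (G x₀ r) (L r X))
    rw [transition_extChartAt hq, fderiv_transition_coordMap hq hp,
      fderiv_transition_coordMap hq hp] at this
    have hs := snd_fderiv_transition_symm (mem_transitionDomain hq hp)
      (coordMap q (G x₀ r) (velocityE (G x₀) r)) (coordMap q (G x₀ r) (L r X))
    have h6 := fderiv_transition_coordMap hq hp (L' r X)
    simp only [jacobiState, ContinuousLinearMap.prod_apply, add_apply, sub_apply,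
      ContinuousLinearMap.comp_apply, map_sub, ContinuousLinearMap.flip_apply, connForm, chartState]
    rw [this, h6, hs]
    abel

/-- The radius `2ρ` leaves a margin: trajectories within `ρ` of `z₀` have closed `ρ`-neighbourhoods
inside the ball, as `hasFDerivAt_solution` demands. -/
theorem exists_lipschitzOn_spray {z₀ : E × E} (hz : z₀.1 ∈ (extChartAt 𝓘(ℝ, E) q).target) :
    ∃ ρ > 0, ∃ K C : NNReal, (∀ z ∈ ball z₀ (2 * ρ), z.1 ∈ (extChartAt 𝓘(ℝ, E) q).target) ∧
      LipschitzOnWith K (spray g q) (ball z₀ (2 * ρ)) ∧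
      LipschitzOnWith C (fderiv ℝ (spray g q)) (ball z₀ (2 * ρ)) := by
  have h := contDiffAt_spray g hz
  obtain ⟨K, s, hs, hK⟩ := (h.of_le (m := 1) (by simp)).exists_lipschitzOnWith
  obtain ⟨C, t, ht, hC⟩ := ((h.fderiv_right (m := ∞) (by simp)).of_le (m := 1) (by simp)).exists_lipschitzOnWith
  have hu : {z : E × E | z.1 ∈ (extChartAt 𝓘(ℝ, E) q).target} ∈ 𝓝 z₀ :=
    continuousAt_fst.eventually_mem ((isOpen_extChartAt_target q).mem_nhds hz)
  obtain ⟨ρ, hρ, hsub⟩ := Metric.mem_nhds_iff.1 (Filter.inter_mem hu (Filter.inter_mem hs ht))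
  have e : 2 * (ρ / 2) = ρ := by ring
  refine ⟨ρ / 2, by positivity, K, C, ?_, ?_, ?_⟩ <;> rw [e]
  · exact fun z hz => (hsub hz).1
  · exact hK.mono fun z hz => (hsub hz).2.1
  · exact hC.mono fun z hz => (hsub hz).2.2

/-- Geodesics with initial data in the domain of a local flow of the spray follow it. -/
theorem IsGeodesicOn.chartState_mem [T2Space P] {γ : ℝ → P} {I : Set ℝ} (hγ : IsGeodesicOn g γ I)
    (hI : I.OrdConnected) {a : ℝ} (ha : a ∈ I) (hq : γ a ∈ (extChartAt 𝓘(ℝ, E) q).source)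
    {Ω : Set (E × E)} (hΩ : ∀ z ∈ Ω, z.1 ∈ (extChartAt 𝓘(ℝ, E) q).target) {h : ℝ} (hh : 0 < h)
    {α : ℝ → E × E} (hα0 : α 0 = chartState q γ a)
    (hα : ∀ t ∈ Ioo (-h) h, HasDerivAt α (spray g q (α t)) t ∧ α t ∈ Ω) {t : ℝ} (ht : t ∈ I)
    (hta : |t - a| < h) : γ t ∈ (extChartAt 𝓘(ℝ, E) q).source ∧ chartState q γ t ∈ Ω := by
  have hm : ∀ s ∈ Ioo (a - h) (a + h), s - a ∈ Ioo (-h) h := fun s hs =>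
    ⟨by linarith [hs.1], by linarith [hs.2]⟩
  obtain ⟨hβ, hβ'⟩ := isGeodesicOn_of_spray g (q := q) (β := fun t => α (t - a))
    (J := Ioo (a - h) (a + h)) isOpen_Ioo (fun s hs => (hα _ (hm s hs)).1.comp_sub_const s a)
    (fun s hs => hΩ _ (hα _ (hm s hs)).2)
  have haS : a ∈ Ioo (a - h) (a + h) := ⟨by linarith, by linarith⟩
  have htS : t ∈ Ioo (a - h) (a + h) := by
    rw [abs_lt] at hta
    exact ⟨by linarith, by linarith⟩
  have h0 := (chartState_eq_iff hq (hβ' a haS).1).1 (by rw [(hβ' a haS).2, sub_self, hα0])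
  have heq := hγ.eqOn hβ (hI.inter ordConnected_Ioo) inter_subset_left inter_subset_right
    ⟨ha, haS⟩ h0.1 h0.2
  have hev := heq.eventuallyEq_of_mem ((hγ.1.inter isOpen_Ioo).mem_nhds ⟨ht, htS⟩)
  rw [chartState_congr hev q, (hβ' t htS).2, hev.eq_of_nhds]
  exact ⟨(hβ' t htS).1, (hα _ (hm t htS)).2⟩

/-- Near `r` the base geodesic stays in one chart and in the domain of a local flow. The time from
`a` to `b` is rescaled to `[0, 1]`, the spray acquiring the factor `b - a` of either sign; hence `O`
serves for propagation in both directions. -/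
theorem exists_hasVariation_step [T2Space P] (hG : ∀ x, IsGeodesicOn g (G x) (J x))
    (hJ : ∀ x, (J x).OrdConnected)
    (hL : ∀ s ∈ J x₀, HasCovHom g (G x₀) L (L' s) s ∧
      HasCovHom g (G x₀) L' (-(jacobiOp g (G x₀ s) (velocityE (G x₀) s)).comp (L s)) s)
    (hr : r ∈ J x₀) : ∃ O ∈ 𝓝 r, ∀ a ∈ O, ∀ b ∈ O, (∀ x, a ∈ J x) → (∀ x, b ∈ J x) →
      HasVariation g G L L' x₀ a → HasVariation g G L L' x₀ b := by
  obtain ⟨q, hq⟩ : ∃ q, G x₀ r ∈ (extChartAt 𝓘(ℝ, E) q).source := ⟨_, mem_extChartAt_source _⟩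
  set z₀ : E × E := chartState q (G x₀) r with hz₀
  have hz : z₀.1 ∈ (extChartAt 𝓘(ℝ, E) q).target := (extChartAt 𝓘(ℝ, E) q).map_source hq
  obtain ⟨ρ, hρ, K, C, htar, hK, hC⟩ := exists_lipschitzOn_spray (g := g) hz
  set Ω : Set (E × E) := ball z₀ (2 * ρ) with hΩ
  have hΩz : Ω ∈ 𝓝 z₀ := ball_mem_nhds _ (by positivity)
  obtain ⟨h, hh, U, hU, hflow⟩ := exists_localFlow_mem
    ((contDiffAt_spray g hz).of_le (m := 1) (by simp)) hΩz
  have hcs : ContinuousAt (chartState q (G x₀) : ℝ → E × E) r :=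
    ((hG x₀).hasDerivAt_chartState hr hq).continuousAt
  have hev : ∀ᶠ t in 𝓝 r, t ∈ J x₀ ∧ G x₀ t ∈ (extChartAt 𝓘(ℝ, E) q).source ∧
      (chartState q (G x₀) t : E × E) ∈ ball z₀ ρ ∧ U ∈ 𝓝 (chartState q (G x₀) t : E × E) := by
    filter_upwards [(hG x₀).1.mem_nhds hr, eventually_mem_source ((hG x₀).continuousAt hr) hq,
      hcs.eventually_mem (ball_mem_nhds _ hρ),
      hcs.eventually (eventually_mem_nhds_iff.2 hU)] with t h1 h2 h3 h4
    exact ⟨h1, h2, h3, h4⟩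
  obtain ⟨η, hη, hball⟩ := Metric.mem_nhds_iff.1 hev
  have hη' : 0 < min η (h / 2) := lt_min hη (by positivity)
  refine ⟨ball r (min η (h / 2)), ball_mem_nhds _ hη', fun a ha b hb haJ hbJ hva => ?_⟩
  have hsub : ball r (min η (h / 2)) ⊆ ball r η := ball_subset_ball (min_le_left _ _)
  have hda : |a - r| < h / 2 := lt_of_lt_of_le ha (min_le_right _ _)
  have hdb : |b - r| < h / 2 := lt_of_lt_of_le hb (min_le_right _ _)
  obtain ⟨haJ₀, haq, -, haU⟩ := hball (hsub ha)
  have hconv : ∀ s ∈ Icc (0 : ℝ) 1, a + (b - a) * s ∈ segment ℝ a b := fun s hs => by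
    rw [segment_eq_image']
    exact ⟨s, hs, by simp [mul_comm]⟩
  have hJs : ∀ x, ∀ s ∈ Icc (0 : ℝ) 1, a + (b - a) * s ∈ J x := fun x s hs =>
    (hJ x).convex.segment_subset (haJ x) (hbJ x) (hconv s hs)
  have hdist : ∀ s ∈ Icc (0 : ℝ) 1, |a + (b - a) * s - a| < h := fun s hs => by
    rw [add_sub_cancel_left, abs_mul, abs_of_nonneg hs.1]
    have h1 : |b - a| < h := by
      have := abs_sub_le b r a
      rw [abs_sub_comm r a] at this
      linarith
    nlinarith [abs_nonneg (b - a), hs.1, hs.2]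
  -- For `x` near `x₀` the state at time `a` lies in `U`, by differentiability at `a`. Uniqueness
  -- then forces the geodesic `G x` to follow the local flow, so it remains in `Ω` up to time `b`.
  have hnear : ∀ᶠ x in 𝓝 x₀, ∀ s ∈ Icc (0 : ℝ) 1,
      G x (a + (b - a) * s) ∈ (extChartAt 𝓘(ℝ, E) q).source ∧
        (chartState q (G x) (a + (b - a) * s) : E × E) ∈ Ω := by
    filter_upwards [eventually_mem_source hva.1 haq, (hva.2 q haq).1.eventually_mem haU]
      with x hx hxU s hs
    obtain ⟨α, hα0, hα⟩ := hflow _ hxU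
    exact (hG x).chartState_mem (hJ x) (haJ x) hx htar hh hα0 hα (hJs x s hs) (hdist s hs)
  have hbq : ∀ᶠ x in 𝓝 x₀, G x b ∈ (extChartAt 𝓘(ℝ, E) q).source := by
    filter_upwards [hnear] with x hx
    simpa using (hx 1 ⟨zero_le_one, le_rfl⟩).1
  have hder : ∀ x, ∀ s ∈ Icc (0 : ℝ) 1, G x (a + (b - a) * s) ∈ (extChartAt 𝓘(ℝ, E) q).source →
      HasDerivAt (fun s => (chartState q (G x) (a + (b - a) * s) : E × E))
        ((b - a) • spray g q (chartState q (G x) (a + (b - a) * s))) s := by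
    intro x s hs hx
    have h1 : HasDerivAt (fun s : ℝ => a + (b - a) * s) (b - a) s := by
      simpa using ((hasDerivAt_id s).const_mul (b - a)).const_add a
    exact ((hG x).hasDerivAt_chartState (hJs x s hs) hx).scomp s h1
  set σ : E₀ → M := fun v => (extChartAt 𝓘(ℝ, E₀) x₀).symm v with hσ
  have hσ0 : σ (extChartAt 𝓘(ℝ, E₀) x₀ x₀) = x₀ := extChartAt_to_inv x₀
  have hσc : Filter.Tendsto σ (𝓝 (extChartAt 𝓘(ℝ, E₀) x₀ x₀)) (𝓝 x₀) := by
    have := continuousAt_extChartAt_symm (I := 𝓘(ℝ, E₀)) x₀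
    rw [ContinuousAt, extChartAt_to_inv] at this
    exact this
  have hmain := hasFDerivAt_solution (V := E₀) (X := spray g q) (X' := fderiv ℝ (spray g q))
    (convex_ball z₀ (2 * ρ)) (fun z hz => hasFDerivAt_spray (htar z hz)) hK hC (c := b - a)
    (α := fun v s => chartState q (G (σ v)) (a + (b - a) * s))
    (v₀ := extChartAt 𝓘(ℝ, E₀) x₀ x₀) (by
      filter_upwards [hσc.eventually hnear] with v hv s hs
      exact ⟨hder _ s hs (hv s hs).1, (hv s hs).2⟩) hρ (fun s hs => by
      have hm : a + (b - a) * s ∈ ball r (min η (h / 2)) :=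
        (convex_ball r _).segment_subset ha hb (hconv s hs)
      have h3 := (hball (hsub hm)).2.2.1
      simp only [hσ0]
      refine closedBall_subset_ball' ?_
      have : dist (chartState q (G x₀) (a + (b - a) * s) : E × E) z₀ < ρ := h3
      linarith)
    (w := fun s => jacobiState g q (G x₀) L L' (a + (b - a) * s)) (fun s hs => by
      have hs' := hJs x₀ s hs
      have h1 : HasDerivAt (fun s : ℝ => a + (b - a) * s) (b - a) s := by
        simpa using ((hasDerivAt_id s).const_mul (b - a)).const_add a
      have h2 := hasDerivAt_jacobiState (hG x₀) hs' ((hnear.self_of_nhds s hs).1) (hL _ hs').1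
        (hL _ hs').2
      simp only [hσ0]
      exact h2.scomp s h1)
    (by
      have := hasMFDerivAt_iff_hasFDerivAt_symm.1 (hva.2 q haq)
      simp only [mul_zero, add_zero]
      exact this)
  have hsb : a + (b - a) * 1 = b := by ring
  simp only [hsb] at hmain
  have hmain' := hasMFDerivAt_iff_hasFDerivAt_symm (h := fun x => (chartState q (G x) b : E × E)).2
    hmain
  refine hasVariation_of_chart ?_ hbq.self_of_nhds hmain'
  -- Differentiability is known only for the chart coordinates. Continuity into `P` is recovered by
  -- applying the inverse chart, since the points at time `b` lie in its source.
  have h1 : ContinuousAt (fun x => (extChartAt 𝓘(ℝ, E) q).symm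
      (chartState q (G x) b : E × E).1) x₀ :=
    ContinuousAt.comp (f := fun x => (chartState q (G x) b : E × E).1)
      (g := (extChartAt 𝓘(ℝ, E) q).symm)
      (continuousAt_extChartAt_symm' hbq.self_of_nhds) hmain'.1.fst
  refine h1.congr ?_
  filter_upwards [hbq] with x hx
  exact (extChartAt 𝓘(ℝ, E) q).left_inv hx

/-- The variation field of a variation by geodesics is a Jacobi field. -/
theorem HasVariation.of_jacobi [T2Space P] (hG : ∀ x, IsGeodesicOn g (G x) (J x))
    (hJ : ∀ x, (J x).OrdConnected)
    (hL : ∀ s ∈ J x₀, HasCovHom g (G x₀) L (L' s) s ∧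
      HasCovHom g (G x₀) L' (-(jacobiOp g (G x₀ s) (velocityE (G x₀) s)).comp (L s)) s)
    {a b : ℝ} (ha : ∀ x, a ∈ J x) (hb : ∀ x, b ∈ J x) (h : HasVariation g G L L' x₀ a) :
    HasVariation g G L L' x₀ b := by
  have hsub : ∀ x, uIcc a b ⊆ J x := fun x => (hJ x).uIcc_subset (ha x) (hb x)
  -- Having a variation is locally constant on the segment between `a` and `b`, where every `G x` is
  -- defined, by the step applied in both directions.
  have := isPreconnected_uIcc.induction₂
    (fun s t => HasVariation g G L L' x₀ s ↔ HasVariation g G L L' x₀ t) (fun r hr => ?_)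
    (fun x y z _ _ _ => Iff.trans) (fun x y _ _ => Iff.symm)
    (left_mem_uIcc : a ∈ uIcc a b) right_mem_uIcc
  · exact this.1 h
  obtain ⟨O, hO, H⟩ := exists_hasVariation_step hG hJ hL (hsub x₀ hr)
  filter_upwards [mem_nhdsWithin_of_mem_nhds hO, self_mem_nhdsWithin] with s hs hs'
  exact ⟨H r (mem_of_mem_nhds hO) s hs (fun x => hsub x hr) (fun x => hsub x hs'),
    H s hs r (mem_of_mem_nhds hO) (fun x => hsub x hs') (fun x => hsub x hr)⟩

end GeodesicVariations

/-! ### Variations issuing from a vector field along a map -/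

noncomputable section NormalVariations

variable {E₀ : Type*} [NormedAddCommGroup E₀] [NormedSpace ℝ E₀]
  {E : Type*} [NormedAddCommGroup E] [NormedSpace ℝ E]
  {P : Type*} [TopologicalSpace P] [ChartedSpace E P] [IsManifold 𝓘(ℝ, E) ∞ P]
  {M : Type*} [TopologicalSpace M] [ChartedSpace E₀ M]
  {g : SmoothMetric E P} {q p : P} {f : M → P} {V : M → E} {x₀ : M}

/-- Smoothness of a vector field along a map, in coordinates. -/
theorem contMDiffAt_vectorField_iff :
    ContMDiffAt 𝓘(ℝ, E₀) 𝓘(ℝ, E).tangent ∞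
        (fun x => (⟨f x, (V x : E)⟩ : TangentBundle 𝓘(ℝ, E) P)) x₀ ↔
      ContMDiffAt 𝓘(ℝ, E₀) 𝓘(ℝ, E) ∞ f x₀ ∧
        ContMDiffAt 𝓘(ℝ, E₀) 𝓘(ℝ, E) ∞ (fun x => coordMap (f x₀) (f x) (V x)) x₀ := by
  have h := Bundle.contMDiffAt_totalSpace (F := E) (E := fun p : P => TangentSpace 𝓘(ℝ, E) p)
    (IM := 𝓘(ℝ, E₀)) (IB := 𝓘(ℝ, E)) (n := ∞)
    (f := fun x => (⟨f x, (V x : E)⟩ : TangentBundle 𝓘(ℝ, E) P)) (x₀ := x₀)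
  refine h.trans (and_congr_right fun hf => ?_)
  refine Filter.EventuallyEq.contMDiffAt_iff ?_
  filter_upwards [eventually_mem_source (E := E) hf.continuousAt
    (mem_extChartAt_source (I := 𝓘(ℝ, E)) (f x₀))] with x hx
  rw [coordMap_eq hx]
  rfl

variable [FiniteDimensional ℝ E]

/-- The derivative of the scalar product of vector fields along a map. -/
theorem innerE_covAlong_add {V₁ : M → E} (hf : ContinuousAt f x₀) {u' V' V₁' : E₀ →L[ℝ] E}
    (hu : HasMFDerivAt 𝓘(ℝ, E₀) 𝓘(ℝ, E) (fun x => extChartAt 𝓘(ℝ, E) (f x₀) (f x)) x₀ u')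
    (hV : HasMFDerivAt 𝓘(ℝ, E₀) 𝓘(ℝ, E) (fun x => coordMap (f x₀) (f x) (V x)) x₀ V')
    (hV₁ : HasMFDerivAt 𝓘(ℝ, E₀) 𝓘(ℝ, E) (fun x => coordMap (f x₀) (f x) (V₁ x)) x₀ V₁')
    {c : ℝ} (hc : ∀ x, innerE g (f x) (V x) (V₁ x) = c) (X : E₀) :
    innerE g (f x₀) (covAlong g f V x₀ X) (V₁ x₀)
      + innerE g (f x₀) (V x₀) (covAlong g f V₁ x₀ X) = 0 := by
  have hq := mem_extChartAt_source (I := 𝓘(ℝ, E)) (f x₀)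
  have h1 := covAlong_eq g hf hu hV X
  have h2 := covAlong_eq g hf hu hV₁ X
  set v₀ := extChartAt 𝓘(ℝ, E₀) x₀ x₀ with hv₀
  set σ : E₀ → M := fun v => (extChartAt 𝓘(ℝ, E₀) x₀).symm v with hσ
  have hσ0 : σ v₀ = x₀ := extChartAt_to_inv x₀
  -- Restriction to a coordinate line through `x₀` in direction `X` reduces the identity to the
  -- product rule along a curve.
  have hline : HasDerivAt (fun s : ℝ => v₀ + s • X) X 0 := by
    simpa using ((hasDerivAt_id (0 : ℝ)).smul_const X).const_add v₀
  have hl0 : v₀ + (0 : ℝ) • X = v₀ := by simp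
  have key : ∀ {W : M → E} {W' : E₀ →L[ℝ] E}, HasMFDerivAt 𝓘(ℝ, E₀) 𝓘(ℝ, E) W x₀ W' →
      HasDerivAt (fun s : ℝ => W (σ (v₀ + s • X))) (W' X) 0 := fun {W W'} hW => by
    have := hasMFDerivAt_iff_hasFDerivAt_symm.1 hW
    rw [← hv₀, ← hl0] at this
    exact this.comp_hasDerivAt (0 : ℝ) hline
  have h3 := hasDerivAt_chartMetric g (key hu) (key hV) (key hV₁) (q := f x₀) (by
    simp only [hl0, hσ0]
    exact (extChartAt 𝓘(ℝ, E) (f x₀)).map_source hq)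
  have hσc : Filter.Tendsto (fun s : ℝ => σ (v₀ + s • X)) (𝓝 0) (𝓝 x₀) := by
    have h4 := continuousAt_extChartAt_symm (I := 𝓘(ℝ, E₀)) x₀
    rw [ContinuousAt, extChartAt_to_inv] at h4
    have h5 := hline.continuousAt
    rw [ContinuousAt, hl0] at h5
    exact h4.comp h5
  have h6 := h3.congr_of_eventuallyEq (f₁ := fun _ => c) (by
    filter_upwards [hσc.eventually (eventually_mem_source (E := E) hf hq)] with s hs
    rw [chartMetric_coordMap g hs, hc])
  have h7 := h6.unique (hasDerivAt_const 0 c)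
  simp only [hl0, hσ0] at h7
  rw [h1, h2, ← h7]
  have hid : ∀ w : E, coordMap (f x₀) (f x₀) w = w := fun w => by rw [coordMap_self]; rfl
  have h8 : ∀ a b, innerE g (f x₀) a b
      = chartMetric g (f x₀) (extChartAt 𝓘(ℝ, E) (f x₀) (f x₀)) a b := fun a b => by
    have := chartMetric_coordMap g hq a b
    rw [hid, hid] at this
    exact this.symm
  rw [h8, h8]
  simp only [hid]

section Variation

variable {G : M → ℝ → P} {L L' : ℝ → E₀ →L[ℝ] E} {r : ℝ}

theorem HasVariation.hasMFDerivAt (h : HasVariation g G L L' x₀ r)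
    (hq : G x₀ r ∈ (extChartAt 𝓘(ℝ, E) q).source) :
    HasMFDerivAt 𝓘(ℝ, E₀) 𝓘(ℝ, E) (fun x => extChartAt 𝓘(ℝ, E) q (G x r)) x₀
      ((coordMap q (G x₀ r)).comp (L r) : E₀ →L[ℝ] E) ∧
    HasMFDerivAt 𝓘(ℝ, E₀) 𝓘(ℝ, E)
      (fun x => coordMap q (G x r) (velocityE (G x) r : E)) x₀ ((coordMap q (G x₀ r)).comp (L' r)
        - (connForm g q (G x₀) r).comp ((coordMap q (G x₀ r)).comp (L r)) : E₀ →L[ℝ] E) :=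
  ⟨hasMFDerivAt_iff_hasFDerivAt_symm.2
      ((hasMFDerivAt_iff_hasFDerivAt_symm.1 (h.2 q hq)).fst.congr_fderiv (by ext; rfl)),
    hasMFDerivAt_iff_hasFDerivAt_symm.2
      ((hasMFDerivAt_iff_hasFDerivAt_symm.1 (h.2 q hq)).snd.congr_fderiv (by ext; rfl))⟩

theorem HasVariation.mfderivE_eq (h : HasVariation g G L L' x₀ r) :
    mfderivE (fun x => G x r) x₀ = L r := by
  have hq := mem_extChartAt_source (I := 𝓘(ℝ, E)) (G x₀ r)
  ext X
  have := coordMap_mfderiv (f := fun x => G x r) h.1 hq (h.hasMFDerivAt hq).1 X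
  rw [ContinuousLinearMap.comp_apply] at this
  rw [← coordInv_coordMap hq (L r X), ← this, coordInv_coordMap hq]

/-- The interchange `∇_x ∂_r = ∇_r ∂_x`. It rests on the symmetry of `Γ`, by which the correction in
`jacobiState` cancels the Christoffel term of `covAlong`. -/
theorem HasVariation.covAlong_eq (h : HasVariation g G L L' x₀ r) :
    covAlong g (fun x => G x r) (fun x => velocityE (G x) r) x₀ = L' r := by
  have hq := mem_extChartAt_source (I := 𝓘(ℝ, E)) (G x₀ r)
  ext X
  have := coordMap_covAlong g (f := fun x => G x r) (V := fun x => velocityE (G x) r) h.1 hq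
    (h.hasMFDerivAt hq).1 (h.hasMFDerivAt hq).2 X
  rw [← coordInv_coordMap hq (L' r X), ← coordInv_coordMap hq (covAlong g _ _ x₀ X), this]
  congr 1
  simp only [sub_apply, ContinuousLinearMap.comp_apply, connForm, chartState]
  rw [christoffel_symm g ((extChartAt 𝓘(ℝ, E) _).map_source hq)
    (coordMap (G x₀ r) (G x₀ r) (L r X))]
  abel

/-- At time `0` the geodesics have position `f` and velocity `V`, so nothing but smoothness of the
field is needed. This is where the propagation by `HasVariation.of_jacobi` starts. -/
theorem hasVariation_zero [T2Space P]
    (hV : ContMDiffAt 𝓘(ℝ, E₀) 𝓘(ℝ, E).tangent ∞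
      (fun x => (⟨f x, (V x : E)⟩ : TangentBundle 𝓘(ℝ, E) P)) x₀)
    (hL : L 0 = mfderivE f x₀) (hL' : L' 0 = covAlong g f V x₀) :
    HasVariation g (fun x => geodesicCurve g (f x) (V x)) L L' x₀ 0 := by
  obtain ⟨hf, hV⟩ := contMDiffAt_vectorField_iff.1 hV
  have h0 : ∀ x, geodesicCurve g (f x) (V x) 0 = f x := fun x => (geodesicCurve_zero g _ _).1
  have h1 : ∀ x, (velocityE (geodesicCurve g (f x) (V x)) 0 : E) = V x := fun x =>
    (geodesicCurve_zero g _ _).2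
  have hq := mem_extChartAt_source (I := 𝓘(ℝ, E)) (f x₀)
  have hu : HasMFDerivAt 𝓘(ℝ, E₀) 𝓘(ℝ, E) (fun x => extChartAt 𝓘(ℝ, E) (f x₀) (f x)) x₀
      (mfderivE (fun x => extChartAt 𝓘(ℝ, E) (f x₀) (f x)) x₀ : E₀ →L[ℝ] E) :=
    (((contMDiffAt_extChartAt (n := ∞)).comp x₀ hf).mdifferentiableAt (by simp)).hasMFDerivAt
  have hV' : HasMFDerivAt 𝓘(ℝ, E₀) 𝓘(ℝ, E) (fun x => coordMap (f x₀) (f x) (V x)) x₀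
      (mfderivE (fun x => coordMap (f x₀) (f x) (V x)) x₀ : E₀ →L[ℝ] E) :=
    (hV.mdifferentiableAt (by simp)).hasMFDerivAt
  have hst : ∀ x, (chartState (f x₀) (geodesicCurve g (f x) (V x)) 0 : E × E) =
      (extChartAt 𝓘(ℝ, E) (f x₀) (f x), coordMap (f x₀) (f x) (V x)) := fun x => by
    rw [chartState, h0, h1]
  refine hasVariation_of_chart (q := f x₀) (by simpa only [h0] using hf.continuousAt)
    (by rw [h0]; exact hq) (hasMFDerivAt_iff_hasFDerivAt_symm.2 ?_)
  simp only [hst]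
  have e : jacobiState g (f x₀) (geodesicCurve g (f x₀) (V x₀)) L L' 0 =
      (mfderivE (fun x => extChartAt 𝓘(ℝ, E) (f x₀) (f x)) x₀ : E₀ →L[ℝ] E).prod
        (mfderivE (fun x => coordMap (f x₀) (f x) (V x)) x₀ : E₀ →L[ℝ] E) := by
    refine ContinuousLinearMap.ext fun X => ?_
    have e1 := coordMap_mfderiv hf.continuousAt hq hu X
    have e2 := coordMap_covAlong g hf.continuousAt hq hu hV' X
    have e3 : jacobiState g (f x₀) (geodesicCurve g (f x₀) (V x₀)) L L' 0 X =
      (coordMap (f x₀) (f x₀) (L 0 X), coordMap (f x₀) (f x₀) (L' 0 X)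
        - christoffel g (f x₀) (extChartAt 𝓘(ℝ, E) (f x₀) (f x₀))
          (coordMap (f x₀) (f x₀) (V x₀)) (coordMap (f x₀) (f x₀) (L 0 X))) := by
      simp only [jacobiState, ContinuousLinearMap.prod_apply, sub_apply,
        ContinuousLinearMap.comp_apply, connForm, hst, h0]
    rw [e3, hL, hL', e1, e2, christoffel_symm g ((extChartAt 𝓘(ℝ, E) _).map_source hq)
      (coordMap (f x₀) (f x₀) (V x₀))]
    rw [add_sub_cancel_right]
    rfl
  rw [e]
  exact (hasMFDerivAt_iff_hasFDerivAt_symm.1 hu).prodMk (hasMFDerivAt_iff_hasFDerivAt_symm.1 hV')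

end Variation

end NormalVariations

/-! ### Jacobi's formula and the trace of the shape operator -/

noncomputable section Determinants

section LinearAlgebra

variable {E₀ : Type*} [NormedAddCommGroup E₀] [NormedSpace ℝ E₀] [FiniteDimensional ℝ E₀]
  {t : ℝ}

theorem hasDerivAt_of_clm_apply {W : Type*} [NormedAddCommGroup W] [NormedSpace ℝ W]
    {A : ℝ → E₀ →L[ℝ] W} {A' : E₀ →L[ℝ] W}
    (h : ∀ X, HasDerivAt (fun s => A s X) (A' X) t) : HasDerivAt A A' t := by
  let b := Module.finBasis ℝ E₀
  let Φ : (E₀ →L[ℝ] ℝ) → W →L[ℝ] E₀ →L[ℝ] W := ContinuousLinearMap.smulRightL ℝ E₀ W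
  have key : ∀ B : E₀ →L[ℝ] W,
      B = ∑ i, Φ (LinearMap.toContinuousLinearMap (b.coord i)) (B (b i)) := by
    intro B
    ext w
    conv_lhs => rw [← b.sum_repr w, map_sum]
    rw [sum_apply]
    exact Finset.sum_congr rfl fun i _ => map_smul _ _ _
  rw [key A', show A = fun s => ∑ i, Φ (LinearMap.toContinuousLinearMap (b.coord i)) (A s (b i))
    from funext fun s => key (A s)]
  exact HasDerivAt.fun_sum fun i _ => (ContinuousLinearMap.hasFDerivAt _).comp_hasDerivAt t (h (b i))

/-- The determinant is polynomial in the entries, hence differentiable, and its derivative at the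
identity can be computed along the line `1 + r m'`, where it is `1 + r tr m' + O(r²)`. -/
theorem hasDerivAt_matrix_det {ι : Type*} [Fintype ι] [DecidableEq ι] {m : ℝ → ι → ι → ℝ}
    {m' : ι → ι → ℝ} (hm : HasDerivAt m m' t) (h1 : Matrix.of (m t) = 1) :
    HasDerivAt (fun s => (Matrix.of (m s)).det) (Matrix.of m').trace t := by
  have hdiff : Differentiable ℝ fun a : ι → ι → ℝ => (Matrix.of a).det := by
    simp only [Matrix.det_apply, Matrix.of_apply]
    fun_prop
  obtain ⟨F, hFdef⟩ : ∃ F : (ι → ι → ℝ) → ℝ, F = fun a => (Matrix.of a).det := ⟨_, rfl⟩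
  rw [← hFdef] at hdiff
  have hline : HasDerivAt (fun r : ℝ => m t + r • m') m' 0 := by
    simpa using ((hasDerivAt_id (0 : ℝ)).smul_const m').const_add (m t)
  have h0 : m t + (0 : ℝ) • m' = m t := by simp
  have hF := (hdiff (m t)).hasFDerivAt
  have hcurve := hF.comp_hasDerivAt t hm
  rw [← h0] at hF
  have h2 := hF.comp_hasDerivAt (0 : ℝ) hline
  rw [h0] at h2
  rw [hFdef] at hcurve h2
  refine HasDerivAt.congr_deriv (f := fun s => (Matrix.of (m s)).det) hcurve ?_
  have h3 : HasDerivAt (fun r : ℝ => (Matrix.of (m t + r • m')).det) (Matrix.of m').trace 0 := by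
    have e : (fun r : ℝ => (Matrix.of (m t + r • m')).det) = fun r : ℝ =>
        1 + (Matrix.of m').trace * r + (Matrix.det (1 + (Polynomial.X : Polynomial ℝ) •
          (Matrix.of m').map Polynomial.C)).divX.divX.eval r * r ^ 2 := by
      funext r
      rw [← Matrix.det_one_add_smul, ← h1]
      rfl
    rw [e]
    have := (((hasDerivAt_id (0 : ℝ)).const_mul (Matrix.of m').trace).const_add 1).add
      (((Matrix.det (1 + (Polynomial.X : Polynomial ℝ) •
          (Matrix.of m').map Polynomial.C)).divX.divX.hasDerivAt 0).mul (hasDerivAt_pow 2 (0 : ℝ)))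
    exact HasDerivAt.congr_deriv this (by simp)
  exact h2.unique h3

/-- Jacobi's formula for the derivative of the determinant. -/
theorem hasDerivAt_det {A : ℝ → E₀ →L[ℝ] E₀} {A' B : E₀ →L[ℝ] E₀} (hA : HasDerivAt A A' t)
    (hdet : LinearMap.det (A t : E₀ →ₗ[ℝ] E₀) ≠ 0) (hB : (A t).comp B = A') :
    HasDerivAt (fun s => LinearMap.det (A s : E₀ →ₗ[ℝ] E₀))
      (LinearMap.det (A t : E₀ →ₗ[ℝ] E₀) * LinearMap.trace ℝ E₀ B) t := by
  let b := Module.finBasis ℝ E₀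
  let e : E₀ ≃ₗ[ℝ] E₀ := LinearMap.equivOfDetNeZero _ hdet
  have he : ∀ X, e X = A t X := fun X => rfl
  -- Composition with `A(t)⁻¹` reduces to a curve through the identity, at the cost of the factor
  -- `det A(t)`.
  let ec : E₀ →L[ℝ] E₀ := LinearMap.toContinuousLinearMap (e.symm : E₀ →ₗ[ℝ] E₀)
  have hec : ∀ X, ec (A t X) = X := fun X => by
    rw [← he]
    exact e.symm_apply_apply X
  have hec' : ∀ X, A t (ec X) = X := fun X => by
    rw [← he]
    exact e.apply_symm_apply X
  let m : ℝ → Fin (Module.finrank ℝ E₀) → Fin (Module.finrank ℝ E₀) → ℝ :=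
    fun s i j => b.repr (ec (A s (b j))) i
  have hmat : ∀ s, Matrix.of (m s) = LinearMap.toMatrix b b (ec.comp (A s) : E₀ →ₗ[ℝ] E₀) := by
    intro s
    ext i j
    rw [LinearMap.toMatrix_apply]
    rfl
  have hm : HasDerivAt m (fun i j => b.repr (ec (A' (b j))) i) t := by
    rw [hasDerivAt_pi]
    intro i
    rw [hasDerivAt_pi]
    intro j
    have h1 : HasDerivAt (fun s => ec (A s (b j))) (ec (A' (b j))) t := by
      have h2 : HasDerivAt (fun s => A s (b j)) (A' (b j)) t := by
        simpa using hA.clm_apply (hasDerivAt_const t (b j))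
      exact ec.hasFDerivAt.comp_hasDerivAt t h2
    exact (LinearMap.toContinuousLinearMap (b.coord i)).hasFDerivAt.comp_hasDerivAt t h1
  have hone : Matrix.of (m t) = 1 := by
    rw [hmat, ← LinearMap.toMatrix_id b]
    congr 1
    ext X
    exact hec X
  have h := (hasDerivAt_matrix_det hm hone).const_mul (LinearMap.det (A t : E₀ →ₗ[ℝ] E₀))
  refine (h.congr_of_eventuallyEq (Filter.Eventually.of_forall fun s => ?_)).congr_deriv ?_
  · simp only
    rw [hmat, LinearMap.det_toMatrix, ← LinearMap.det_comp]
    congr 1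
    ext X
    exact (hec' _).symm
  · congr 1
    rw [LinearMap.trace_eq_matrix_trace ℝ b]
    congr 1
    ext i j
    rw [LinearMap.toMatrix_apply, ← hB]
    simp only [Matrix.of_apply, ContinuousLinearMap.comp_apply, hec]
    rfl

end LinearAlgebra

section NormalFields

variable {E₀ : Type*} [NormedAddCommGroup E₀] [NormedSpace ℝ E₀]
  {E : Type*} [NormedAddCommGroup E] [NormedSpace ℝ E] [FiniteDimensional ℝ E]
  {P : Type*} [TopologicalSpace P] [ChartedSpace E P] [IsManifold 𝓘(ℝ, E) ∞ P]
  {g : SmoothMetric E P} {γ : ℝ → P} {J : Set ℝ} {r : ℝ} {L : ℝ → E₀ →L[ℝ] E}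

/-- Count of dimensions: an injective image of `E₀` inside the hyperplane `v^⊥` fills it. -/
theorem range_eq_normalSpace (hdim : Module.finrank ℝ E = Module.finrank ℝ E₀ + 1) {x : P}
    {v : E} (hv : innerE g x v v = 1) {A : E₀ →L[ℝ] E} (hA : Function.Injective A)
    (hAv : ∀ X, innerE g x v (A X) = 0) {w : E} (hw : innerE g x v w = 0) : ∃ X, A X = w := by
  have hle : LinearMap.range (A : E₀ →ₗ[ℝ] E) ≤ LinearMap.ker (innerE g x v : E →ₗ[ℝ] ℝ) := by
    rintro _ ⟨X, rfl⟩
    exact hAv X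
  have hsurj : LinearMap.range (innerE g x v : E →ₗ[ℝ] ℝ) = ⊤ := by
    rw [LinearMap.range_eq_top]
    intro c
    refine ⟨c • v, ?_⟩
    change innerE g x v (c • v) = c
    rw [map_smul, hv, smul_eq_mul, mul_one]
  have h1 := LinearMap.finrank_range_add_finrank_ker (innerE g x v : E →ₗ[ℝ] ℝ)
  rw [hsurj, finrank_top, Module.finrank_self] at h1
  have h2 := LinearMap.finrank_range_of_inj (f := (A : E₀ →ₗ[ℝ] E)) hA
  have h3 := Submodule.eq_of_le_of_finrank_eq hle (by omega)
  have h4 : w ∈ LinearMap.range (A : E₀ →ₗ[ℝ] E) := by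
    rw [h3]
    exact hw
  exact h4

/-- Parallel transport keeps a frame of the orthogonal complement of the velocity. -/
theorem parallel_frame (hγ : IsGeodesicOn g γ J) (hJ : J.OrdConnected) {s₀ : ℝ} (hs₀ : s₀ ∈ J)
    (hL : ∀ s ∈ J, HasCovHom g γ L 0 s) (hinj : Function.Injective (L s₀))
    (hn : ∀ X, innerE g (γ s₀) (velocityE γ s₀) (L s₀ X) = 0) {s : ℝ} (hs : s ∈ J) :
    (∀ X Y, innerE g (γ s) (L s X) (L s Y) = innerE g (γ s₀) (L s₀ X) (L s₀ Y)) ∧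
      (∀ X, innerE g (γ s) (velocityE γ s) (L s X) = 0) ∧ Function.Injective (L s) := by
  have hconst : ∀ F : ℝ → ℝ, (∀ s ∈ J, HasDerivAt F 0 s) → F s = F s₀ := fun F hF =>
    hγ.1.is_const_of_deriv_eq_zero hJ.isPreconnected
      (fun r hr => (hF r hr).differentiableAt.differentiableWithinAt)
      (fun r hr => (hF r hr).deriv) hs hs₀
  have h1 : ∀ X Y, innerE g (γ s) (L s X) (L s Y) = innerE g (γ s₀) (L s₀ X) (L s₀ Y) :=
    fun X Y => hconst (fun s => innerE g (γ s) (L s X) (L s Y)) fun r hr => by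
      simpa using (hL r hr).hasDerivAt_innerE hγ hr (hL r hr) X Y
  refine ⟨h1, fun X => ?_, ?_⟩
  · rw [← hn X]
    exact hconst (fun s => innerE g (γ s) (velocityE γ s) (L s X)) fun r hr => by
      simpa using (hL r hr).hasDerivAt_innerE_velocityE hγ hr X
  · rw [injective_iff_map_eq_zero]
    intro X hX
    have h2 := h1 X X
    rw [hX, map_zero] at h2
    by_contra hX0
    have h3 : L s₀ X ≠ 0 := fun h => hX0 (hinj (by rw [h, map_zero]))
    exact (innerE_pos g (γ s₀) h3).ne h2

/-- The determinant of a tensor of `γ'^⊥`, its derivative, and the trace of the shape operators of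
the corresponding variation. -/
theorem NormalEndField.trace_eq [FiniteDimensional ℝ E₀] (D : NormalEndField g γ) {D₁ : ℝ → E →L[ℝ] E}
    (hdim : Module.finrank ℝ E = Module.finrank ℝ E₀ + 1)
    (hγ : IsGeodesicOn g γ J) (hJ : J.OrdConnected) {s₀ : ℝ} (hs₀ : s₀ ∈ J)
    (hunit : ∀ s ∈ J, innerE g (γ s) (velocityE γ s) (velocityE γ s) = 1)
    (hD : ∀ s ∈ J, HasCovEnd g γ D.toE (D₁ s) s)
    (hL : ∀ s ∈ J, HasCovHom g γ L 0 s) (hinj : Function.Injective (L s₀))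
    (hn : ∀ X, innerE g (γ s₀) (velocityE γ s₀) (L s₀ X) = 0) (hr : r ∈ J)
    (hDL : Function.Injective ((D.toE r).comp (L r))) :
    D.det r ≠ 0 ∧ DifferentiableAt ℝ D.det r ∧
      LinearMap.trace ℝ E₀ (((D.toE r).comp (L r) : E₀ →ₗ[ℝ] E).leftInverse ∘ₗ
        (-((D₁ r).comp (L r)) : E₀ →L[ℝ] E).toLinearMap) = -(deriv D.det r / D.det r) := by
  have hfr := fun s (hs : s ∈ J) => parallel_frame hγ hJ hs₀ hL hinj hn hs
  -- the metric on `E₀` for which the frame is isometric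
  let h : E₀ →L[ℝ] E₀ →L[ℝ] ℝ := (innerE g (γ s₀)).bilinearComp (L s₀) (L s₀)
  have hh : ∀ s ∈ J, ∀ X Y, innerE g (γ s) (L s X) (L s Y) = h X Y := fun s hs => (hfr s hs).1
  have hhinj : Function.Injective h := by
    rw [injective_iff_map_eq_zero]
    intro X hX
    by_contra hX0
    have h3 : L s₀ X ≠ 0 := fun h => hX0 (hinj (by rw [h, map_zero]))
    refine (innerE_pos g (γ s₀) h3).ne ?_
    have := DFunLike.congr_fun hX X
    exact this.symm
  let he : E₀ ≃L[ℝ] (E₀ →L[ℝ] ℝ) :=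
    (LinearEquiv.ofInjectiveOfFinrankEq h.toLinearMap hhinj (by
      rw [← (LinearMap.toContinuousLinearMap : (E₀ →ₗ[ℝ] ℝ) ≃ₗ[ℝ] (E₀ →L[ℝ] ℝ)).finrank_eq]
      exact (Subspace.dual_finrank_eq (K := ℝ) (V := E₀)).symm)).toContinuousLinearEquiv
  have hhe : ∀ l Y, h (he.symm l) Y = l Y := fun l Y =>
    DFunLike.congr_fun (he.apply_symm_apply l) Y
  -- A normal vector is determined by its scalar products with the frame `L s`. Coordinates in the
  -- frame are thus read off by pairing, and `L s` need not be inverted and differentiated.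
  have huniq : ∀ s ∈ J, ∀ z w, innerE g (γ s) (velocityE γ s) w = 0 →
      (∀ Y, h z Y = innerE g (γ s) w (L s Y)) → L s z = w := by
    intro s hs z w hw hz
    obtain ⟨X, rfl⟩ := range_eq_normalSpace hdim (hunit s hs) (hfr s hs).2.2 (hfr s hs).2.1 hw
    have : z = X := hhinj (by
      ext Y
      rw [hz, hh s hs])
    rw [this]
  have hnor : ∀ s ∈ J, ∀ X, innerE g (γ s) (velocityE γ s) (D.toE s (L s X)) = 0 := fun s hs X =>
    D.map_normal s (L s X) ((hfr s hs).2.1 X)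
  have hDLc : ∀ s ∈ J, HasCovHom g γ (fun s => (D.toE s).comp (L s)) ((D₁ s).comp (L s)) s := by
    intro s hs
    have := (hL s hs).comp hγ hs (hD s hs)
    rwa [ContinuousLinearMap.comp_zero, add_zero] at this
  -- `D'` is normal on the frame as well: the scalar product of `γ'` with `D L X` is identically
  -- zero and `γ'` is parallel.
  have hnor' : ∀ s ∈ J, ∀ X, innerE g (γ s) (velocityE γ s) (D₁ s (L s X)) = 0 := by
    intro s hs X
    have h1 := (hDLc s hs).hasDerivAt_innerE_velocityE hγ hs X
    refine h1.unique ((hasDerivAt_const s (0 : ℝ)).congr_of_eventuallyEq ?_)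
    filter_upwards [hγ.1.mem_nhds hs] with c hc
    exact hnor c hc X
  -- `b` holds the coefficients of `D` in the parallel frame. Raising an index with the constant
  -- metric `h` gives `d = L⁻¹ D L`, a curve of endomorphisms of the fixed space `E₀` with `d' = L⁻¹
  -- D' L`.
  let b : ℝ → E₀ →L[ℝ] E₀ →L[ℝ] ℝ := fun s =>
    (innerE g (γ s)).bilinearComp ((D.toE s).comp (L s)) (L s)
  let b' : ℝ → E₀ →L[ℝ] E₀ →L[ℝ] ℝ := fun s =>
    (innerE g (γ s)).bilinearComp ((D₁ s).comp (L s)) (L s)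
  have hb : ∀ s ∈ J, HasDerivAt b (b' s) s := fun s hs =>
    hasDerivAt_of_clm_apply fun X => hasDerivAt_of_clm_apply fun Y => by
      have := (hDLc s hs).hasDerivAt_innerE hγ hs (hL s hs) X Y
      rw [zero_apply, map_zero, add_zero] at this
      exact this
  let c : (E₀ →L[ℝ] ℝ) →L[ℝ] E₀ := he.symm
  let d : ℝ → E₀ →L[ℝ] E₀ := fun s => c.comp (b s)
  let d' : ℝ → E₀ →L[ℝ] E₀ := fun s => c.comp (b' s)
  have hd : HasDerivAt d (d' r) r := by
    have := (hasDerivAt_const r c).clm_comp (hb r hr)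
    rwa [ContinuousLinearMap.zero_comp, zero_add] at this
  have hLd : ∀ s ∈ J, ∀ X, L s (d s X) = D.toE s (L s X) := fun s hs X =>
    huniq s hs _ _ (hnor s hs X) fun Y => hhe (b s X) Y
  have hLd' : ∀ s ∈ J, ∀ X, L s (d' s X) = D₁ s (L s X) := fun s hs X =>
    huniq s hs _ _ (hnor' s hs X) fun Y => hhe (b' s X) Y
  have hdet : ∀ s ∈ J, D.det s = LinearMap.det (d s : E₀ →ₗ[ℝ] E₀) := by
    intro s hs
    let e : E₀ ≃ₗ[ℝ] normalSpace g γ s := LinearEquiv.ofBijective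
      ((L s : E₀ →ₗ[ℝ] E).codRestrict (normalSpace g γ s) (hfr s hs).2.1)
      ⟨fun X Y hXY => (hfr s hs).2.2 (congrArg Subtype.val hXY), fun w => by
        obtain ⟨X, hX⟩ := range_eq_normalSpace hdim (hunit s hs) (hfr s hs).2.2 (hfr s hs).2.1
          (w := w.1) w.2
        exact ⟨X, Subtype.ext hX⟩⟩
    rw [NormalEndField.det, ← LinearMap.det_conj (d s : E₀ →ₗ[ℝ] E₀) e]
    congr 1
    refine LinearMap.ext fun w => Subtype.ext ?_
    obtain ⟨X, rfl⟩ := e.surjective w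
    have h2 : ((e (d s (e.symm (e X)))).1 : E) = D.toE s (e X).1 := by
      rw [e.symm_apply_apply]
      exact hLd s hs X
    exact h2.symm
  have hdinj : Function.Injective (d r) := fun X Y hXY => hDL (by
    rw [ContinuousLinearMap.comp_apply, ContinuousLinearMap.comp_apply, ← hLd r hr, hXY,
      hLd r hr])
  have hdet0 : LinearMap.det (d r : E₀ →ₗ[ℝ] E₀) ≠ 0 := by
    rw [← isUnit_iff_ne_zero, ← LinearMap.isUnit_iff_isUnit_det, LinearMap.isUnit_iff_ker_eq_bot,
      LinearMap.ker_eq_bot]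
    exact hdinj
  let ed : E₀ ≃ₗ[ℝ] E₀ := LinearMap.equivOfDetNeZero _ hdet0
  let B : E₀ →L[ℝ] E₀ := (LinearMap.toContinuousLinearMap (ed.symm : E₀ →ₗ[ℝ] E₀)).comp (d' r)
  have hdB : ∀ X, d r (B X) = d' r X := fun X => ed.apply_symm_apply (d' r X)
  have hder := hasDerivAt_det hd hdet0 (B := B) (ContinuousLinearMap.ext hdB)
  have hder' := hder.congr_of_eventuallyEq (f₁ := D.det) (by
    filter_upwards [hγ.1.mem_nhds hr] with s hs
    exact hdet s hs)
  refine ⟨by rwa [hdet r hr], hder'.differentiableAt, ?_⟩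
  rw [hder'.deriv, hdet r hr, mul_div_cancel_left₀ _ hdet0, ← map_neg]
  congr 1
  refine LinearMap.ext fun X => ?_
  -- With `B = d⁻¹ d'` one has `D' L = D L B`, so the left inverse of the injective map `D L` turns
  -- `-D' L` into `-B`.
  have h1 : (-((D₁ r).comp (L r)) : E₀ →L[ℝ] E) X = ((D.toE r).comp (L r)) (-(B X)) := by
    rw [map_neg, neg_apply, ContinuousLinearMap.comp_apply, ContinuousLinearMap.comp_apply,
      ← hLd' r hr, ← hdB, hLd r hr]
  have h2 := LinearMap.leftInverse_apply_of_inj (f := ((D.toE r).comp (L r) : E₀ →ₗ[ℝ] E))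
    (LinearMap.ker_eq_bot.2 hDL) (-(B X))
  exact (congrArg _ h1).trans h2

end NormalFields

end Determinants

/-! ### Parallel hypersurfaces: differential, Gauss lemma, mean curvature -/

noncomputable section ParallelHypersurfaces

variable {n : ℕ}
  {P : Type*} [TopologicalSpace P] [ChartedSpace (EuclideanSpace ℝ (Fin (n + 1))) P]
  [IsManifold (𝓡 (n + 1)) ∞ P]
  {M : Type*} {g : SmoothMetric (EuclideanSpace ℝ (Fin (n + 1))) P} {f : M → P}
  {N : ∀ x, TangentSpace (𝓡 (n + 1)) (f x)}

local notation "E₀" => EuclideanSpace ℝ (Fin n)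
local notation "E₁" => EuclideanSpace ℝ (Fin (n + 1))

/-- A vector field along `f` in the model space. -/
def normalE (N : ∀ x, TangentSpace (𝓡 (n + 1)) (f x)) (x : M) : E₁ := N x

/-- The shape operator in the model space. -/
def shapeE [TopologicalSpace M] [ChartedSpace E₀ M] (g : SmoothMetric E₁ P) (f : M → P) (N : ∀ x, TangentSpace (𝓡 (n + 1)) (f x)) (x : M) :
    E₀ →ₗ[ℝ] E₀ := shapeOperator g f N x

section Geodesics

variable [T2Space P]

theorem isGeodesicOn_normalGeodesic (x : M) :
    IsGeodesicOn g (normalGeodesic g f N x) (normalDomain g f N x) :=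
  isGeodesicOn_geodesicCurve g (f x) (normalE N x)

theorem ordConnected_normalDomain (x : M) : (normalDomain g f N x).OrdConnected :=
  ordConnected_geodesicDomain g (f x) (normalE N x)

theorem zero_mem_normalDomain (x : M) : (0 : ℝ) ∈ normalDomain g f N x :=
  zero_mem_geodesicDomain g (f x) (normalE N x)

theorem normalGeodesic_zero (x : M) : normalGeodesic g f N x 0 = f x :=
  (geodesicCurve_zero g (f x) (normalE N x)).1

theorem velocityE_normalGeodesic_zero (x : M) :
    (velocityE (normalGeodesic g f N x) 0 : E₁) = normalE N x :=
  (geodesicCurve_zero g (f x) (normalE N x)).2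

end Geodesics

variable [TopologicalSpace M] [ChartedSpace (EuclideanSpace ℝ (Fin n)) M]

theorem finrank_eq_finrank_add_one : Module.finrank ℝ E₁ = Module.finrank ℝ E₀ + 1 := by
  simp

theorem IsUnitNormal.innerE_self (hN : IsUnitNormal g f N) (x : M) :
    innerE g (f x) (normalE N x) (normalE N x) = 1 := (hN.2 x).1

theorem IsUnitNormal.innerE_mfderivE (hN : IsUnitNormal g f N) (x : M) (X : E₀) :
    innerE g (f x) (normalE N x) (mfderivE f x X) = 0 := (hN.2 x).2 X

theorem IsHypersurface.injective_mfderivE (hf : IsHypersurface n f) (x : M) :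
    Function.Injective (mfderivE f x : E₀ →L[ℝ] E₁) := hf.2 x

theorem IsUnitNormal.hasMFDerivAt (hN : IsUnitNormal g f N) (x : M) :
    HasMFDerivAt 𝓘(ℝ, E₀) 𝓘(ℝ, E₁) (fun y => extChartAt 𝓘(ℝ, E₁) (f x) (f y)) x
        (mfderivE (fun y => extChartAt 𝓘(ℝ, E₁) (f x) (f y)) x : E₀ →L[ℝ] E₁) ∧
      HasMFDerivAt 𝓘(ℝ, E₀) 𝓘(ℝ, E₁) (fun y => coordMap (f x) (f y) (normalE N y)) x
        (mfderivE (fun y => coordMap (f x) (f y) (normalE N y)) x : E₀ →L[ℝ] E₁) := by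
  obtain ⟨hf, hV⟩ := contMDiffAt_vectorField_iff.1 (hN.1 x)
  exact ⟨(((contMDiffAt_extChartAt (n := ∞)).comp x hf).mdifferentiableAt (by simp)).hasMFDerivAt,
    (hV.mdifferentiableAt (by simp)).hasMFDerivAt⟩

/-- The defining property of the shape operator. -/
theorem IsUnitNormal.mfderivE_shapeOperator (hf : IsHypersurface n f) (hN : IsUnitNormal g f N)
    (x : M) (X : E₀) :
    mfderivE f x (shapeE g f N x X) = -covAlong g f (normalE N) x X := by
  obtain ⟨hu, hV⟩ := hN.hasMFDerivAt x
  -- Constant length makes `∇_X N` orthogonal to `N`, hence tangent to the hypersurface. The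
  -- algebraic left inverse in `shapeOperator` then really inverts `df`.
  have hnor : innerE g (f x) (normalE N x) (-covAlong g f (normalE N) x X) = 0 := by
    have := innerE_covAlong_add (g := g) (V := normalE N) (V₁ := normalE N)
      (hf.1 x).continuousAt hu hV hV hN.innerE_self X
    rw [innerE_symm g (f x) (covAlong g f (normalE N) x X)] at this
    rw [map_neg]
    linarith
  obtain ⟨Y, hY⟩ := range_eq_normalSpace finrank_eq_finrank_add_one (hN.innerE_self x)
    (hf.injective_mfderivE x) (hN.innerE_mfderivE x) hnor
  have h1 : (shapeE g f N x X) = Y := by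
    have h2 : (shapeE g f N x X) = (mfderivE f x : E₀ →L[ℝ] E₁).toLinearMap.leftInverse
      (-covAlong g f (normalE N) x X) := rfl
    rw [h2, ← hY]
    exact LinearMap.leftInverse_apply_of_inj (LinearMap.ker_eq_bot.2 (hf.injective_mfderivE x)) Y
  rw [h1, hY]

variable [T2Space P]

theorem IsUnitNormal.innerE_velocityE (hN : IsUnitNormal g f N) {x : M} {r : ℝ}
    (hr : r ∈ normalDomain g f N x) :
    innerE g (normalGeodesic g f N x r) (velocityE (normalGeodesic g f N x) r : E₁)
      (velocityE (normalGeodesic g f N x) r) = 1 := by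
  rw [(isGeodesicOn_normalGeodesic x).innerE_velocityE (ordConnected_normalDomain x) hr
    (zero_mem_normalDomain x), velocityE_normalGeodesic_zero, normalGeodesic_zero]
  exact hN.innerE_self x

theorem exists_isJacobiTensor (hf : IsHypersurface n f) (hN : IsUnitNormal g f N) (x : M) :
    ∃ D : NormalEndField g (normalGeodesic g f N x), IsJacobiTensor g f N x D := by
  have hγ := isGeodesicOn_normalGeodesic (g := g) (f := f) (N := N) x
  -- `-df ∘ A_N ∘ df⁻¹` on the tangent hyperplane, extended by the left inverse. The value in the
  -- normal direction is arbitrary, since the projections in `exists_normalEndField` remove it.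
  let A₁ : E₁ →L[ℝ] E₁ := LinearMap.toContinuousLinearMap
    (-((mfderivE f x : E₀ →L[ℝ] E₁).toLinearMap ∘ₗ shapeE g f N x ∘ₗ
      (mfderivE f x : E₀ →L[ℝ] E₁).toLinearMap.leftInverse))
  obtain ⟨D, D₀, D₁, hDD, hD0, hD1, hcov, hC2⟩ := exists_normalEndField hγ
    (ordConnected_normalDomain x) (zero_mem_normalDomain x)
    (fun s hs => hN.innerE_velocityE hs) A₁
  have hce : ∀ r ∈ normalDomain g f N x, covEnd g (normalGeodesic g f N x) D.toE r = D₁ r := by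
    intro r hr
    rw [hDD]
    exact (hcov r hr).1.covEnd hγ hr
  have hnor : ∀ X : E₀, innerE g (normalGeodesic g f N x 0)
      (velocityE (normalGeodesic g f N x) 0 : E₁) (mfderivE f x X) = 0 := by
    intro X
    rw [velocityE_normalGeodesic_zero, normalGeodesic_zero]
    exact hN.innerE_mfderivE x X
  refine ⟨D, fun r hr => ?_, fun r hr (v : E₁) _ => ?_, fun v hv => ?_, fun (X : E₀) => ?_⟩
  · refine (hC2 r hr).congr_of_eventuallyEq ?_
    filter_upwards [eventually_mem_source (hγ.continuousAt hr)
      (mem_extChartAt_source (I := 𝓘(ℝ, E₁)) (normalGeodesic g f N x r))] with s hs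
    rw [← hDD]
    exact endInChart_eq hs _
  · have h1 : HasCovEnd g (normalGeodesic g f N x) (covEnd g (normalGeodesic g f N x) D.toE) _ r :=
      (hcov r hr).2.congr_of_eventuallyEq (by
        filter_upwards [hγ.1.mem_nhds hr] with s hs
        exact hce s hs)
    have h2 := DFunLike.congr_fun (h1.covEnd hγ hr) v
    have h3 : covEnd g (normalGeodesic g f N x) (covEnd g (normalGeodesic g f N x) D.toE) r v
      + jacobiOp g (normalGeodesic g f N x r) (velocityE (normalGeodesic g f N x) r)
        (D.toE r v) = 0 := by
      rw [h2, hDD]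
      simp
    exact h3
  · have h1 : D.toE 0 (v : E₁) = v := by
      rw [hDD, hD0]
      exact normalProj_of_innerE_eq_zero hv
    exact h1
  · have h1 : covEnd g (normalGeodesic g f N x) D.toE 0 (mfderivE f x X) =
        -mfderivE f x (shapeE g f N x X) := by
      rw [hce 0 (zero_mem_normalDomain x), hD1]
      have h2 : A₁ (mfderivE f x X) = -mfderivE f x (shapeE g f N x X) := by
        have h3 := LinearMap.leftInverse_apply_of_inj
          (LinearMap.ker_eq_bot.2 (hf.injective_mfderivE x)) X
        have h4 : A₁ (mfderivE f x X) = -mfderivE f x (shapeE g f N x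
          ((mfderivE f x : E₀ →L[ℝ] E₁).toLinearMap.leftInverse (mfderivE f x X))) := rfl
        rw [h4]
        exact congrArg (fun Y => -mfderivE f x (shapeE g f N x Y)) h3
      rw [ContinuousLinearMap.comp_apply, ContinuousLinearMap.comp_apply,
        normalProj_of_innerE_eq_zero (hnor X), h2, ← map_neg]
      exact normalProj_of_innerE_eq_zero (hnor _)
    exact h1

/-- The parallel displacement `Φ_r` of a hypersurface in terms of a Jacobi tensor. -/
theorem IsJacobiTensor.exists_hasVariation (hf : IsHypersurface n f) (hN : IsUnitNormal g f N)
    {x : M} {D : NormalEndField g (normalGeodesic g f N x)} (hD : IsJacobiTensor g f N x D) :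
    ∃ L : ℝ → E₀ →L[ℝ] E₁, (∀ s ∈ normalDomain g f N x,
        HasCovHom g (normalGeodesic g f N x) L 0 s) ∧ Function.Injective (L 0) ∧
      (∀ X, innerE g (normalGeodesic g f N x 0) (velocityE (normalGeodesic g f N x) 0 : E₁)
        (L 0 X) = 0) ∧
      (∀ s ∈ normalDomain g f N x, HasCovEnd g (normalGeodesic g f N x) D.toE
        (covEnd g (normalGeodesic g f N x) D.toE s) s) ∧
      ∀ r, (∀ y, r ∈ normalDomain g f N y) → HasVariation g (normalGeodesic g f N)
        (fun s => (D.toE s).comp (L s))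
        (fun s => (covEnd g (normalGeodesic g f N x) D.toE s).comp (L s)) x r := by
  have hγ := isGeodesicOn_normalGeodesic (g := g) (f := f) (N := N) x
  obtain ⟨L, hL0, hL⟩ := exists_parallel hγ (ordConnected_normalDomain x)
    (zero_mem_normalDomain x) (mfderivE f x : E₀ →L[ℝ] E₁)
  have hnor : ∀ X : E₀, innerE g (normalGeodesic g f N x 0)
      (velocityE (normalGeodesic g f N x) 0 : E₁) (L 0 X) = 0 := by
    intro X
    rw [velocityE_normalGeodesic_zero, normalGeodesic_zero, hL0]
    exact hN.innerE_mfderivE x X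
  have hcov := fun t (ht : t ∈ normalDomain g f N x) => D.hasCovEnd hγ
    (fun s hs => hN.innerE_velocityE hs) hD.contDiffAt hD.jacobi ht
  refine ⟨L, hL, hL0 ▸ hf.injective_mfderivE x, hnor, fun s hs => (hcov s hs).1,
    fun r hr => ?_⟩
  -- `D L` and `D' L` satisfy the Jacobi equation because `L` is parallel. At time `0` they equal
  -- `df` and `∇N`, by the two initial conditions on `D`.
  refine HasVariation.of_jacobi (J := normalDomain g f N)
    (fun y => isGeodesicOn_normalGeodesic y) (fun y => ordConnected_normalDomain y)
    (fun s hs => ?_) (fun y => zero_mem_normalDomain y) hr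
    (hasVariation_zero (hN.1 x) ?_ ?_)
  · have h1 := (hL s hs).comp hγ hs (hcov s hs).1
    have h2 := (hL s hs).comp hγ hs (hcov s hs).2
    rw [ContinuousLinearMap.comp_zero, add_zero] at h1 h2
    exact ⟨h1, h2⟩
  · rw [← hL0]
    exact ContinuousLinearMap.ext fun X => hD.initial (L 0 X) (hnor X)
  · refine ContinuousLinearMap.ext fun X => ?_
    have h1 : covEnd g (normalGeodesic g f N x) D.toE 0 (mfderivE f x X) =
        -mfderivE f x (shapeE g f N x X) := hD.initial_deriv X
    rw [ContinuousLinearMap.comp_apply, hL0, h1, hN.mfderivE_shapeOperator hf, neg_neg]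
    rfl

/-- The differential of the displacement is `D L` and the derivative of its normal is `D' L`.
Injectivity of `D L`, that is, the immersion property at `x`, is what makes `det D` nonzero. -/
theorem IsJacobiTensor.meanCurvature_eq (hf : IsHypersurface n f) (hN : IsUnitNormal g f N)
    {x : M} {D : NormalEndField g (normalGeodesic g f N x)} (hD : IsJacobiTensor g f N x D)
    {r : ℝ} (hr : ∀ y, r ∈ normalDomain g f N y)
    (hinj : Function.Injective (mfderivE (fun y => normalGeodesic g f N y r) x : E₀ →L[ℝ] E₁)) :
    D.det r ≠ 0 ∧ DifferentiableAt ℝ D.det r ∧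
      meanCurvature g (fun y => normalGeodesic g f N y r)
        (fun y => velocity (normalGeodesic g f N y) r) x = jacobiMeanCurvature D r := by
  obtain ⟨L, hL, hL0, hn, hcov, hvar⟩ := hD.exists_hasVariation hf hN
  have hv := hvar r hr
  have h1 := hv.mfderivE_eq
  have h2 := hv.covAlong_eq
  rw [h1] at hinj
  obtain ⟨h3, h4, h5⟩ := D.trace_eq finrank_eq_finrank_add_one (isGeodesicOn_normalGeodesic x)
    (ordConnected_normalDomain x) (zero_mem_normalDomain x) (fun s hs => hN.innerE_velocityE hs)
    hcov hL hL0 hn (hr x) hinj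
  refine ⟨h3, h4, ?_⟩
  rw [← h1, ← h2] at h5
  have h6 : meanCurvature g (fun y => normalGeodesic g f N y r)
      (fun y => velocity (normalGeodesic g f N y) r) x = -(deriv D.det r / D.det r) / n :=
    congrArg (· / (n : ℝ)) h5
  rw [h6, jacobiMeanCurvature, neg_div, div_div, mul_comm]

/-- The Gauss lemma for normal geodesics: the differential is `D L`, the frame `L` stays normal to
`γ'`, and `D` preserves `γ'^⊥`. -/
theorem innerE_velocityE_mfderivE (hf : IsHypersurface n f) (hN : IsUnitNormal g f N) {r : ℝ}
    (hr : ∀ y, r ∈ normalDomain g f N y) (x : M) (X : E₀) :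
    innerE g (normalGeodesic g f N x r) (velocityE (normalGeodesic g f N x) r : E₁)
      (mfderivE (fun y => normalGeodesic g f N y r) x X) = 0 := by
  obtain ⟨D, hD⟩ := exists_isJacobiTensor hf hN x
  obtain ⟨L, hL, hL0, hn, hcov, hvar⟩ := hD.exists_hasVariation hf hN
  rw [(hvar r hr).mfderivE_eq]
  exact D.map_normal r (L r X) ((parallel_frame (isGeodesicOn_normalGeodesic x)
    (ordConnected_normalDomain x) (zero_mem_normalDomain x) hL hL0 hn (hr x)).2.1 X)

end ParallelHypersurfaces

/-! ### Uniqueness of the unit normal up to a locally constant sign -/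

noncomputable section UnitNormals

variable {E₀ : Type*} [NormedAddCommGroup E₀] [NormedSpace ℝ E₀]
  {E : Type*} [NormedAddCommGroup E] [NormedSpace ℝ E]
  {P : Type*} [TopologicalSpace P] [ChartedSpace E P] [IsManifold 𝓘(ℝ, E) ∞ P]
  {M : Type*} [TopologicalSpace M]
  {g : SmoothMetric E P} {f : M → P} {V V₁ : M → E} {x₀ : M}

theorem continuousAt_innerE [FiniteDimensional ℝ E] (hf : ContinuousAt f x₀)
    (hV : ContinuousAt (fun x => coordMap (f x₀) (f x) (V x)) x₀)
    (hV₁ : ContinuousAt (fun x => coordMap (f x₀) (f x) (V₁ x)) x₀) :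
    ContinuousAt (fun x => innerE g (f x) (V x) (V₁ x)) x₀ := by
  have hq := mem_extChartAt_source (I := 𝓘(ℝ, E)) (f x₀)
  have hφ : ContinuousAt (fun x => extChartAt 𝓘(ℝ, E) (f x₀) (f x)) x₀ :=
    ContinuousAt.comp (continuousAt_extChartAt (f x₀)) hf
  have hG : ContinuousAt (fun x => chartMetric g (f x₀) (extChartAt 𝓘(ℝ, E) (f x₀) (f x))) x₀ :=
    ContinuousAt.comp (f := fun x => extChartAt 𝓘(ℝ, E) (f x₀) (f x)) (g := chartMetric g (f x₀))
      (contDiffAt_chartMetric g ((extChartAt 𝓘(ℝ, E) (f x₀)).map_source hq)).continuousAt hφ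
  refine ((hG.clm_apply hV).clm_apply hV₁).congr ?_
  filter_upwards [eventually_mem_source hf hq] with x hx
  exact chartMetric_coordMap g hx _ _

theorem eq_zero_of_innerE_self_eq_zero {x : P} {w : E} (h : innerE g x w w = 0) : w = 0 := by
  by_contra h0
  exact (innerE_pos g x h0).ne' h

/-- Two unit vectors orthogonal to the same hyperplane agree up to sign. -/
theorem unitNormal_unique [FiniteDimensional ℝ E] (hdim : Module.finrank ℝ E = Module.finrank ℝ E₀ + 1) {x : P}
    {v w : E} (hv : innerE g x v v = 1) (hw : innerE g x w w = 1) {A : E₀ →L[ℝ] E}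
    (hA : Function.Injective A) (hAv : ∀ X, innerE g x v (A X) = 0)
    (hAw : ∀ X, innerE g x w (A X) = 0) :
    w = innerE g x v w • v ∧ (innerE g x v w = 1 ∨ innerE g x v w = -1) := by
  set c := innerE g x v w with hc
  have h1 : innerE g x v (w - c • v) = 0 := by
    rw [map_sub, map_smul, hv, smul_eq_mul, mul_one, sub_self]
  obtain ⟨X, hX⟩ := range_eq_normalSpace hdim hv hA hAv h1
  have h2 : innerE g x (w - c • v) (w - c • v) = 0 := by
    have h3 : innerE g x (w - c • v) (A X) = 0 := by
      rw [map_sub, map_smul, sub_apply, smul_apply, hAw, hAv, smul_zero, sub_zero]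
    rwa [hX] at h3
  have h3 := sub_eq_zero.1 (eq_zero_of_innerE_self_eq_zero h2)
  refine ⟨h3, ?_⟩
  have h4 : innerE g x (c • v) (c • v) = 1 := by rw [← h3, hw]
  rw [map_smul, map_smul, smul_apply, hv, smul_eq_mul, smul_eq_mul, mul_one] at h4
  exact mul_self_eq_one_iff.1 h4

/-- A unit normal vector field with a differentiable unit normal comparison field. -/
theorem eventuallyEq_smul_of_unitNormal [FiniteDimensional ℝ E] (hdim : Module.finrank ℝ E = Module.finrank ℝ E₀ + 1)
    {A : M → E₀ →L[ℝ] E} (hf : ContinuousAt f x₀)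
    (hV : ContinuousAt (fun x => coordMap (f x₀) (f x) (V x)) x₀)
    (hV₁ : ContinuousAt (fun x => coordMap (f x₀) (f x) (V₁ x)) x₀)
    (hVV : ∀ x, innerE g (f x) (V x) (V x) = 1) (hVV₁ : ∀ x, innerE g (f x) (V₁ x) (V₁ x) = 1)
    (hA : ∀ x, Function.Injective (A x)) (hAV : ∀ x X, innerE g (f x) (V x) (A x X) = 0)
    (hAV₁ : ∀ x X, innerE g (f x) (V₁ x) (A x X) = 0) :
    ∃ c : ℝ, c * c = 1 ∧ V₁ =ᶠ[𝓝 x₀] fun x => c • V x := by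
  have hu := fun x => unitNormal_unique hdim (hVV x) (hVV₁ x) (hA x) (hAV x) (hAV₁ x)
  have hc := continuousAt_innerE (g := g) hf hV hV₁
  -- The scalar product is continuous and only takes the values `±1`, which are `2` apart, so it is
  -- constant near `x₀`.
  have hlt : ∀ᶠ x in 𝓝 x₀, |innerE g (f x) (V x) (V₁ x) - innerE g (f x₀) (V x₀) (V₁ x₀)| < 1 := by
    have := Metric.continuousAt_iff'.1 hc 1 one_pos
    exact this
  refine ⟨innerE g (f x₀) (V x₀) (V₁ x₀), by rcases (hu x₀).2 with h | h <;> rw [h] <;> norm_num, ?_⟩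
  filter_upwards [hlt] with x hx
  have h1 : innerE g (f x) (V x) (V₁ x) = innerE g (f x₀) (V x₀) (V₁ x₀) := by
    rcases (hu x).2 with h | h <;> rcases (hu x₀).2 with h' | h' <;> rw [h, h'] at hx ⊢ <;>
      norm_num at hx
  rw [← h1]
  exact (hu x).1

theorem covAlong_smul [ChartedSpace E₀ M] (hf : ContinuousAt f x₀) {u' V' : E₀ →L[ℝ] E}
    (hu : HasMFDerivAt 𝓘(ℝ, E₀) 𝓘(ℝ, E) (fun x => extChartAt 𝓘(ℝ, E) (f x₀) (f x)) x₀ u')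
    (hV : HasMFDerivAt 𝓘(ℝ, E₀) 𝓘(ℝ, E) (fun x => coordMap (f x₀) (f x) (V x)) x₀ V') {c : ℝ}
    (hc : V₁ =ᶠ[𝓝 x₀] fun x => c • V x) : covAlong (E₀ := E₀) g f V₁ x₀ = c • covAlong g f V x₀ := by
  have hV₁ : HasMFDerivAt 𝓘(ℝ, E₀) 𝓘(ℝ, E) (fun x => coordMap (f x₀) (f x) (V₁ x)) x₀
      (c • V' : E₀ →L[ℝ] E) := by
    refine hasMFDerivAt_iff_hasFDerivAt_symm.2 ?_
    refine ((hasMFDerivAt_iff_hasFDerivAt_symm.1 hV).const_smul c).congr_of_eventuallyEq ?_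
    have h4 := continuousAt_extChartAt_symm (I := 𝓘(ℝ, E₀)) x₀
    rw [ContinuousAt, extChartAt_to_inv] at h4
    filter_upwards [h4.eventually hc] with y hy
    rw [hy, map_smul]
    rfl
  ext X
  rw [covAlong_eq g hf hu hV₁, hc.eq_of_nhds, smul_apply, smul_apply, covAlong_eq g hf hu hV,
    map_smul, smul_add]

end UnitNormals

/-! ### The mean curvature vector of a parallel hypersurface -/

noncomputable section MeanCurvatureFlow

theorem uniqueDiffOn_timeInterval {δ : EReal} (hδ : 0 < δ) :
    UniqueDiffOn ℝ (timeInterval δ) := by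
  obtain ⟨s, hs, hs'⟩ := EReal.lt_iff_exists_real_btwn.1 hδ
  have hs0 : (0 : ℝ) < s := by exact_mod_cast hs
  have hsub : Icc 0 s ⊆ timeInterval δ := fun t ht =>
    ⟨ht.1, lt_of_le_of_lt (by exact_mod_cast ht.2) hs'⟩
  refine uniqueDiffOn_convex ?_ ?_
  · refine OrdConnected.convex ⟨fun a ha b hb c hc => ⟨ha.1.trans hc.1, lt_of_le_of_lt ?_ hb.2⟩⟩
    exact_mod_cast hc.2
  · refine ⟨s / 2, interior_mono hsub ?_⟩
    rw [interior_Icc]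
    exact ⟨by linarith, by linarith⟩

/-- The parameter of a reparametrized curve is differentiable if both curves are. -/
theorem hasDerivWithinAt_of_comp_eq {E : Type*} [NormedAddCommGroup E] [NormedSpace ℝ E]
    {u w : ℝ → E} {ε : ℝ → ℝ} {S : Set ℝ} {t c : ℝ} {v : E} {ℓ : E →L[ℝ] ℝ} (hv : ℓ v = 1)
    (hu : HasStrictDerivAt u v (ε t)) (hw : HasDerivWithinAt w (c • v) S t)
    (hε : ContinuousWithinAt ε S t) (hwu : ∀ᶠ s in 𝓝[S] t, w s = u (ε s)) (ht : t ∈ S) :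
    HasDerivWithinAt ε c S t := by
  -- The scalar function `ℓ ∘ u` has a local inverse at `ε t`, so near `t` the parameter is that
  -- inverse composed with `ℓ ∘ w`. Continuity of `ε` keeps its values where the inverse is valid.
  have hk : HasStrictDerivAt (fun r => ℓ (u r)) 1 (ε t) := by
    rw [← hv]
    exact ℓ.hasStrictFDerivAt.comp_hasStrictDerivAt (ε t) hu
  have hm : HasDerivWithinAt (fun s => ℓ (w s)) c S t := by
    have := ℓ.hasFDerivAt.comp_hasDerivWithinAt t hw
    rw [map_smul, hv, smul_eq_mul, mul_one] at this
    exact this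
  have hleft := hk.eventually_left_inverse one_ne_zero
  have hinv := (hk.to_localInverse one_ne_zero).hasDerivAt
  have hwt : w t = u (ε t) := hwu.self_of_nhdsWithin ht
  have h1 : HasDerivWithinAt (fun s => hk.localInverse _ _ _ one_ne_zero (ℓ (w s))) _ S t :=
    HasDerivAt.comp_hasDerivWithinAt (h₂ := hk.localInverse _ _ _ one_ne_zero) t
      (by rw [hwt]; exact hinv) hm
  rw [inv_one, one_mul] at h1
  refine h1.congr_of_eventuallyEq ?_ ?_
  · filter_upwards [hwu, hε.eventually hleft] with s hs hs'
    rw [hs, hs']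
  · rw [hwt, hleft.self_of_nhds]

variable {n : ℕ}
  {P : Type*} [TopologicalSpace P] [ChartedSpace (EuclideanSpace ℝ (Fin (n + 1))) P]
  [IsManifold (𝓡 (n + 1)) ∞ P] [T2Space P]
  {M : Type*} [TopologicalSpace M] [ChartedSpace (EuclideanSpace ℝ (Fin n)) M]
  {g : SmoothMetric (EuclideanSpace ℝ (Fin (n + 1))) P} {f : M → P}
  {N : ∀ x, TangentSpace (𝓡 (n + 1)) (f x)} {r : ℝ}

local notation "E₀" => EuclideanSpace ℝ (Fin n)
local notation "E₁" => EuclideanSpace ℝ (Fin (n + 1))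

/-- A unit normal field of a parallel hypersurface is, up to a locally constant sign, the velocity
of the normal geodesics. -/
theorem eventuallyEq_smul_velocityE (hf : IsHypersurface n f) (hN : IsUnitNormal g f N)
    (hr : ∀ y, r ∈ normalDomain g f N y)
    (hΦ : IsHypersurface n fun y => normalGeodesic g f N y r)
    {ν : ∀ y, TangentSpace (𝓡 (n + 1)) (normalGeodesic g f N y r)}
    (hν : IsUnitNormal g (fun y => normalGeodesic g f N y r) ν) (x : M) :
    ∃ c : ℝ, c * c = 1 ∧
      (normalE ν : M → E₁) =ᶠ[𝓝 x] fun y => c • velocityE (normalGeodesic g f N y) r := by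
  obtain ⟨D, hD⟩ := exists_isJacobiTensor hf hN x
  obtain ⟨L, hL, hL0, hn, hcov, hvar⟩ := hD.exists_hasVariation hf hN
  have hv := hvar r hr
  have hm := hv.hasMFDerivAt (mem_extChartAt_source (I := 𝓘(ℝ, E₁)) (normalGeodesic g f N x r))
  exact eventuallyEq_smul_of_unitNormal (g := g) (f := fun y => normalGeodesic g f N y r)
    (V := fun y => velocityE (normalGeodesic g f N y) r) (V₁ := normalE ν)
    (A := fun y => mfderivE (fun y => normalGeodesic g f N y r) y)
    finrank_eq_finrank_add_one hv.1 hm.2.1 (hν.hasMFDerivAt x).2.1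
    (fun y => hN.innerE_velocityE (hr y)) hν.innerE_self hΦ.injective_mfderivE
    (innerE_velocityE_mfderivE hf hN hr) hν.innerE_mfderivE

/-- The velocity field of the normal geodesics is a smooth unit normal field of a smooth parallel
hypersurface. -/
theorem isUnitNormal_velocity (hf : IsHypersurface n f) (hN : IsUnitNormal g f N)
    (hr : ∀ y, r ∈ normalDomain g f N y)
    (hΦ : IsHypersurface n fun y => normalGeodesic g f N y r)
    {ν : ∀ y, TangentSpace (𝓡 (n + 1)) (normalGeodesic g f N y r)}
    (hν : IsUnitNormal g (fun y => normalGeodesic g f N y r) ν) :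
    IsUnitNormal g (fun y => normalGeodesic g f N y r)
      (fun y => velocity (normalGeodesic g f N y) r) := by
  refine ⟨fun x => ?_, fun x => ⟨hN.innerE_velocityE (hr x),
    fun X => innerE_velocityE_mfderivE hf hN hr x X⟩⟩
  obtain ⟨c, hc, heq⟩ := eventuallyEq_smul_velocityE hf hN hr hΦ hν x
  obtain ⟨h1, h2⟩ := contMDiffAt_vectorField_iff.1 (hν.1 x)
  refine contMDiffAt_vectorField_iff.2 ⟨h1, ?_⟩
  -- Since `c² = 1`, the velocity is locally `c • ν` and inherits smoothness from the given normal
  -- field. No smooth dependence of geodesics beyond first order is needed.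
  have h3 : ContMDiffAt 𝓘(ℝ, E₀) 𝓘(ℝ, E₁) ∞ (fun y => c • coordMap (normalGeodesic g f N x r)
      (normalGeodesic g f N y r) (normalE ν y)) x :=
    (c • ContinuousLinearMap.id ℝ E₁).contMDiff.contMDiffAt.comp x h2
  refine h3.congr_of_eventuallyEq ?_
  filter_upwards [heq] with y hy
  rw [hy, map_smul, smul_smul, hc, one_smul]
  rfl

/-- The mean curvature vector does not depend on the unit normal field. -/
theorem meanCurvature_smul_eq (hf : IsHypersurface n f) (hN : IsUnitNormal g f N)
    (hr : ∀ y, r ∈ normalDomain g f N y)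
    (hΦ : IsHypersurface n fun y => normalGeodesic g f N y r)
    {ν : ∀ y, TangentSpace (𝓡 (n + 1)) (normalGeodesic g f N y r)}
    (hν : IsUnitNormal g (fun y => normalGeodesic g f N y r) ν) (x : M) :
    meanCurvature g (fun y => normalGeodesic g f N y r) ν x • normalE ν x =
      meanCurvature g (fun y => normalGeodesic g f N y r)
        (fun y => velocity (normalGeodesic g f N y) r) x •
          (velocityE (normalGeodesic g f N x) r : E₁) := by
  obtain ⟨c, hc, heq⟩ := eventuallyEq_smul_velocityE hf hN hr hΦ hν x
  have hv := (isUnitNormal_velocity hf hN hr hΦ hν).hasMFDerivAt x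
  have h1 : (covAlong g (fun y => normalGeodesic g f N y r) (normalE ν) x : E₀ →L[ℝ] E₁) =
      c • covAlong g (fun y => normalGeodesic g f N y r)
        (fun y => velocityE (normalGeodesic g f N y) r) x :=
    covAlong_smul (hΦ.1 x).continuousAt hv.1 hv.2 heq
  have h2 : shapeE g (fun y => normalGeodesic g f N y r) ν x =
      c • shapeE g (fun y => normalGeodesic g f N y r)
        (fun y => velocity (normalGeodesic g f N y) r) x := by
    have e : ∀ V : M → E₁, ∀ X : E₀, shapeE g (fun y => normalGeodesic g f N y r) (fun y => V y) x X =
      (mfderivE (fun y => normalGeodesic g f N y r) x : E₀ →L[ℝ] E₁).toLinearMap.leftInverse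
        (-covAlong g (fun y => normalGeodesic g f N y r) V x X) := fun V X => rfl
    refine LinearMap.ext fun X => ?_
    have e1 := e (normalE ν) X
    have e2 := e (fun y => velocityE (normalGeodesic g f N y) r) X
    rw [h1, smul_apply, ← smul_neg, map_smul, ← e2] at e1
    exact e1
  have h3 : meanCurvature g (fun y => normalGeodesic g f N y r) ν x =
      c * meanCurvature g (fun y => normalGeodesic g f N y r)
        (fun y => velocity (normalGeodesic g f N y) r) x := by
    have e : ∀ ν', meanCurvature g (fun y => normalGeodesic g f N y r) ν' x =
      LinearMap.trace ℝ E₀ (shapeE g (fun y => normalGeodesic g f N y r) ν' x) / n :=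
      fun ν' => rfl
    rw [e, e, h2, map_smul, smul_eq_mul, mul_div_assoc]
  -- Changing the sign of the normal changes the sign of the mean curvature too, and `c² = 1`.
  rw [h3, heq.eq_of_nhds, smul_smul, mul_right_comm, hc, one_mul]

end MeanCurvatureFlow

/-! ### The equation for the parameter and the isoparametric property -/

noncomputable section ReparametrizedParallelFlow

variable {n : ℕ}
  {P : Type*} [TopologicalSpace P] [ChartedSpace (EuclideanSpace ℝ (Fin (n + 1))) P]
  [IsManifold (𝓡 (n + 1)) ∞ P]
  {M : Type*} [TopologicalSpace M] [ChartedSpace (EuclideanSpace ℝ (Fin n)) M]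
  {g : SmoothMetric (EuclideanSpace ℝ (Fin (n + 1))) P} {f : M → P}
  {N : ∀ x, TangentSpace (𝓡 (n + 1)) (f x)} {T δ : EReal} {F : M → ℝ → P} {ε : ℝ → ℝ}

local notation "E₀" => EuclideanSpace ℝ (Fin n)
local notation "E₁" => EuclideanSpace ℝ (Fin (n + 1))

theorem timeInterval_mono (h : δ ≤ T) : timeInterval δ ⊆ timeInterval T :=
  fun _ ht => ⟨ht.1, ht.2.trans_le h⟩

theorem Icc_subset_timeInterval {t : ℝ} (ht : t ∈ timeInterval δ) : Icc 0 t ⊆ timeInterval δ :=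
  fun _ hs => ⟨hs.1, lt_of_le_of_lt (EReal.coe_le_coe_iff.2 hs.2) ht.2⟩

/-- The velocity of a point under the mean curvature flow, in the chart at `q`. -/
theorem IsMCFSolution.hasDerivWithinAt_extChartAt (hF : IsMCFSolution g f T F) {t : ℝ}
    (ht : t ∈ timeInterval T) (x : M) {q : P} (hq : F x t ∈ (extChartAt 𝓘(ℝ, E₁) q).source) :
    HasDerivWithinAt (fun s => extChartAt 𝓘(ℝ, E₁) q (F x s))
      (coordMap q (F x t) (mfderivWithin 𝓘(ℝ, ℝ) (𝓡 (n + 1)) (F x) (timeInterval T) t (1 : ℝ)))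
      (timeInterval T) t := by
  have h1 : ContMDiffWithinAt 𝓘(ℝ, ℝ) 𝓘(ℝ, E₁) ∞ (F x) (timeInterval T) t :=
    (hF.1 (x, t) ⟨mem_univ _, ht⟩).comp (f := fun s : ℝ => (x, s)) t
      (contMDiff_const.prodMk contMDiff_id _).contMDiffWithinAt fun s hs => ⟨mem_univ _, hs⟩
  have h2 := (h1.mdifferentiableWithinAt (by simp)).hasMFDerivWithinAt
  have h3 : HasMFDerivAt 𝓘(ℝ, E₁) 𝓘(ℝ, E₁) (extChartAt 𝓘(ℝ, E₁) q) (F x t)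
      (mfderiv 𝓘(ℝ, E₁) 𝓘(ℝ, E₁) (extChartAt 𝓘(ℝ, E₁) q) (F x t)) :=
    ((contMDiffAt_extChartAt' (n := ∞) (by simpa using hq)).mdifferentiableAt
      (by simp)).hasMFDerivAt
  have h4 := h3.comp_hasMFDerivWithinAt t h2
  have h5 : HasFDerivWithinAt (fun s => extChartAt 𝓘(ℝ, E₁) q (F x s))
      ((coordMap q (F x t)).comp (show ℝ →L[ℝ] E₁ from
        mfderivWithin 𝓘(ℝ, ℝ) (𝓡 (n + 1)) (F x) (timeInterval T) t)) (timeInterval T) t :=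
    hasMFDerivWithinAt_iff_hasFDerivWithinAt.1 h4
  exact h5.hasDerivWithinAt

theorem IsRPF.eq_normalGeodesic (hε : IsRPF g f N F δ ε) {t : ℝ} (ht : t ∈ timeInterval δ) :
    (fun x => F x t) = fun x => normalGeodesic g f N x (ε t) :=
  funext fun x => (hε.2.2 t ht x).2

theorem IsUnitNormal.neg (hN : IsUnitNormal g f N) : IsUnitNormal g f fun x => -N x := by
  refine ⟨fun x => ?_, fun x => ⟨?_, fun X => ?_⟩⟩
  · obtain ⟨h1, h2⟩ := contMDiffAt_vectorField_iff.1 (hN.1 x)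
    refine contMDiffAt_vectorField_iff.2 ⟨h1, ?_⟩
    have h3 : ContMDiffAt 𝓘(ℝ, E₀) 𝓘(ℝ, E₁) ∞ (fun y => -coordMap (f x) (f y) (normalE N y)) x :=
      (-ContinuousLinearMap.id ℝ E₁).contMDiff.contMDiffAt.comp x h2
    refine h3.congr_of_eventuallyEq (Filter.Eventually.of_forall fun y => ?_)
    exact map_neg (coordMap (f x) (f y)) (normalE N y)
  · have := (hN.2 x).1
    rw [map_neg, map_neg, neg_apply, neg_neg, this]
  · have := (hN.2 x).2 X
    rw [map_neg, neg_apply, this, neg_zero]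

theorem IsRPF.neg (hε : IsRPF g f N F δ ε) : IsRPF g f (fun x => -N x) F δ fun t => -ε t := by
  refine ⟨hε.1.neg, by simp [hε.2.1], fun t ht x => ?_⟩
  have h := hε.2.2 t ht x
  simp only [normalDomain, normalGeodesic, neg_smul_neg, mem_ofPred_eq] at h ⊢
  exact h

theorem isHypersurface_of_isRPF (hF : IsMCFSolution g f T F) (hδT : δ ≤ T)
    (hε : IsRPF g f N F δ ε) {t : ℝ} (ht : t ∈ timeInterval δ) :
    IsHypersurface n fun x => normalGeodesic g f N x (ε t) := by
  rw [← hε.eq_normalGeodesic ht]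
  exact (hF.2.2 t (timeInterval_mono hδT ht)).1

theorem exists_isUnitNormal_of_isRPF (hF : IsMCFSolution g f T F) (hδT : δ ≤ T)
    (hε : IsRPF g f N F δ ε) {t : ℝ} (ht : t ∈ timeInterval δ) :
    ∃ ν : ∀ x, TangentSpace (𝓡 (n + 1)) (normalGeodesic g f N x (ε t)),
      IsUnitNormal g (fun x => normalGeodesic g f N x (ε t)) ν ∧ ∀ x : M,
        (mfderivWithin 𝓘(ℝ, ℝ) (𝓡 (n + 1)) (F x) (timeInterval T) t (1 : ℝ) : E₁) =
          meanCurvature g (fun x => normalGeodesic g f N x (ε t)) ν x • normalE ν x := by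
  -- The tangent spaces containing `ν` depend on the map, so the equality of maps is substituted
  -- before `ν` is chosen.
  have key : ∀ G : M → P, (fun x => F x t) = G →
      ∃ ν : ∀ x, TangentSpace (𝓡 (n + 1)) (G x), IsUnitNormal g G ν ∧ ∀ x : M,
        (mfderivWithin 𝓘(ℝ, ℝ) (𝓡 (n + 1)) (F x) (timeInterval T) t (1 : ℝ) : E₁) =
          meanCurvature g G ν x • normalE ν x := by
    rintro _ rfl
    exact (hF.2.2 t (timeInterval_mono hδT ht)).2
  exact key _ (hε.eq_normalGeodesic ht)

variable [T2Space P]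

/-- The parameter of a reparametrization of the parallel flow by mean curvature moves with the mean
curvature of the parallel hypersurfaces. -/
theorem IsRPF.hasDerivWithinAt (hf : IsHypersurface n f) (hN : IsUnitNormal g f N)
    (hF : IsMCFSolution g f T F) (hδT : δ ≤ T) (hε : IsRPF g f N F δ ε) {t : ℝ}
    (ht : t ∈ timeInterval δ) (x : M) :
    HasDerivWithinAt ε (meanCurvature g (fun y => normalGeodesic g f N y (ε t))
        (fun y => velocity (normalGeodesic g f N y) (ε t)) x) (timeInterval δ) t := by
  have hr : ∀ y, ε t ∈ normalDomain g f N y := fun y => (hε.2.2 t ht y).1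
  obtain ⟨ν, hν, hνF⟩ := exists_isUnitNormal_of_isRPF hF hδT hε ht
  have hq := mem_extChartAt_source (I := 𝓘(ℝ, E₁)) (normalGeodesic g f N x (ε t))
  have hFx : F x t = normalGeodesic g f N x (ε t) := (hε.2.2 t ht x).2
  have hγ := isGeodesicOn_normalGeodesic (g := g) (f := f) (N := N) x
  have hw := (hF.hasDerivWithinAt_extChartAt (timeInterval_mono hδT ht) x
    (hFx.symm ▸ hq)).mono (timeInterval_mono hδT)
  rw [hνF x, meanCurvature_smul_eq hf hN hr (isHypersurface_of_isRPF hF hδT hε ht) hν x,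
    map_smul, hFx] at hw
  have hu := (contDiffAt_extChartAt_comp hγ.1 hγ.2.1 (hr x) hq).hasStrictDerivAt (by simp)
  rw [(eventually_chartState hγ.1 hγ.2.1 (hr x) hq).self_of_nhds.deriv] at hu
  -- The functional `ℓ` is the scalar product with `γ_x'(ε t)`, which takes the value `1` on the
  -- velocity because the geodesic has unit speed.
  refine hasDerivWithinAt_of_comp_eq ?_ hu hw (hε.1 t ht) ?_ ht
    (ℓ := chartMetric g (normalGeodesic g f N x (ε t)) (extChartAt 𝓘(ℝ, E₁) (normalGeodesic g f N x (ε t))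
      (normalGeodesic g f N x (ε t))) (coordMap (normalGeodesic g f N x (ε t))
        (normalGeodesic g f N x (ε t)) (velocityE (normalGeodesic g f N x) (ε t) : E₁)))
  · rw [chartMetric_coordMap g hq]
    exact hN.innerE_velocityE (hr x)
  · filter_upwards [self_mem_nhdsWithin] with s hs
    rw [(hε.2.2 s hs x).2]

/-- Continuity and `ε 0 = 0` make every `r` in `[0, ε t₁)` a value `ε t`, so `Φ_r` is a time slice
of the flow. Its mean curvature at each point equals the derivative of `ε` at `t`, a number
independent of the point. -/
theorem IsRPF.isIsoparametric (hf : IsHypersurface n f) (hN : IsUnitNormal g f N)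
    (hF : IsMCFSolution g f T F) (hδ : 0 < δ) (hδT : δ ≤ T) (hε : IsRPF g f N F δ ε)
    (h : ∃ t ∈ timeInterval δ, 0 < ε t) : IsIsoparametric g f N := by
  obtain ⟨t₁, ht₁, hpos⟩ := h
  refine ⟨ε t₁, hpos, fun r hr0 hr => ?_⟩
  obtain ⟨t, ht, rfl⟩ : r ∈ ε '' Icc 0 t₁ :=
    intermediate_value_Icc ht₁.1 (hε.1.mono (Icc_subset_timeInterval ht₁))
      ⟨hε.2.1.trans_le hr0, hr.le⟩
  replace ht := Icc_subset_timeInterval ht₁ ht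
  have hdom : ∀ y, ε t ∈ normalDomain g f N y := fun y => (hε.2.2 t ht y).1
  have hΦ := isHypersurface_of_isRPF hF hδT hε ht
  obtain ⟨ν, hν, -⟩ := exists_isUnitNormal_of_isRPF hF hδT hε ht
  exact ⟨hdom, hΦ, isUnitNormal_velocity hf hN hdom hΦ hν, derivWithin ε (timeInterval δ) t,
    fun x => ((hε.hasDerivWithinAt hf hN hF hδT ht x).derivWithin
      (uniqueDiffOn_timeInterval hδ t ht)).symm⟩

end ReparametrizedParallelFlow

theorem lemma3p1 {n : ℕ} (hn : 1 ≤ n)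
    {P : Type*} [TopologicalSpace P] [T2Space P]
    [ChartedSpace (EuclideanSpace ℝ (Fin (n + 1))) P] [IsManifold (𝓡 (n + 1)) ∞ P]
    (g : SmoothMetric (EuclideanSpace ℝ (Fin (n + 1))) P)
    {M : Type*} [TopologicalSpace M]
    [ChartedSpace (EuclideanSpace ℝ (Fin n)) M] [IsManifold (𝓡 n) ∞ M]
    (f : M → P) (hf : IsHypersurface n f)
    (N : ∀ x, TangentSpace (𝓡 (n + 1)) (f x)) (hN : IsUnitNormal g f N)
    (T : EReal) (F : M → ℝ → P) (hF : IsMCFSolution g f T F)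
    (δ : EReal) (hδ : 0 < δ) (hδT : δ ≤ T)
    (ε : ℝ → ℝ) (hε : IsRPF g f N F δ ε) :
    ((∃ t ∈ timeInterval δ, 0 < ε t) → IsIsoparametric g f N) ∧
    ((∃ t ∈ timeInterval δ, ε t < 0) → IsIsoparametric g f (fun x => -N x)) ∧
    (∀ x, ∃ D : NormalEndField g (normalGeodesic g f N x), IsJacobiTensor g f N x D) ∧
    (∀ x, ∀ D : NormalEndField g (normalGeodesic g f N x), IsJacobiTensor g f N x D →
      ∀ t ∈ timeInterval δ,
        D.det (ε t) ≠ 0 ∧ DifferentiableAt ℝ D.det (ε t) ∧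
        HasDerivWithinAt ε (jacobiMeanCurvature D (ε t)) (timeInterval δ) t) ∧
    (∀ x y, ∀ D : NormalEndField g (normalGeodesic g f N x), IsJacobiTensor g f N x D →
      ∀ D' : NormalEndField g (normalGeodesic g f N y), IsJacobiTensor g f N y D' →
      ∀ t ∈ timeInterval δ,
        jacobiMeanCurvature D (ε t) = jacobiMeanCurvature D' (ε t)) := by
  have hr : ∀ t ∈ timeInterval δ, ∀ y, ε t ∈ normalDomain g f N y :=
    fun t ht y => (hε.2.2 t ht y).1
  have hJ : ∀ x, ∀ D : NormalEndField g (normalGeodesic g f N x), IsJacobiTensor g f N x D →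
      ∀ t ∈ timeInterval δ,
        D.det (ε t) ≠ 0 ∧ DifferentiableAt ℝ D.det (ε t) ∧
        HasDerivWithinAt ε (jacobiMeanCurvature D (ε t)) (timeInterval δ) t := by
    intro x D hD t ht
    obtain ⟨h1, h2, h3⟩ := hD.meanCurvature_eq hf hN (hr t ht)
      ((isHypersurface_of_isRPF hF hδT hε ht).injective_mfderivE x)
    exact ⟨h1, h2, h3 ▸ hε.hasDerivWithinAt hf hN hF hδT ht x⟩
  refine ⟨hε.isIsoparametric hf hN hF hδ hδT, fun ⟨t, ht, hneg⟩ => ?_,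
    exists_isJacobiTensor hf hN, hJ, fun x y D hD D' hD' t ht => ?_⟩
  -- Since `(-ε)(-N) = εN`, the same flow is a reparametrized parallel flow for `-N` with parameter
  -- `-ε`, which is positive at `t`.
  · exact hε.neg.isIsoparametric hf hN.neg hF hδ hδT ⟨t, ht, neg_pos.2 hneg⟩
  -- Both sides are the derivative of the same function `ε` at `t`, one-sided when `t = 0`.
  · exact (uniqueDiffOn_timeInterval hδ t ht).eq_deriv _ (hJ x D hD t ht).2.2
      (hJ y D' hD' t ht).2.2
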